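/- **Theorem 5.1.** Let $n\in\mathbb N$, $p\ge 1$, $\alpha>0$ with $2<\alpha p<2p+1$, and put $s:=\frac{\alpha p-1}{2p}\in(0,1)$, $\rho:=2p$. Let $W^{1+s,\rho}(\mathbb R/\mathbb Z,\mathbb R^n)$ be the Sobolev–Slobodeckij space of all closed curves $\gamma:\mathbb R/\mathbb Z\to\mathbb R^n$ (identified with their continuous representatives) with a weak derivative $\gamma'\in L^\rho$ such that $$\|\gamma\|_{W^{1+s,\rho}}^\rho:=\|\gamma\|_{L^\rho}^\rho+\|\gamma'\|_{L^\rho}^\rho+\iint_{(\mathbb R/\mathbb Z)^2}\frac{|\gamma'(x)-\gamma'(y)|^\rho}{|x-y|_{\mathbb R/\mathbb Z}^{1+s\rho}}\,dx\,dy<\infty,$$ and let $W^{1+s,\rho}_{\mathrm{ir}}(\mathbb R/\mathbb Z,\mathbb R^n)$ be the subset of those $\gamma$ which are injective on $\mathbb R/\mathbb Z$ and regular, i.e. $\gamma'(x)$ exists and is non-zero for every $x$. For such $\gamma$ let $$E^{\alpha,p}(\gamma):=\iint_{(\mathbb R/\mathbb Z)^2}\Big(\frac1{|\gamma(x)-\gamma(y)|^\alpha}-\frac1{d_\gamma(x,y)^\alpha}\Big)^p|\gamma'(x)|\,|\gamma'(y)|\,dx\,dy$$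 be O'Hara's energy, where the intrinsic distance $d_\gamma(x,y)$ is the length of the shorter of the two arcs of $\gamma$ connecting $\gamma(x)$ and $\gamma(y)$. Then $W^{1+s,\rho}_{\mathrm{ir}}(\mathbb R/\mathbb Z,\mathbb R^n)$ is an open subset of $W^{1+s,\rho}(\mathbb R/\mathbb Z,\mathbb R^n)$, the energy $E^{\alpha,p}$ is finite on it, and $E^{\alpha,p}$ is continuously Fréchet differentiable on it: every $\gamma\in W^{1+s,\rho}_{\mathrm{ir}}$ has a Fréchet derivative $DE^{\alpha,p}(\gamma)\in\big(W^{1+s,\rho}(\mathbb R/\mathbb Z,\mathbb R^n)\big)^*$, and $\gamma\mapsto DE^{\alpha,p}(\gamma)$ is continuous on $W^{1+s,\rho}_{\mathrm{ir}}$ in the dual norm. -/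

import Mathlib

open MeasureTheory Set
open scoped ENNReal ContDiff

noncomputable section

namespace KnotEnergy

/-! ### Sobolev–Slobodeckij spaces of closed curves -/

/-- `g` is a weak derivative of `f`: for the `1`-periodic lifts to `ℝ` and all real test functions
`φ ∈ C_c^∞(ℝ)` one has `∫ φ' f = - ∫ φ g`. (Used only for continuous `f` and integrable `g`.) -/
def HasWeakDeriv {n : ℕ} (f g : UnitAddCircle → EuclideanSpace ℝ (Fin n)) : Prop :=
  ∀ φ : ℝ → ℝ, ContDiff ℝ ∞ φ → HasCompactSupport φ →
    ∫ t : ℝ, deriv φ t • f (t : UnitAddCircle) = - ∫ t : ℝ, φ t • g (t : UnitAddCircle)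

/-- The fractional difference quotient `(g x - g y) / |x - y|^(s + 1/ρ)`, where `|x - y|` is the
distance on `ℝ/ℤ`. Its `L^ρ` norm on `(ℝ/ℤ)²` is the Gagliardo seminorm
`(∬ |g x - g y|^ρ / |x - y|^(1 + s ρ) dx dy)^(1/ρ)`. -/
def fracQuot {n : ℕ} (s ρ : ℝ) (g : UnitAddCircle → EuclideanSpace ℝ (Fin n)) :
    UnitAddCircle × UnitAddCircle → EuclideanSpace ℝ (Fin n) :=
  fun z => (dist z.1 z.2 ^ (s + 1 / ρ))⁻¹ • (g z.1 - g z.2)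

/-- `g` is a weak derivative of `f` and lies in `W^{s,ρ}(ℝ/ℤ, ℝⁿ)`. -/
structure IsSlobDeriv {n : ℕ} (s ρ : ℝ) (f g : UnitAddCircle → EuclideanSpace ℝ (Fin n)) :
    Prop where
  weak : HasWeakDeriv f g
  memLp : MemLp g (ENNReal.ofReal ρ) volume
  gagliardo : MemLp (fracQuot s ρ g) (ENNReal.ofReal ρ) volume

section aux

variable {n : ℕ}

instance factOfReal {ρ : ℝ} [h : Fact (1 ≤ ρ)] : Fact (1 ≤ ENNReal.ofReal ρ) :=
  ⟨by simpa using h.out⟩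

instance factTwoMul {p : ℝ} [h : Fact (1 ≤ p)] : Fact (1 ≤ 2 * p) :=
  ⟨by linarith [h.out]⟩

theorem locallyIntegrable_lift {g : UnitAddCircle → EuclideanSpace ℝ (Fin n)}
    (hg : Integrable g volume) : LocallyIntegrable (fun t : ℝ => g (t : UnitAddCircle)) := by
  have h1 : IntegrableOn (fun t : ℝ => g (t : UnitAddCircle)) (Ioc 0 (0 + 1)) :=
    (UnitAddCircle.measurePreserving_mk 0).integrable_comp_of_integrable hg
  have hper : Function.Periodic (fun t : ℝ => g (t : UnitAddCircle)) 1 := by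
    intro t; simp
  have h2 : ∀ a b : ℝ, IntervalIntegrable (fun t : ℝ => g (t : UnitAddCircle)) volume a b :=
    hper.intervalIntegrable (t := 0) one_ne_zero
      ((intervalIntegrable_iff_integrableOn_Ioc_of_le (by norm_num)).2 h1)
  rw [locallyIntegrable_iff]
  intro K hK
  obtain ⟨R, hR⟩ := hK.isBounded.subset_closedBall 0
  rw [Real.closedBall_eq_Icc] at hR
  by_cases hR0 : 0 - R ≤ 0 + R
  · exact ((intervalIntegrable_iff_integrableOn_Icc_of_le hR0).1 (h2 _ _)).mono_set hR
  · rw [Icc_eq_empty hR0] at hR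
    simp [subset_empty_iff.1 hR]

theorem integrable_test_smul {g : UnitAddCircle → EuclideanSpace ℝ (Fin n)}
    (hg : Integrable g volume) {φ : ℝ → ℝ} (hφ : Continuous φ) (hc : HasCompactSupport φ) :
    Integrable (fun t : ℝ => φ t • g (t : UnitAddCircle)) :=
  (locallyIntegrable_lift hg).integrable_smul_left_of_hasCompactSupport hφ hc

theorem ContinuousMap.integrable_circle (f : C(UnitAddCircle, EuclideanSpace ℝ (Fin n))) :
    Integrable f volume :=
  f.continuous.integrable_of_hasCompactSupport (HasCompactSupport.of_compactSpace f)

theorem fracQuot_add (s ρ : ℝ) (g h : UnitAddCircle → EuclideanSpace ℝ (Fin n)) :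
    fracQuot s ρ (g + h) = fracQuot s ρ g + fracQuot s ρ h := by
  funext z
  simp only [fracQuot, Pi.add_apply, ← smul_add]
  congr 1
  abel

theorem fracQuot_smul (s ρ c : ℝ) (g : UnitAddCircle → EuclideanSpace ℝ (Fin n)) :
    fracQuot s ρ (c • g) = c • fracQuot s ρ g := by
  funext z
  simp only [fracQuot, Pi.smul_apply, ← smul_sub]
  rw [smul_comm]

theorem fracQuot_congr (s ρ : ℝ) {g h : UnitAddCircle → EuclideanSpace ℝ (Fin n)}
    (hgh : g =ᵐ[volume] h) : fracQuot s ρ g =ᵐ[volume] fracQuot s ρ h := by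
  have h1 : ∀ᵐ z : UnitAddCircle × UnitAddCircle, g z.1 = h z.1 :=
    Measure.quasiMeasurePreserving_fst.ae hgh
  have h2 : ∀ᵐ z : UnitAddCircle × UnitAddCircle, g z.2 = h z.2 :=
    Measure.quasiMeasurePreserving_snd.ae hgh
  filter_upwards [h1, h2] with z hz1 hz2
  simp [fracQuot, hz1, hz2]

theorem IsSlobDeriv.smul {s ρ : ℝ} (c : ℝ) {f : C(UnitAddCircle, EuclideanSpace ℝ (Fin n))}
    {g : UnitAddCircle → EuclideanSpace ℝ (Fin n)} (h : IsSlobDeriv s ρ f g) :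
    IsSlobDeriv s ρ (c • f : C(UnitAddCircle, EuclideanSpace ℝ (Fin n))) (c • g) where
  weak φ hφ hc := by
    simp only [ContinuousMap.smul_apply, Pi.smul_apply, smul_comm _ c]
    rw [integral_smul, integral_smul, h.weak φ hφ hc, smul_neg]
  memLp := h.memLp.const_smul c
  gagliardo := by
    rw [fracQuot_smul]; exact h.gagliardo.const_smul c

theorem isSlobDeriv_zero {s ρ : ℝ} :
    IsSlobDeriv s ρ (0 : C(UnitAddCircle, EuclideanSpace ℝ (Fin n))) 0 where
  weak φ _ _ := by simp
  memLp := MemLp.zero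
  gagliardo := by
    have : fracQuot (n := n) s ρ 0 = 0 := by funext z; simp [fracQuot]
    rw [this]; exact MemLp.zero

variable {s ρ : ℝ} [Fact (1 ≤ ρ)]

theorem IsSlobDeriv.integrable {f g : UnitAddCircle → EuclideanSpace ℝ (Fin n)}
    (h : IsSlobDeriv s ρ f g) : Integrable g volume :=
  h.memLp.integrable Fact.out

theorem IsSlobDeriv.add {f f' : C(UnitAddCircle, EuclideanSpace ℝ (Fin n))}
    {g g' : UnitAddCircle → EuclideanSpace ℝ (Fin n)}
    (h : IsSlobDeriv s ρ f g) (h' : IsSlobDeriv s ρ f' g') :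
    IsSlobDeriv s ρ (f + f' : C(UnitAddCircle, EuclideanSpace ℝ (Fin n))) (g + g') where
  weak φ hφ hc := by
    have hd : Continuous (deriv φ) := hφ.continuous_deriv (by simp)
    simp only [ContinuousMap.add_apply, Pi.add_apply, smul_add]
    rw [integral_add (integrable_test_smul (ContinuousMap.integrable_circle f) hd hc.deriv)
        (integrable_test_smul (ContinuousMap.integrable_circle f') hd hc.deriv),
      integral_add (integrable_test_smul h.integrable hφ.continuous hc)
        (integrable_test_smul h'.integrable hφ.continuous hc),
      h.weak φ hφ hc, h'.weak φ hφ hc, neg_add]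
  memLp := h.memLp.add h'.memLp
  gagliardo := by
    rw [fracQuot_add]; exact h.gagliardo.add h'.gagliardo

/-- Weak derivatives are unique almost everywhere. -/
theorem IsSlobDeriv.ae_eq {f g g' : UnitAddCircle → EuclideanSpace ℝ (Fin n)}
    (h : IsSlobDeriv s ρ f g) (h' : IsSlobDeriv s ρ f g') : g =ᵐ[volume] g' := by
  have h1 : ∀ᵐ t : ℝ, g (t : UnitAddCircle) = g' (t : UnitAddCircle) :=
    ae_eq_of_integral_contDiff_smul_eq (locallyIntegrable_lift h.integrable)
      (locallyIntegrable_lift h'.integrable) fun φ hφ hc => by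
        have := (h.weak φ hφ hc).symm.trans (h'.weak φ hφ hc)
        exact neg_injective this
  have hmp := UnitAddCircle.measurePreserving_mk 0
  have hm : AEStronglyMeasurable (g - g') volume :=
    h.memLp.aestronglyMeasurable.sub h'.memLp.aestronglyMeasurable
  obtain ⟨u, hu, hgu⟩ := hm
  have h3 : ∀ᵐ x ∂(volume : Measure UnitAddCircle), u x = 0 := by
    rw [← hmp.map_eq]
    refine (ae_map_iff hmp.measurable.aemeasurable
      (hu.measurableSet_eq_fun stronglyMeasurable_zero)).2 ?_
    filter_upwards [ae_restrict_of_ae h1, hmp.quasiMeasurePreserving.ae hgu] with t ht ht'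
    rw [← ht']
    simp [ht]
  filter_upwards [h3, hgu] with x hx hx'
  have : (g - g') x = 0 := hx'.trans hx
  exact sub_eq_zero.1 this

end aux

/-- The vector space underlying `W^{1+s,ρ}(ℝ/ℤ, ℝⁿ)`: closed curves, each given by its continuous
representative, that possess a weak derivative in `W^{s,ρ}(ℝ/ℤ, ℝⁿ)`. -/
def slobSubmodule (s ρ : ℝ) [Fact (1 ≤ ρ)] (n : ℕ) :
    Submodule ℝ C(UnitAddCircle, EuclideanSpace ℝ (Fin n)) where
  carrier := {f | ∃ g, IsSlobDeriv s ρ f g}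
  add_mem' := fun ⟨g, hg⟩ ⟨g', hg'⟩ => ⟨g + g', hg.add hg'⟩
  zero_mem' := ⟨0, isSlobDeriv_zero⟩
  smul_mem' := fun c _ ⟨g, hg⟩ => ⟨c • g, hg.smul c⟩

/-- The Sobolev–Slobodeckij space `W^{1+s,ρ}(ℝ/ℤ, ℝⁿ)`. It is a type of its own, so that it carries
its own norm, defined below, and not the supremum norm. -/
def Slob (s ρ : ℝ) [Fact (1 ≤ ρ)] (n : ℕ) : Type :=
  ↥(slobSubmodule s ρ n)

section Slob

variable {s ρ : ℝ} [Fact (1 ≤ ρ)] {n : ℕ}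

instance : AddCommGroup (Slob s ρ n) := inferInstanceAs (AddCommGroup ↥(slobSubmodule s ρ n))

instance : Module ℝ (Slob s ρ n) := inferInstanceAs (Module ℝ ↥(slobSubmodule s ρ n))

namespace Slob

/-- The continuous closed curve `ℝ/ℤ → ℝⁿ` underlying an element of `W^{1+s,ρ}(ℝ/ℤ, ℝⁿ)`. -/
def curve (γ : Slob s ρ n) : C(UnitAddCircle, EuclideanSpace ℝ (Fin n)) := γ.1

theorem curve_injective : Function.Injective (curve : Slob s ρ n → _) :=
  fun _ _ h => Subtype.ext h

@[simp] theorem curve_add (γ η : Slob s ρ n) : (γ + η).curve = γ.curve + η.curve := rfl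

@[simp] theorem curve_smul (c : ℝ) (γ : Slob s ρ n) : (c • γ).curve = c • γ.curve := rfl

/-- The weak derivative of `γ`; it is determined up to null sets. -/
def wderiv (γ : Slob s ρ n) : UnitAddCircle → EuclideanSpace ℝ (Fin n) :=
  Classical.choose γ.2

theorem isSlobDeriv (γ : Slob s ρ n) : IsSlobDeriv s ρ γ.curve γ.wderiv :=
  Classical.choose_spec γ.2

theorem memLp_curve (γ : Slob s ρ n) : MemLp γ.curve (ENNReal.ofReal ρ) volume :=
  γ.curve.continuous.memLp_of_hasCompactSupport (HasCompactSupport.of_compactSpace _)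

theorem wderiv_add (γ η : Slob s ρ n) :
    (γ + η).wderiv =ᵐ[volume] γ.wderiv + η.wderiv :=
  (γ + η).isSlobDeriv.ae_eq (γ.isSlobDeriv.add η.isSlobDeriv)

theorem wderiv_smul (c : ℝ) (γ : Slob s ρ n) : (c • γ).wderiv =ᵐ[volume] c • γ.wderiv :=
  (c • γ).isSlobDeriv.ae_eq (γ.isSlobDeriv.smul c)

/-- The linear embedding of `W^{1+s,ρ}(ℝ/ℤ, ℝⁿ)` that sends `γ` to
`(γ, γ', (γ'(x) - γ'(y)) / |x - y|^(s + 1/ρ))` in the `ℓ^ρ`-sum of three `L^ρ` spaces. -/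
def embed (s ρ : ℝ) [Fact (1 ≤ ρ)] (n : ℕ) : Slob s ρ n →ₗ[ℝ]
    WithLp (ENNReal.ofReal ρ)
      (Lp (EuclideanSpace ℝ (Fin n)) (ENNReal.ofReal ρ) (volume : Measure UnitAddCircle) ×
        WithLp (ENNReal.ofReal ρ)
          (Lp (EuclideanSpace ℝ (Fin n)) (ENNReal.ofReal ρ) (volume : Measure UnitAddCircle) ×
            Lp (EuclideanSpace ℝ (Fin n)) (ENNReal.ofReal ρ)
              (volume : Measure (UnitAddCircle × UnitAddCircle)))) where
  toFun γ := WithLp.toLp _ (γ.memLp_curve.toLp _,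
    WithLp.toLp _ (γ.isSlobDeriv.memLp.toLp _, γ.isSlobDeriv.gagliardo.toLp _))
  map_add' γ η := by
    rw [← WithLp.toLp_add, Prod.mk_add_mk, ← WithLp.toLp_add, Prod.mk_add_mk,
      ← MemLp.toLp_add, ← MemLp.toLp_add, ← MemLp.toLp_add]
    congr 4
    · exact MemLp.toLp_congr _ _ (wderiv_add γ η)
    · refine MemLp.toLp_congr _ _ ?_
      rw [← fracQuot_add]
      exact fracQuot_congr s ρ (wderiv_add γ η)
  map_smul' c γ := by
    rw [RingHom.id_apply, ← WithLp.toLp_smul, Prod.smul_mk, ← WithLp.toLp_smul, Prod.smul_mk,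
      ← MemLp.toLp_const_smul, ← MemLp.toLp_const_smul, ← MemLp.toLp_const_smul]
    congr 4
    · exact MemLp.toLp_congr _ _ (wderiv_smul c γ)
    · refine MemLp.toLp_congr _ _ ?_
      rw [← fracQuot_smul]
      exact fracQuot_congr s ρ (wderiv_smul c γ)

theorem embed_injective : Function.Injective (embed s ρ n) := by
  intro γ η h
  have h1 : γ.memLp_curve.toLp _ = η.memLp_curve.toLp _ :=
    congrArg (fun w => (WithLp.ofLp w).1) h
  have h2 : (γ.curve : UnitAddCircle → _) = η.curve :=
    (MemLp.toLp_eq_toLp_iff _ _).1 h1 |> fun h =>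
      (Continuous.ae_eq_iff_eq volume γ.curve.continuous η.curve.continuous).1 h
  exact curve_injective (DFunLike.coe_injective h2)

end Slob

instance : NormedAddCommGroup (Slob s ρ n) :=
  NormedAddCommGroup.induced _ _ (Slob.embed s ρ n) Slob.embed_injective

instance : NormedSpace ℝ (Slob s ρ n) :=
  NormedSpace.induced ℝ (Slob s ρ n) _ (Slob.embed s ρ n)

/-- The norm written out:
`‖γ‖ = (‖γ‖_{L^ρ}^ρ + ‖γ'‖_{L^ρ}^ρ + ∬ |γ'(x) - γ'(y)|^ρ / |x - y|^(1 + s ρ) dx dy)^(1/ρ)`. -/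
theorem Slob.norm_def (γ : Slob s ρ n) :
    ‖γ‖ = ((eLpNorm γ.curve (ENNReal.ofReal ρ) volume).toReal ^ ρ +
      ((eLpNorm γ.wderiv (ENNReal.ofReal ρ) volume).toReal ^ ρ +
        (eLpNorm (fracQuot s ρ γ.wderiv) (ENNReal.ofReal ρ) volume).toReal ^ ρ)) ^ (1 / ρ) := by
  have h1 : (1 : ℝ) ≤ ρ := Fact.out
  have h0 : (0 : ℝ) < ρ := by linarith
  have h2 : (ENNReal.ofReal ρ).toReal = ρ := ENNReal.toReal_ofReal h0.le
  have h3 : 0 < (ENNReal.ofReal ρ).toReal := by rw [h2]; exact h0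
  change ‖Slob.embed s ρ n γ‖ = _
  rw [WithLp.prod_norm_eq_add h3, WithLp.prod_norm_eq_add h3, h2,
    ← Real.rpow_mul (by positivity), one_div_mul_cancel h0.ne', Real.rpow_one]
  simp [Slob.embed, Lp.norm_toLp]

end Slob

/-! ### O'Hara's energies -/

section Energy

variable {n : ℕ}

/-- The speed `|γ'(t)|` of the `1`-periodic lift of a closed curve. -/
def speed (γ : UnitAddCircle → EuclideanSpace ℝ (Fin n)) (t : ℝ) : ℝ :=
  ‖deriv (fun u : ℝ => γ (u : UnitAddCircle)) t‖

/-- The intrinsic distance `d_γ(x, y)`, for parameters `x, y ∈ [0, 1]`: the length of the shorter of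
the two arcs of the closed curve between `γ(x)` and `γ(y)`. One arc has length
`|∫_x^y |γ'||`, the other one is the rest of the curve. -/
def intrinsicDist (γ : UnitAddCircle → EuclideanSpace ℝ (Fin n)) (x y : ℝ) : ℝ :=
  min |∫ t in x..y, speed γ t| ((∫ t in (0 : ℝ)..1, speed γ t) - |∫ t in x..y, speed γ t|)

/-- O'Hara's energy
`E^{α,p}(γ) = ∬ (|γ(x) - γ(y)|^{-α} - d_γ(x,y)^{-α})^p |γ'(x)| |γ'(y)| dx dy ∈ [0, ∞]`,
the integral being taken over the fundamental domain `(0, 1]²` of `(ℝ/ℤ)²`. -/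
def oharaEnergy (α p : ℝ) (γ : UnitAddCircle → EuclideanSpace ℝ (Fin n)) : ℝ≥0∞ :=
  ∫⁻ z in Ioc (0 : ℝ) 1 ×ˢ Ioc (0 : ℝ) 1, ENNReal.ofReal
    ((1 / ‖γ (z.1 : UnitAddCircle) - γ (z.2 : UnitAddCircle)‖ ^ α
        - 1 / intrinsicDist γ z.1 z.2 ^ α) ^ p * speed γ z.1 * speed γ z.2)

/-- The set `W^{1+s,ρ}_{ir}(ℝ/ℤ, ℝⁿ)` of injective regular curves, where regular means that the
derivative exists and is different from zero at every point (in Lean, `deriv` is zero where the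
derivative does not exist). -/
def injReg (s ρ : ℝ) [Fact (1 ≤ ρ)] (n : ℕ) : Set (Slob s ρ n) :=
  {γ | Function.Injective γ.curve ∧
    ∀ t : ℝ, deriv (fun u : ℝ => γ.curve (u : UnitAddCircle)) t ≠ 0}

end Energy

end KnotEnergy

end

/-! Only the diagonal of the energy integral is singular. Let g = γ'. Between the parameters x and x
+ w, with 0 < w ≤ 1/2, the chord is w times the norm of the mean of g, and the arc is w times the
mean of |g|. The difference of the squares of these two means is the double mean of |g(a)||g(b)| -
⟨g(a), g(b)⟩ (`integral_csDefect`), which is non-negative and at most |g(a) - g(b)|²/2. So the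
bracket in the energy is at most a constant times the weighted square oscillation `sqOsc`. Since ρ =
2p and 1 + sρ = αp, Jensen's inequality and the Gagliardo seminorm bound the integral of the p-th
power of `sqOsc` by ‖γ‖^ρ. This gives finiteness.

For openness, sρ = αp - 1 > 1, so the norm controls γ' uniformly
(`exists_continuous_representative`). By compactness, injectivity and regularity amount to a
positive lower bound for the norms of the means of γ' (`IsTame`), and such a bound survives small
perturbations.

For differentiability, the density at a fixed pair of parameters is strictly differentiable in γ
unless the two arcs between the points are equally long, which happens only on a null set of pairs.
The difficulty is to pass to the integral: the difference quotients contain the oscillation of the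
normalised increment, which ranges over the whole unit sphere and has no common integrable majorant.
Young's inequality gives this term a coefficient 1/K at the price of a factor K elsewhere, with K ≥
1 arbitrary (`exists_density_lipschitz`). Fixing a large K and applying dominated convergence to a
truncated remainder yields strict differentiability of the integral
(`exists_hasStrictFDerivAt_integral`). Strict differentiability at all points of an open set already
implies continuity of the derivative (`continuousOn_fderiv_of_hasStrictFDerivAt`), so no formula for
it is needed. -/

namespace KnotEnergy
open Filter Topology

/-! ### Strict differentiability of integrals with a parameter -/

/-- The integral of a family `e γ` is strictly differentiable at `γ₀` if almost all of its values
are, and if the difference quotients of `e` are controlled by a family `P` of integrable weights. -/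
theorem exists_hasStrictFDerivAt_integral {X Ω : Type*} [NormedAddCommGroup X] [NormedSpace ℝ X]
    [MeasurableSpace Ω] {μ : Measure Ω} [IsFiniteMeasure μ] {γ₀ : X} {U : Set X} (hU : U ∈ 𝓝 γ₀)
    {e P : X → Ω → ℝ} {C q : ℝ} (hC : 0 ≤ C) (hq : 0 < q)
    (he : ∀ γ ∈ U, Integrable (e γ) μ)
    (hP0 : ∀ h z, 0 ≤ P h z) (hPi : ∀ h, Integrable (P h) μ)
    (hPn : ∀ h, ∫ z, P h z ∂μ ≤ C * ‖h‖ ^ q)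
    (hPh : ∀ (t : ℝ) h z, P (t • h) z = |t| ^ q * P h z)
    (hPa : ∀ h k z, P (h + k) z ≤ C * (P h z + P k z))
    (hlip : ∀ γ₁ ∈ U, ∀ γ₂ ∈ U, ∀ K : ℝ, 1 ≤ K → ∀ᵐ z ∂μ, |e γ₁ z - e γ₂ z| ≤
      C * ‖γ₁ - γ₂‖ * (K * (1 + P γ₁ z + P γ₂ z) +
        K⁻¹ * P (‖γ₁ - γ₂‖⁻¹ • (γ₁ - γ₂)) z))
    (hd : ∀ᵐ z ∂μ, ∃ D : X →L[ℝ] ℝ, HasStrictFDerivAt (fun γ => e γ z) D γ₀) :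
    ∃ D : X →L[ℝ] ℝ, HasStrictFDerivAt (fun γ => ∫ z, e γ z ∂μ) D γ₀ := by
  classical
  have hγ₀ : γ₀ ∈ U := mem_of_mem_nhds hU
  obtain ⟨D', hD'⟩ : ∃ D' : Ω → X →L[ℝ] ℝ, ∀ᵐ z ∂μ,
      HasStrictFDerivAt (fun γ => e γ z) (D' z) γ₀ := by
    -- The value 0 off the null set is a mere default. Nothing is known yet about measurability in
    -- `z`; it is recovered below from limits of difference quotients.
    refine ⟨fun z => if h : ∃ D : X →L[ℝ] ℝ, HasStrictFDerivAt (fun γ => e γ z) D γ₀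
      then h.choose else 0, ?_⟩
    filter_upwards [hd] with z hz
    rw [dif_pos hz]
    exact hz.choose_spec
  have hPu : ∀ h : X, ∫ z, P (‖h‖⁻¹ • h) z ∂μ ≤ C := by
    intro h
    refine (hPn _).trans ?_
    have h1 : ‖‖h‖⁻¹ • h‖ ≤ 1 := by
      rw [norm_smul, norm_inv, norm_norm]
      exact inv_mul_le_one
    have := Real.rpow_le_one (norm_nonneg _) h1 hq.le
    nlinarith
  -- a sequence approaching `γ₀` in direction `h`
  have hseq : ∀ h : X, ∃ t : ℕ → ℝ, (∀ k, 0 < t k) ∧ Tendsto t atTop (𝓝 0) ∧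
      ∀ k, γ₀ + t k • h ∈ U := by
    intro h
    have h1 : Tendsto (fun k : ℕ => 1 / ((k : ℝ) + 1)) atTop (𝓝 0) :=
      tendsto_one_div_add_atTop_nhds_zero_nat
    have h2 : Tendsto (fun k : ℕ => γ₀ + (1 / ((k : ℝ) + 1)) • h) atTop (𝓝 γ₀) := by
      simpa using (h1.smul_const h).const_add γ₀
    obtain ⟨N, hN⟩ := eventually_atTop.1 (h2.eventually hU)
    refine ⟨fun k => 1 / (((k + N : ℕ) : ℝ) + 1), fun k => by positivity,
      h1.comp (tendsto_add_atTop_nat N), fun k => hN _ (by omega)⟩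
  have hlim : ∀ (h : X) (t : ℕ → ℝ), (∀ k, 0 < t k) → Tendsto t atTop (𝓝 0) → ∀ z,
      HasStrictFDerivAt (fun γ => e γ z) (D' z) γ₀ →
      Tendsto (fun k => (t k)⁻¹ * (e (γ₀ + t k • h) z - e γ₀ z)) atTop (𝓝 (D' z h)) := by
    intro h t ht0 ht z hz
    have h2 : Tendsto (fun k => ‖(t k)⁻¹‖) atTop atTop := by
      have : Tendsto t atTop (𝓝[>] 0) :=
        tendsto_nhdsWithin_iff.2 ⟨ht, Eventually.of_forall ht0⟩
      exact tendsto_norm_atTop_atTop.comp (tendsto_inv_nhdsGT_zero.comp this)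
    have h3 := hz.hasFDerivAt.lim h h2
    simpa [smul_eq_mul] using h3
  have hDm : ∀ h, AEStronglyMeasurable (fun z => D' z h) μ := by
    intro h
    obtain ⟨t, ht0, ht, htU⟩ := hseq h
    refine aestronglyMeasurable_of_tendsto_ae atTop
      (f := fun k z => (t k)⁻¹ * (e (γ₀ + t k • h) z - e γ₀ z)) (fun k => ?_) ?_
    · exact (((he _ (htU k)).sub (he _ hγ₀)).const_mul _).aestronglyMeasurable
    · filter_upwards [hD'] with z hz using hlim h t ht0 ht z hz
  -- The Lipschitz bound passes to the limit along `γ₀ + t k • h`: the normalised increment is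
  -- `‖h‖⁻¹ • h` for every `k`, and the extra contribution `|t k| ^ q * P h z` to the weight
  -- vanishes.
  have hDb : ∀ h, ∀ K : ℝ, 1 ≤ K → ∀ᵐ z ∂μ, |D' z h| ≤
      C * ‖h‖ * (K * (1 + (C + 1) * P γ₀ z) + K⁻¹ * P (‖h‖⁻¹ • h) z) := by
    intro h K hK
    obtain ⟨t, ht0, ht, htU⟩ := hseq h
    have hall := ae_all_iff.2 fun k => hlip _ (htU k) _ hγ₀ K hK
    filter_upwards [hD', hall] with z hz hb
    have hl1 := (hlim h t ht0 ht z hz).abs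
    have hl2 : Tendsto (fun k => C * ‖h‖ * (K * (1 + C * (P γ₀ z + |t k| ^ q * P h z) + P γ₀ z)
        + K⁻¹ * P (‖h‖⁻¹ • h) z)) atTop (𝓝 (C * ‖h‖ * (K * (1 + C * (P γ₀ z + 0 * P h z) + P γ₀ z)
        + K⁻¹ * P (‖h‖⁻¹ • h) z))) := by
      have h0 : Tendsto (fun k => |t k| ^ q) atTop (𝓝 0) := by
        have := (ht.abs).rpow_const (p := q) (Or.inr hq.le)
        simpa [Real.zero_rpow hq.ne'] using this
      exact ((((((h0.mul_const _).const_add _).const_mul _).const_add _).add_const _).const_mul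
        _ |>.add_const _).const_mul _
    refine (le_of_tendsto_of_tendsto hl1 hl2 (Eventually.of_forall fun k => ?_)).trans
      (le_of_eq (by ring))
    have hk := hb k
    have e1 : γ₀ + t k • h - γ₀ = t k • h := by abel
    have e2 : ‖t k • h‖⁻¹ • (t k • h) = ‖h‖⁻¹ • h := by
      rw [norm_smul, Real.norm_of_nonneg (ht0 k).le, smul_smul]
      congr 1
      rw [mul_inv, mul_right_comm, inv_mul_cancel₀ (ht0 k).ne', one_mul]
    rw [e1, e2, norm_smul, Real.norm_of_nonneg (ht0 k).le] at hk
    have hPk : P (γ₀ + t k • h) z ≤ C * (P γ₀ z + |t k| ^ q * P h z) := by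
      rw [← hPh]; exact hPa _ _ _
    calc |(t k)⁻¹ * (e (γ₀ + t k • h) z - e γ₀ z)|
        = (t k)⁻¹ * |e (γ₀ + t k • h) z - e γ₀ z| := by
          rw [abs_mul, abs_of_pos (inv_pos.2 (ht0 k))]
      _ ≤ (t k)⁻¹ * (C * (t k * ‖h‖) * (K * (1 + P (γ₀ + t k • h) z + P γ₀ z) +
            K⁻¹ * P (‖h‖⁻¹ • h) z)) :=
          mul_le_mul_of_nonneg_left hk (inv_pos.2 (ht0 k)).le
      _ = C * ‖h‖ * (K * (1 + P (γ₀ + t k • h) z + P γ₀ z) + K⁻¹ * P (‖h‖⁻¹ • h) z) := by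
          have := (ht0 k).ne'
          field_simp
      _ ≤ C * ‖h‖ * (K * (1 + C * (P γ₀ z + |t k| ^ q * P h z) + P γ₀ z)
        + K⁻¹ * P (‖h‖⁻¹ • h) z) := by gcongr
  have hint : ∀ h K : ℝ, ∀ u : X, Integrable (fun z => h * (K * (1 + (C + 1) * P γ₀ z) +
      K⁻¹ * P u z)) μ := fun h K u =>
    ((((integrable_const _).add ((hPi γ₀).const_mul _)).const_mul _).add
      ((hPi u).const_mul _)).const_mul _
  have hDi : ∀ h, Integrable (fun z => D' z h) μ := by
    intro h
    refine (hint (C * ‖h‖) 1 (‖h‖⁻¹ • h)).mono' (hDm h) ?_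
    filter_upwards [hDb h 1 le_rfl] with z hz using hz
  let A : ℝ := ∫ z, (1 + (C + 1) * P γ₀ z) ∂μ
  have hDn : ∀ h, ‖∫ z, D' z h ∂μ‖ ≤ (C * (A + C)) * ‖h‖ := by
    intro h
    have h1 : ‖∫ z, D' z h ∂μ‖ ≤ ∫ z, C * ‖h‖ * (1 * (1 + (C + 1) * P γ₀ z) +
        1⁻¹ * P (‖h‖⁻¹ • h) z) ∂μ := by
      refine norm_integral_le_of_norm_le (hint (C * ‖h‖) 1 (‖h‖⁻¹ • h)) ?_
      filter_upwards [hDb h 1 le_rfl] with z hz using hz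
    refine h1.trans ?_
    rw [integral_const_mul]
    simp only [one_mul, inv_one]
    have hA : Integrable (fun z => 1 + (C + 1) * P γ₀ z) μ :=
      (integrable_const _).add ((hPi γ₀).const_mul _)
    rw [integral_add hA (hPi _)]
    have := hPu h
    calc C * ‖h‖ * (A + ∫ z, P (‖h‖⁻¹ • h) z ∂μ) ≤ C * ‖h‖ * (A + C) := by gcongr
      _ = _ := by ring
  let D : X →L[ℝ] ℝ := LinearMap.mkContinuous
    { toFun := fun h => ∫ z, D' z h ∂μ
      map_add' := fun h k => by
        simp only [map_add]
        exact integral_add (hDi h) (hDi k)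
      map_smul' := fun c h => by
        simp only [map_smul, smul_eq_mul, RingHom.id_apply]
        exact integral_const_mul _ _ } (C * (A + C)) hDn
  have hDapp : ∀ h, D h = ∫ z, D' z h ∂μ := fun h => rfl
  refine ⟨D, HasStrictFDerivAt.of_isLittleO (Asymptotics.isLittleO_iff.2 fun ε hε => ?_)⟩
  -- `K` is fixed before the neighbourhood of `γ₀`. The terms carrying `K⁻¹` integrate to at most `2
  -- * C * C * K⁻¹`, whatever the direction of the increment.
  obtain ⟨K, hK1, hKε⟩ : ∃ K : ℝ, 1 ≤ K ∧ 2 * C * C * K⁻¹ ≤ ε / 3 := by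
    refine ⟨max 1 (6 * C * C / ε), le_max_left _ _, ?_⟩
    have h1 : 6 * C * C / ε ≤ max 1 (6 * C * C / ε) := le_max_right _ _
    have h2 : 0 < max 1 (6 * C * C / ε) := lt_of_lt_of_le one_pos (le_max_left _ _)
    rw [div_le_iff₀ hε] at h1
    rw [← div_eq_mul_inv, div_le_iff₀ h2]
    linarith
  have hK0 : 0 < K := by linarith
  set T : X × X → Ω → ℝ := fun x z => ‖x.1 - x.2‖⁻¹ * |e x.1 z - e x.2 z - D' z (x.1 - x.2)|
    with hT
  -- A common bound for the coefficients `2 * C`, `C * (3 * C + 1)` and `C * C` that occur once all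
  -- weights are compared with the one at `γ₀`.
  set C2 : ℝ := C * (3 * C + 2) with hC2
  set B : Ω → ℝ := fun z => K * C2 * (1 + P γ₀ z) with hB
  have hC20 : 0 ≤ C2 := by positivity
  have hBi : Integrable B μ := ((integrable_const _).add (hPi γ₀)).const_mul _
  have hB0 : ∀ z, 0 ≤ B z := fun z => by have := hP0 γ₀ z; positivity
  have hT0 : ∀ x z, 0 ≤ T x z := fun x z => by positivity
  have hUU : ∀ᶠ x : X × X in 𝓝 (γ₀, γ₀), x.1 ∈ U ∧ x.2 ∈ U := by
    rw [nhds_prod_eq]; exact (prod_mem_prod hU hU)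
  have hTi : ∀ x : X × X, x.1 ∈ U → x.2 ∈ U → Integrable (T x) μ := fun x h1 h2 =>
    ((((he _ h1).sub (he _ h2)).sub (hDi _)).abs).const_mul _
  -- Dominated convergence handles the remainder quotient `T` truncated at the fixed integrable
  -- function `B`.
  have hGlim : Tendsto (fun x => ∫ z, min (T x z) (B z) ∂μ) (𝓝 (γ₀, γ₀)) (𝓝 (∫ _, (0 : ℝ) ∂μ)) := by
    refine tendsto_integral_filter_of_dominated_convergence B ?_ ?_ hBi ?_
    · filter_upwards [hUU] with x hx
      exact ((hTi x hx.1 hx.2).inf hBi).aestronglyMeasurable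
    · refine Eventually.of_forall fun x => Eventually.of_forall fun z => ?_
      rw [Real.norm_of_nonneg (le_min (hT0 _ _) (hB0 _))]
      exact min_le_right _ _
    · filter_upwards [hD'] with z hz
      have h1 : Tendsto (fun x => T x z) (𝓝 (γ₀, γ₀)) (𝓝 0) := by
        rw [Metric.tendsto_nhds]
        intro δ hδ
        have h2 := Asymptotics.isLittleO_iff.1 hz.isLittleO (half_pos hδ)
        filter_upwards [h2] with x hx
        rw [Real.dist_eq, sub_zero, abs_of_nonneg (hT0 _ _)]
        have h3 : T x z ≤ ‖x.1 - x.2‖⁻¹ * (δ / 2 * ‖x.1 - x.2‖) :=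
          mul_le_mul_of_nonneg_left hx (by positivity)
        have h4 : ‖x.1 - x.2‖⁻¹ * ‖x.1 - x.2‖ ≤ 1 := inv_mul_le_one
        nlinarith
      have h5 := h1.min (tendsto_const_nhds (x := B z))
      rwa [min_eq_left (hB0 z)] at h5
  rw [integral_zero] at hGlim
  have hn : Tendsto (fun x : X × X => K * C2 * (C * ‖x.1 - γ₀‖ ^ q + C * ‖x.2 - γ₀‖ ^ q))
      (𝓝 (γ₀, γ₀)) (𝓝 0) := by
    have h1 : Tendsto (fun x : X × X => ‖x.1 - γ₀‖ ^ q) (𝓝 (γ₀, γ₀)) (𝓝 0) := by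
      have : Continuous fun x : X × X => ‖x.1 - γ₀‖ ^ q :=
        (by fun_prop : Continuous fun x : X × X => ‖x.1 - γ₀‖).rpow_const fun _ => Or.inr hq.le
      simpa [Real.zero_rpow hq.ne'] using this.tendsto (γ₀, γ₀)
    have h2 : Tendsto (fun x : X × X => ‖x.2 - γ₀‖ ^ q) (𝓝 (γ₀, γ₀)) (𝓝 0) := by
      have : Continuous fun x : X × X => ‖x.2 - γ₀‖ ^ q :=
        (by fun_prop : Continuous fun x : X × X => ‖x.2 - γ₀‖).rpow_const fun _ => Or.inr hq.le
      simpa [Real.zero_rpow hq.ne'] using this.tendsto (γ₀, γ₀)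
    simpa using ((h1.const_mul C).add (h2.const_mul C)).const_mul (K * C2)
  filter_upwards [hUU, hGlim.eventually_lt_const (show 0 < ε / 3 by positivity),
    hn.eventually_lt_const (show 0 < ε / 3 by positivity)] with x hxU hG hN
  obtain ⟨γ₁, γ₂⟩ := x
  simp only at hxU hG hN ⊢
  rcases eq_or_ne γ₁ γ₂ with rfl | hne
  · simp
  have hpos : 0 < ‖γ₁ - γ₂‖ := norm_pos_iff.2 (sub_ne_zero.2 hne)
  -- The excess of `T` over `B` consists of the weights of `γ₁ - γ₀` and `γ₂ - γ₀`, small in mean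
  -- since `K` is fixed, and of the weight of the unit increment, small in mean by the choice of
  -- `K`.
  have hTle : ∀ᵐ z ∂μ, T (γ₁, γ₂) z ≤ min (T (γ₁, γ₂) z) (B z) +
      (K * C2 * (P (γ₁ - γ₀) z + P (γ₂ - γ₀) z) +
        2 * C * K⁻¹ * P (‖γ₁ - γ₂‖⁻¹ • (γ₁ - γ₂)) z) := by
    filter_upwards [hlip γ₁ hxU.1 γ₂ hxU.2 K hK1, hDb (γ₁ - γ₂) K hK1] with z h1 h2
    have hp0 := hP0 γ₀ z
    have hp1 := hP0 (γ₁ - γ₀) z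
    have hp2 := hP0 (γ₂ - γ₀) z
    have hp3 := hP0 (‖γ₁ - γ₂‖⁻¹ • (γ₁ - γ₂)) z
    have hq1 : P γ₁ z ≤ C * (P γ₀ z + P (γ₁ - γ₀) z) := by
      have := hPa γ₀ (γ₁ - γ₀) z
      rwa [add_sub_cancel] at this
    have hq2 : P γ₂ z ≤ C * (P γ₀ z + P (γ₂ - γ₀) z) := by
      have := hPa γ₀ (γ₂ - γ₀) z
      rwa [add_sub_cancel] at this
    have hTB : T (γ₁, γ₂) z ≤ B z + (K * C2 * (P (γ₁ - γ₀) z + P (γ₂ - γ₀) z) +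
        2 * C * K⁻¹ * P (‖γ₁ - γ₂‖⁻¹ • (γ₁ - γ₂)) z) := by
      have h3 : |e γ₁ z - e γ₂ z - D' z (γ₁ - γ₂)| ≤ ‖γ₁ - γ₂‖ * (C * ((K * (1 + P γ₁ z + P γ₂ z) +
        K⁻¹ * P (‖γ₁ - γ₂‖⁻¹ • (γ₁ - γ₂)) z) + (K * (1 + (C + 1) * P γ₀ z) +
        K⁻¹ * P (‖γ₁ - γ₂‖⁻¹ • (γ₁ - γ₂)) z))) := by
        refine (abs_sub _ _).trans ((add_le_add h1 h2).trans (le_of_eq (by ring)))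
      have h4 : T (γ₁, γ₂) z ≤ C * ((K * (1 + P γ₁ z + P γ₂ z) +
        K⁻¹ * P (‖γ₁ - γ₂‖⁻¹ • (γ₁ - γ₂)) z) + (K * (1 + (C + 1) * P γ₀ z) +
        K⁻¹ * P (‖γ₁ - γ₂‖⁻¹ • (γ₁ - γ₂)) z)) := by
        simp only [hT]
        rw [inv_mul_le_iff₀ hpos]
        exact h3
      refine h4.trans ?_
      calc _ ≤ C * ((K * (1 + C * (P γ₀ z + P (γ₁ - γ₀) z) + C * (P γ₀ z + P (γ₂ - γ₀) z)) +
        K⁻¹ * P (‖γ₁ - γ₂‖⁻¹ • (γ₁ - γ₂)) z) + (K * (1 + (C + 1) * P γ₀ z) +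
        K⁻¹ * P (‖γ₁ - γ₂‖⁻¹ • (γ₁ - γ₂)) z)) := by gcongr
        _ = K * (2 * C + C * (3 * C + 1) * P γ₀ z) +
            (K * (C * C * (P (γ₁ - γ₀) z + P (γ₂ - γ₀) z)) +
            2 * C * K⁻¹ * P (‖γ₁ - γ₂‖⁻¹ • (γ₁ - γ₂)) z) := by ring
        _ ≤ K * (C2 + C2 * P γ₀ z) + (K * (C2 * (P (γ₁ - γ₀) z + P (γ₂ - γ₀) z)) +
            2 * C * K⁻¹ * P (‖γ₁ - γ₂‖⁻¹ • (γ₁ - γ₂)) z) := by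
          have i1 : 2 * C ≤ C2 := by rw [hC2]; nlinarith
          have i2 : C * (3 * C + 1) ≤ C2 := by rw [hC2]; nlinarith
          have i3 : C * C ≤ C2 := by rw [hC2]; nlinarith
          gcongr
        _ = _ := by simp only [hB]; ring
    rcases le_total (T (γ₁, γ₂) z) (B z) with h | h
    · rw [min_eq_left h]
      have : 0 ≤ K * C2 * (P (γ₁ - γ₀) z + P (γ₂ - γ₀) z) +
        2 * C * K⁻¹ * P (‖γ₁ - γ₂‖⁻¹ • (γ₁ - γ₂)) z := by positivity
      linarith
    · rwa [min_eq_right h]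
  have hTint : ∫ z, T (γ₁, γ₂) z ∂μ ≤ ε := by
    have i1 := (hTi (γ₁, γ₂) hxU.1 hxU.2).inf hBi
    have i2 := ((hPi (γ₁ - γ₀)).add (hPi (γ₂ - γ₀))).const_mul (K * C2)
    have i3 := (hPi (‖γ₁ - γ₂‖⁻¹ • (γ₁ - γ₂))).const_mul (2 * C * K⁻¹)
    have h1 := integral_mono_ae (hTi (γ₁, γ₂) hxU.1 hxU.2) (i1.add (i2.add i3)) hTle
    refine h1.trans ?_
    rw [integral_add' i1 (i2.add i3), integral_add' i2 i3, integral_const_mul, integral_const_mul]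
    have h2 : ∫ z, (P (γ₁ - γ₀) + P (γ₂ - γ₀)) z ∂μ ≤ C * ‖γ₁ - γ₀‖ ^ q + C * ‖γ₂ - γ₀‖ ^ q := by
      rw [integral_add' (hPi _) (hPi _)]
      exact add_le_add (hPn _) (hPn _)
    have h3 := mul_le_mul_of_nonneg_left h2 (show 0 ≤ K * C2 by positivity)
    have h4 := mul_le_mul_of_nonneg_left (hPu (γ₁ - γ₂)) (show 0 ≤ 2 * C * K⁻¹ by positivity)
    have h5 : ∫ z, (T (γ₁, γ₂) ⊓ B) z ∂μ < ε / 3 := hG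
    have h6 : 2 * C * K⁻¹ * C = 2 * C * C * K⁻¹ := by ring
    rw [h6] at h4
    linarith
  rw [hDapp, ← integral_sub (he _ hxU.1) (he _ hxU.2),
    ← integral_sub (show Integrable (fun z => e γ₁ z - e γ₂ z) μ from
      (he _ hxU.1).sub (he _ hxU.2)) (hDi _)]
  refine (norm_integral_le_integral_norm _).trans ?_
  have h7 : ∫ z, ‖e γ₁ z - e γ₂ z - D' z (γ₁ - γ₂)‖ ∂μ = ‖γ₁ - γ₂‖ * ∫ z, T (γ₁, γ₂) z ∂μ := by
    rw [← integral_const_mul]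
    congr 1
    funext z
    simp only [hT, Real.norm_eq_abs]
    rw [mul_inv_cancel_left₀ hpos.ne']
  rw [h7, mul_comm ε]
  gcongr

/-- A function that is strictly differentiable at all points of a set is continuously
differentiable there. -/
theorem continuousOn_fderiv_of_hasStrictFDerivAt {X : Type*} [NormedAddCommGroup X]
    [NormedSpace ℝ X] {f : X → ℝ} {s : Set X} (hs : IsOpen s)
    (h : ∀ x ∈ s, ∃ D : X →L[ℝ] ℝ, HasStrictFDerivAt f D x) : ContinuousOn (fderiv ℝ f) s := by
  intro x hx
  refine ContinuousAt.continuousWithinAt ?_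
  obtain ⟨D, hD⟩ := h x hx
  rw [ContinuousAt, hD.hasFDerivAt.fderiv, Metric.tendsto_nhds]
  intro ε hε
  -- Strictness at `x` bounds the increments of `f - D` near `x` with the constant `ε / 2`. Hence
  -- every derivative of `f` at a nearby point lies within `ε / 2` of `D`.
  have h1 := Asymptotics.isLittleO_iff.1 hD.isLittleO (half_pos hε)
  have h2 := (nhds_prod_eq (x := x) (y := x)) ▸ h1
  have h3 : ∀ᶠ y in 𝓝 x, ∀ᶠ z in 𝓝 y, ‖f z - f y - D (z - y)‖ ≤ ε / 2 * ‖z - y‖ := by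
    have h4 : ∀ᶠ y in 𝓝 x, ∀ᶠ w in 𝓝 (y, y),
        ‖f w.1 - f w.2 - D (w.1 - w.2)‖ ≤ ε / 2 * ‖w.1 - w.2‖ := by
      have := (continuous_id.prodMk continuous_id).tendsto x |>.eventually
        (eventually_eventually_nhds.2 h1)
      exact this
    filter_upwards [h4] with y hy
    have : Tendsto (fun z => (z, y)) (𝓝 y) (𝓝 (y, y)) :=
      (continuous_id.prodMk continuous_const).tendsto y
    exact this.eventually hy
  filter_upwards [h3, hs.mem_nhds hx] with y hy hys
  obtain ⟨D₁, hD₁⟩ := h y hys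
  rw [dist_eq_norm, hD₁.hasFDerivAt.fderiv]
  have h5 : HasFDerivAt (fun z => f z - D z) (D₁ - D) y := hD₁.hasFDerivAt.sub D.hasFDerivAt
  refine lt_of_le_of_lt (h5.le_of_lip' (half_pos hε).le ?_) (half_lt_self hε)
  filter_upwards [hy] with z hz
  refine le_trans (le_of_eq ?_) hz
  rw [map_sub]
  congr 1
  ring

/-! ### Means over intervals and the Gagliardo seminorm -/

section Embedding

variable {n : ℕ} {s ρ : ℝ}

theorem eLpNorm_rpow_eq_lintegral {Y : Type*} [MeasurableSpace Y] {μ : Measure Y} (hρ : 1 ≤ ρ)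
    (f : Y → EuclideanSpace ℝ (Fin n)) :
    eLpNorm f (ENNReal.ofReal ρ) μ ^ ρ = ∫⁻ y, ‖f y‖ₑ ^ ρ ∂μ := by
  have h0 : 0 < ρ := by linarith
  have h := eLpNorm_nnreal_pow_eq_lintegral (μ := μ) (f := f) (p := Real.toNNReal ρ)
    (by simpa using h0)
  simpa [Real.coe_toNNReal ρ h0.le, ENNReal.ofReal] using h

/-- The distance on the circle never exceeds the one on the line, and the ρ-th power of the kernel
has the exponent (s + 1/ρ)ρ = 1 + sρ. Parameters that coincide on the circle are separate, as the
kernel cannot be inverted there. -/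
theorem enorm_sub_rpow_le_fracQuot (hs : 0 ≤ s) (hρ : 1 ≤ ρ)
    (g : UnitAddCircle → EuclideanSpace ℝ (Fin n)) {a b r : ℝ} (hr : |a - b| ≤ r) :
    ‖g (a : UnitAddCircle) - g (b : UnitAddCircle)‖ₑ ^ ρ ≤
      ENNReal.ofReal (r ^ (1 + s * ρ)) * ‖fracQuot s ρ g ((a : UnitAddCircle), (b : UnitAddCircle))‖ₑ
        ^ ρ := by
  have h0 : 0 < ρ := by linarith
  have hr0 : 0 ≤ r := (abs_nonneg _).trans hr
  have hd : dist (a : UnitAddCircle) (b : UnitAddCircle) ≤ r := by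
    rw [dist_eq_norm, ← AddCircle.coe_sub]
    refine le_trans ?_ hr
    rw [← Real.norm_eq_abs]
    exact QuotientAddGroup.norm_mk_le_norm
  rcases eq_or_ne (a : UnitAddCircle) (b : UnitAddCircle) with hab | hab
  · simp [hab, ENNReal.zero_rpow_of_pos h0]
  have hd0 : 0 < dist (a : UnitAddCircle) (b : UnitAddCircle) := dist_pos.2 hab
  set d := dist (a : UnitAddCircle) (b : UnitAddCircle)
  have h1 : g (a : UnitAddCircle) - g (b : UnitAddCircle) =
      (d ^ (s + 1 / ρ)) • fracQuot s ρ g ((a : UnitAddCircle), (b : UnitAddCircle)) := by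
    simp only [fracQuot]
    rw [smul_smul, mul_inv_cancel₀ (Real.rpow_pos_of_pos hd0 _).ne', one_smul]
  rw [h1, enorm_smul, ENNReal.mul_rpow_of_nonneg _ _ h0.le]
  gcongr
  rw [Real.enorm_eq_ofReal (by positivity), ENNReal.ofReal_rpow_of_nonneg (by positivity) h0.le,
    ← Real.rpow_mul hd0.le]
  have : (s + 1 / ρ) * ρ = 1 + s * ρ := by field_simp; ring
  rw [this]
  apply ENNReal.ofReal_le_ofReal
  gcongr

theorem lintegral_lintegral_circle {F : UnitAddCircle × UnitAddCircle → ℝ≥0∞}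
    (hF : AEMeasurable F volume) (x y : ℝ) :
    ∫⁻ a in Ioc x (x + 1), ∫⁻ b in Ioc y (y + 1),
      F ((a : UnitAddCircle), (b : UnitAddCircle)) = ∫⁻ z, F z := by
  have h1 : ∀ a : UnitAddCircle, ∫⁻ b in Ioc y (y + 1), F (a, (b : UnitAddCircle)) =
      ∫⁻ b, F (a, b) := fun a => UnitAddCircle.lintegral_preimage y fun b => F (a, b)
  simp only [h1]
  rw [UnitAddCircle.lintegral_preimage x fun a => ∫⁻ b, F (a, b)]
  exact (lintegral_prod F hF).symm

theorem lintegral_lintegral_sub_le (hs : 0 ≤ s) (hρ : 1 ≤ ρ)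
    {g : UnitAddCircle → EuclideanSpace ℝ (Fin n)}
    (hg : AEStronglyMeasurable (fracQuot s ρ g) volume) (x : ℝ) {r r' : ℝ} (hr' : r' ≤ r)
    (hr1 : r ≤ 1) :
    ∫⁻ a in Ioc x (x + r'), ∫⁻ b in Ioc x (x + r),
      ‖g (a : UnitAddCircle) - g (b : UnitAddCircle)‖ₑ ^ ρ ≤
      ENNReal.ofReal (r ^ (1 + s * ρ)) * eLpNorm (fracQuot s ρ g) (ENNReal.ofReal ρ) volume ^ ρ := by
  have hF : AEMeasurable (fun z => ‖fracQuot s ρ g z‖ₑ ^ ρ) volume := hg.enorm.pow_const _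
  rw [eLpNorm_rpow_eq_lintegral hρ, ← lintegral_lintegral_circle hF x x]
  have h2 : ∫⁻ a in Ioc x (x + r'), ∫⁻ b in Ioc x (x + r),
      ‖g (a : UnitAddCircle) - g (b : UnitAddCircle)‖ₑ ^ ρ ≤
      ∫⁻ a in Ioc x (x + r'), ∫⁻ b in Ioc x (x + r), ENNReal.ofReal (r ^ (1 + s * ρ)) *
        ‖fracQuot s ρ g ((a : UnitAddCircle), (b : UnitAddCircle))‖ₑ ^ ρ := by
    refine setLIntegral_mono' measurableSet_Ioc fun a ha =>
      setLIntegral_mono' measurableSet_Ioc fun b hb => ?_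
    refine enorm_sub_rpow_le_fracQuot hs hρ g (abs_le.2 ⟨?_, ?_⟩)
    · linarith [ha.1, hb.2]
    · linarith [ha.2, hb.1]
  refine h2.trans ?_
  simp only [lintegral_const_mul' _ _ ENNReal.ofReal_ne_top]
  have hr'1 : r' ≤ 1 := hr'.trans hr1
  gcongr

/-- A substitute for Hölder's inequality: below the level `L` the first term suffices, above it the
second one does because 1 - ρ ≤ 0. A level that balances the two terms loses only a constant. -/
theorem enorm_le_add_mul_rpow (hρ : 1 ≤ ρ) {L : ℝ} (hL : 0 < L) (v : EuclideanSpace ℝ (Fin n)) :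
    ‖v‖ₑ ≤ ENNReal.ofReal L + ENNReal.ofReal (L ^ (1 - ρ)) * ‖v‖ₑ ^ ρ := by
  rw [← ofReal_norm, ENNReal.ofReal_rpow_of_nonneg (norm_nonneg _) (by linarith),
    ← ENNReal.ofReal_mul (by positivity), ← ENNReal.ofReal_add hL.le (by positivity)]
  apply ENNReal.ofReal_le_ofReal
  rcases le_total ‖v‖ L with h | h
  · have : 0 ≤ L ^ (1 - ρ) * ‖v‖ ^ ρ := by positivity
    linarith
  · have hv : 0 < ‖v‖ := hL.trans_le h
    have h1 : ‖v‖ ^ (1 - ρ) ≤ L ^ (1 - ρ) := Real.rpow_le_rpow_of_nonpos hL h (by linarith)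
    have h2 : ‖v‖ = ‖v‖ ^ (1 - ρ) * ‖v‖ ^ ρ := by
      rw [← Real.rpow_add hv]; simp
    have h3 : ‖v‖ ^ (1 - ρ) * ‖v‖ ^ ρ ≤ L ^ (1 - ρ) * ‖v‖ ^ ρ := by gcongr
    linarith

/-- The mean of `g` over the interval `(x, x + r)`. -/
noncomputable def arcMean (g : UnitAddCircle → EuclideanSpace ℝ (Fin n)) (x r : ℝ) : EuclideanSpace ℝ (Fin n) :=
  r⁻¹ • ∫ t in x..x + r, g (t : UnitAddCircle)

theorem intervalIntegrable_lift {g : UnitAddCircle → EuclideanSpace ℝ (Fin n)}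
    (hg : Integrable g volume) (a b : ℝ) :
    IntervalIntegrable (fun t : ℝ => g (t : UnitAddCircle)) volume a b :=
  ((locallyIntegrable_lift hg).integrableOn_isCompact isCompact_uIcc).intervalIntegrable

/-- A Campanato estimate: the two means differ by at most the average of |g(a) - g(b)| over the
product of the intervals, and the Gagliardo seminorm controls the average of the ρ-th powers. For sρ
> 1 the power of `r` is positive, which makes the dyadic differences summable. -/
theorem norm_arcMean_sub_le (hs : 0 ≤ s) (hρ : 1 ≤ ρ)
    {g : UnitAddCircle → EuclideanSpace ℝ (Fin n)} (hg : Integrable g volume)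
    (hf : AEStronglyMeasurable (fracQuot s ρ g) volume) {M : ℝ} (hM : 0 < M)
    (hgM : eLpNorm (fracQuot s ρ g) (ENNReal.ofReal ρ) volume ≤ ENNReal.ofReal M) (x : ℝ) {r : ℝ}
    (hr0 : 0 < r) (hr1 : r ≤ 1) :
    ‖arcMean g x (r / 2) - arcMean g x r‖ ≤ 3 * M * r ^ (s - 1 / ρ) := by
  have h0 : 0 < ρ := by linarith
  set A := arcMean g x r with hA
  set u : ℝ → EuclideanSpace ℝ (Fin n) := fun t => g (t : UnitAddCircle) with hu
  have hui : ∀ a b, IntervalIntegrable u volume a b := intervalIntegrable_lift hg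
  have hmean : ∀ (r : ℝ) (v : EuclideanSpace ℝ (Fin n)), 0 < r →
      ‖arcMean g x r - v‖ₑ ≤ ENNReal.ofReal r⁻¹ * ∫⁻ b in Ioc x (x + r), ‖v - u b‖ₑ := by
    intro r v hr
    have h1 : arcMean g x r - v = r⁻¹ • ∫ b in x..x + r, (u b - v) := by
      rw [intervalIntegral.integral_sub (hui _ _) (by simp), intervalIntegral.integral_const,
        smul_sub, smul_smul]
      simp [arcMean, hu, hr.ne']
    rw [h1, enorm_smul, Real.enorm_eq_ofReal (by positivity),
      intervalIntegral.integral_of_le (by linarith)]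
    gcongr
    refine (enorm_integral_le_lintegral_enorm _).trans (le_of_eq ?_)
    congr 1
    funext b
    exact enorm_sub_rev _ _
  -- This level satisfies M^ρ r^(1 + sρ) = L^ρ r², so that the two terms contribute `L` and `2 * L`;
  -- hence the constant 3.
  set L : ℝ := M * r ^ (s - 1 / ρ) with hL
  have hL0 : 0 < L := by positivity
  clear_value L
  have h1 : ‖arcMean g x (r / 2) - A‖ₑ ≤ ENNReal.ofReal (r / 2)⁻¹ *
      ∫⁻ a in Ioc x (x + r / 2), ENNReal.ofReal r⁻¹ * ∫⁻ b in Ioc x (x + r),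
        (ENNReal.ofReal L + ENNReal.ofReal (L ^ (1 - ρ)) * ‖u a - u b‖ₑ ^ ρ) := by
    refine (hmean (r / 2) A (half_pos hr0)).trans ?_
    gcongr with a
    refine (hmean r (u a) hr0).trans ?_
    gcongr with b
    exact enorm_le_add_mul_rpow hρ hL0 _
  have h2 : ∫⁻ a in Ioc x (x + r / 2), ENNReal.ofReal r⁻¹ * ∫⁻ b in Ioc x (x + r),
        (ENNReal.ofReal L + ENNReal.ofReal (L ^ (1 - ρ)) * ‖u a - u b‖ₑ ^ ρ) =
      ENNReal.ofReal r⁻¹ * (ENNReal.ofReal L * ENNReal.ofReal r * ENNReal.ofReal (r / 2) +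
        ENNReal.ofReal (L ^ (1 - ρ)) * ∫⁻ a in Ioc x (x + r / 2), ∫⁻ b in Ioc x (x + r),
          ‖u a - u b‖ₑ ^ ρ) := by
    rw [lintegral_const_mul' _ _ ENNReal.ofReal_ne_top]
    congr 1
    simp only [lintegral_add_left measurable_const, lintegral_const_mul' _ _ ENNReal.ofReal_ne_top,
      lintegral_const, Measure.restrict_apply_univ, Real.volume_Ioc, add_sub_cancel_left, mul_assoc]
  have h3 := lintegral_lintegral_sub_le hs hρ hf x (show r / 2 ≤ r by linarith) hr1
  have h4 : eLpNorm (fracQuot s ρ g) (ENNReal.ofReal ρ) volume ^ ρ ≤ ENNReal.ofReal (M ^ ρ) := by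
    rw [← ENNReal.ofReal_rpow_of_nonneg hM.le h0.le]
    gcongr
  rw [h2] at h1
  have h5 : ‖arcMean g x (r / 2) - A‖ₑ ≤ ENNReal.ofReal (3 * M * r ^ (s - 1 / ρ)) := by
    calc _ ≤ ENNReal.ofReal (r / 2)⁻¹ * (ENNReal.ofReal r⁻¹ *
          (ENNReal.ofReal L * ENNReal.ofReal r * ENNReal.ofReal (r / 2) +
          ENNReal.ofReal (L ^ (1 - ρ)) * (ENNReal.ofReal (r ^ (1 + s * ρ)) *
            ENNReal.ofReal (M ^ ρ)))) := by
          refine h1.trans ?_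
          gcongr
          exact h3.trans (by gcongr)
      _ = ENNReal.ofReal ((r / 2)⁻¹ * (r⁻¹ * (L * r * (r / 2) +
          L ^ (1 - ρ) * (r ^ (1 + s * ρ) * M ^ ρ)))) := by
          rw [ENNReal.ofReal_mul (p := (r / 2)⁻¹) (by positivity),
            ENNReal.ofReal_mul (p := r⁻¹) (by positivity), ENNReal.ofReal_add (by positivity) (by positivity),
            ENNReal.ofReal_mul (p := L * r) (by positivity),
            ENNReal.ofReal_mul (p := L) (by positivity),
            ENNReal.ofReal_mul (p := L ^ (1 - ρ)) (by positivity),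
            ENNReal.ofReal_mul (p := r ^ (1 + s * ρ)) (by positivity)]
      _ = ENNReal.ofReal (3 * M * r ^ (s - 1 / ρ)) := by
          congr 1
          have e1 : L ^ (1 - ρ) * (r ^ (1 + s * ρ) * M ^ ρ) = L * r * r := by
            have e2 : r ^ (1 + s * ρ) * M ^ ρ = L ^ ρ * (r * r) := by
              rw [hL, Real.mul_rpow hM.le (by positivity), ← Real.rpow_mul hr0.le]
              have : r ^ (1 + s * ρ) = r ^ ((s - 1 / ρ) * ρ) * (r * r) := by
                have e3 : r * r = r ^ (2 : ℝ) := by rw [Real.rpow_two]; ring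
                rw [e3, ← Real.rpow_add hr0]
                congr 1
                field_simp
                ring
              rw [this]; ring
            rw [e2, ← mul_assoc, ← Real.rpow_add hL0]
            simp [mul_assoc]
          rw [e1, hL]
          field_simp
          ring
  rw [← ofReal_norm] at h5
  exact (ENNReal.ofReal_le_ofReal_iff (by positivity)).1 h5

end Embedding

/-! ### The embedding into continuously differentiable curves -/

section Embedding

variable {n : ℕ} {s ρ : ℝ}

theorem norm_arcMean_one_le {g : UnitAddCircle → EuclideanSpace ℝ (Fin n)} (hρ : 1 ≤ ρ)
    (hg : AEStronglyMeasurable g volume) {M : ℝ} (hM : 0 ≤ M)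
    (hgM : eLpNorm g (ENNReal.ofReal ρ) volume ≤ ENNReal.ofReal M) (x : ℝ) :
    ‖arcMean g x 1‖ ≤ M := by
  have h1 : ‖arcMean g x 1‖ₑ ≤ ∫⁻ b in Ioc x (x + 1), ‖g (b : UnitAddCircle)‖ₑ := by
    rw [arcMean, inv_one, one_smul, intervalIntegral.integral_of_le (by linarith)]
    exact enorm_integral_le_lintegral_enorm _
  rw [UnitAddCircle.lintegral_preimage x fun b => ‖g b‖ₑ, ← eLpNorm_one_eq_lintegral_enorm] at h1
  have : IsProbabilityMeasure (volume : Measure UnitAddCircle) := ⟨UnitAddCircle.measure_univ⟩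
  have h2 : eLpNorm g 1 volume ≤ eLpNorm g (ENNReal.ofReal ρ) volume :=
    eLpNorm_le_eLpNorm_of_exponent_le (by simpa using hρ) hg
  have h3 := (h1.trans h2).trans hgM
  rw [← ofReal_norm] at h3
  exact (ENNReal.ofReal_le_ofReal_iff hM).1 h3

/-- The constant in the embedding of `W^{s,ρ}` into the continuous functions. -/
noncomputable def embConst (s ρ : ℝ) : ℝ := 1 + 3 / (1 - (1 / 2) ^ (s - 1 / ρ))

theorem half_rpow_lt_one {e : ℝ} (he : 0 < e) : ((1 : ℝ) / 2) ^ e < 1 :=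
  Real.rpow_lt_one (by norm_num) (by norm_num) he

/-- The embedding of `W^{s,ρ}` into the continuous functions. -/
theorem exists_continuous_representative (hs : 0 ≤ s) (hρ : 1 ≤ ρ) (hsρ : 1 < s * ρ)
    {g : UnitAddCircle → EuclideanSpace ℝ (Fin n)}
    (hg : MemLp g (ENNReal.ofReal ρ) volume)
    (hf : AEStronglyMeasurable (fracQuot s ρ g) volume) {M : ℝ} (hM : 0 < M)
    (hgM : eLpNorm g (ENNReal.ofReal ρ) volume ≤ ENNReal.ofReal M)
    (hfM : eLpNorm (fracQuot s ρ g) (ENNReal.ofReal ρ) volume ≤ ENNReal.ofReal M) :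
    ∃ G : ℝ → EuclideanSpace ℝ (Fin n), Continuous G ∧ (∀ x, ‖G x‖ ≤ embConst s ρ * M) ∧
      ∀ᵐ x : ℝ, g (x : UnitAddCircle) = G x := by
  have h0 : 0 < ρ := by linarith
  have hgi : Integrable g volume := hg.integrable (by simpa using hρ)
  set ε := s - 1 / ρ with hε
  have hε0 : 0 < ε := by
    rw [hε, sub_pos, div_lt_iff₀ h0]; exact hsρ
  have hq := half_rpow_lt_one hε0
  have hq0 : 0 < ((1 : ℝ) / 2) ^ ε := by positivity
  set q : ℝ := (1 / 2) ^ ε with hqdef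
  -- The dyadic means converge uniformly by comparison with a geometric series. Their limit is
  -- therefore continuous, and Lebesgue's differentiation theorem identifies it with `g` almost
  -- everywhere.
  let A : ℕ → ℝ → EuclideanSpace ℝ (Fin n) := fun k x => arcMean g x ((1 / 2) ^ k)
  have hstep : ∀ x k, dist (A k x) (A (k + 1) x) ≤ 3 * M * q ^ k := by
    intro x k
    have h := norm_arcMean_sub_le hs hρ hgi hf hM hfM x (r := (1 / 2) ^ k) (by positivity)
      (pow_le_one₀ (by norm_num) (by norm_num))
    rw [dist_comm, dist_eq_norm]
    have e1 : ((1 : ℝ) / 2) ^ (k + 1) = (1 / 2) ^ k / 2 := by rw [pow_succ]; ring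
    have e2 : (((1 : ℝ) / 2) ^ k) ^ (s - 1 / ρ) = q ^ k := by
      rw [hqdef, ← Real.rpow_natCast, ← Real.rpow_natCast, ← Real.rpow_mul (by norm_num),
        ← Real.rpow_mul (by norm_num), mul_comm]
    simp only [A, e1]
    rw [← e2]
    exact h
  have hex : ∀ x, ∃ G, Tendsto (fun k => A k x) atTop (𝓝 G) := fun x =>
    cauchySeq_tendsto_of_complete (cauchySeq_of_le_geometric q (3 * M) hq (hstep x))
  choose G hG using hex
  have hdist : ∀ x k, dist (A k x) (G x) ≤ 3 * M * q ^ k / (1 - q) := fun x k =>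
    dist_le_of_le_geometric_of_tendsto q (3 * M) hq (hstep x) (hG x) k
  have hloc := locallyIntegrable_lift hgi
  have hAcont : ∀ k, Continuous (A k) := by
    intro k
    have hp : Continuous fun b => ∫ t in (0 : ℝ)..b, g (t : UnitAddCircle) :=
      intervalIntegral.continuous_primitive (fun a b => intervalIntegrable_lift hgi a b) 0
    have : A k = fun x => (((1 : ℝ) / 2) ^ k)⁻¹ •
        ((∫ t in (0 : ℝ)..(x + (1 / 2) ^ k), g (t : UnitAddCircle)) -
          ∫ t in (0 : ℝ)..x, g (t : UnitAddCircle)) := by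
      funext x
      simp only [A, arcMean]
      rw [intervalIntegral.integral_interval_sub_left (intervalIntegrable_lift hgi _ _)
        (intervalIntegrable_lift hgi _ _)]
    rw [this]
    have hp' : Continuous fun x : ℝ => ∫ t in (0 : ℝ)..(x + (1 / 2) ^ k), g (t : UnitAddCircle) :=
      hp.comp (continuous_id.add continuous_const)
    exact (hp'.sub hp).const_smul (((1 : ℝ) / 2) ^ k)⁻¹
  have hunif : TendstoUniformly A G atTop := by
    rw [Metric.tendstoUniformly_iff]
    intro δ hδ
    have h1 : Tendsto (fun k : ℕ => 3 * M * q ^ k / (1 - q)) atTop (𝓝 0) := by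
      simpa using ((tendsto_pow_atTop_nhds_zero_of_lt_one hq0.le hq).const_mul (3 * M)).div_const
        (1 - q)
    filter_upwards [h1.eventually_lt_const hδ] with k hk x
    rw [dist_comm]
    exact (hdist x k).trans_lt hk
  refine ⟨G, hunif.continuous (Frequently.of_forall hAcont), fun x => ?_, ?_⟩
  · have h1 := hdist x 0
    have h2 : ‖A 0 x‖ ≤ M := by
      simpa [A] using norm_arcMean_one_le hρ hg.aestronglyMeasurable hM.le hgM x
    have h3 : ‖G x‖ ≤ ‖A 0 x‖ + dist (A 0 x) (G x) := by
      rw [dist_comm, dist_eq_norm]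
      exact norm_le_norm_add_norm_sub' _ _
    -- The mean over the full circle contributes `M` and the geometric series the rest; this is the
    -- origin of `embConst`.
    have h4 : embConst s ρ * M = M + 3 * M * q ^ 0 / (1 - q) := by
      simp only [embConst, ← hε, ← hqdef]
      ring
    linarith
  · filter_upwards [LocallyIntegrable.ae_hasDerivAt_integral hloc] with x hx
    have h1 := hx x
    have h2 := (hasDerivAt_iff_tendsto_slope_zero.1 h1)
    have h3 : Tendsto (fun k : ℕ => ((1 : ℝ) / 2) ^ k) atTop (𝓝[≠] 0) :=
      tendsto_nhdsWithin_iff.2 ⟨tendsto_pow_atTop_nhds_zero_of_lt_one (by norm_num) (by norm_num),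
        Eventually.of_forall fun k => by simp⟩
    have h4 := h2.comp h3
    refine tendsto_nhds_unique (h4.congr fun k => ?_) (hG x)
    simp [A, arcMean]

/-- The lemma of du Bois-Reymond. Subtracting from a test function ψ the multiple (∫ψ)χ of a fixed
bump χ of mass one leaves mean zero, hence the derivative of a test function. Testing with it
identifies `u` with the constant ∫χu. -/
theorem ae_const_of_integral_deriv_smul_eq_zero {u : ℝ → EuclideanSpace ℝ (Fin n)}
    (hu : Continuous u)
    (h : ∀ φ : ℝ → ℝ, ContDiff ℝ ∞ φ → HasCompactSupport φ → ∫ t, deriv φ t • u t = 0) (x y : ℝ) :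
    u x = u y := by
  have hint : ∀ φ : ℝ → ℝ, Continuous φ → HasCompactSupport φ → Integrable fun t => φ t • u t :=
    fun φ hφ hc => (hφ.smul hu).integrable_of_hasCompactSupport hc.smul_right
  obtain ⟨χ, hχ, hχc, hχ1⟩ : ∃ χ : ℝ → ℝ, ContDiff ℝ ∞ χ ∧ HasCompactSupport χ ∧ ∫ t, χ t = 1 := by
    let b : ContDiffBump (0 : ℝ) := default
    exact ⟨b.normed volume, b.contDiff_normed, b.hasCompactSupport_normed, b.integral_normed⟩
  set c := ∫ t, χ t • u t with hc
  have hae : ∀ᵐ t : ℝ, u t = c := by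
    refine ae_eq_of_integral_contDiff_smul_eq hu.locallyIntegrable
      continuous_const.locallyIntegrable fun ψ hψ hψc => ?_
    set m := ∫ t, ψ t with hm
    set ψ₀ : ℝ → ℝ := fun t => ψ t - m * χ t with hψ₀
    have hψ₀d : ContDiff ℝ ∞ ψ₀ := hψ.sub (contDiff_const.mul hχ)
    have hψ₀c : HasCompactSupport ψ₀ := hψc.sub hχc.mul_left
    have hψi := hψ.continuous.integrable_of_hasCompactSupport (μ := volume) hψc
    have hχi := hχ.continuous.integrable_of_hasCompactSupport (μ := volume) hχc
    have hψ₀i := hψ₀d.continuous.integrable_of_hasCompactSupport (μ := volume) hψ₀c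
    have hψ₀0 : ∫ t, ψ₀ t = 0 := by
      rw [hψ₀, integral_sub hψi (hχi.const_mul _), integral_const_mul, hχ1, mul_one, sub_self]
    obtain ⟨R, hR⟩ := hψ₀c.isCompact.isBounded.subset_closedBall 0
    rw [Real.closedBall_eq_Icc, zero_sub, zero_add] at hR
    have hz : ∀ t, t ∉ Icc (-R) R → ψ₀ t = 0 := fun t ht =>
      image_eq_zero_of_notMem_tsupport fun h => ht (hR h)
    set φ : ℝ → ℝ := fun t => ∫ a in (-R)..t, ψ₀ a with hφ
    have hφd : ∀ t, HasDerivAt φ (ψ₀ t) t := fun t =>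
      intervalIntegral.integral_hasDerivAt_right (hψ₀d.continuous.intervalIntegrable _ _)
        (hψ₀d.continuous.stronglyMeasurableAtFilter _ _) hψ₀d.continuous.continuousAt
    have hderiv : deriv φ = ψ₀ := funext fun t => (hφd t).deriv
    have hφs : ContDiff ℝ ∞ φ := by
      rw [contDiff_infty_iff_deriv, hderiv]
      exact ⟨fun t => (hφd t).differentiableAt, hψ₀d⟩
    -- The primitive vanishes to the left of the support of `ψ₀`, and to the right because `ψ₀` has
    -- mean zero. The endpoint `-R` is not covered by `hz`, so the value there comes from
    -- continuity.
    have hφc : HasCompactSupport φ := by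
      refine HasCompactSupport.intro (isCompact_Icc (a := -R) (b := R)) fun t ht => ?_
      rcases lt_or_ge t (-R) with h1 | h1
      · simp only [hφ]
        refine (intervalIntegral.integral_congr (g := fun _ => (0 : ℝ)) fun a ha => ?_).trans
          (by simp)
        rw [uIcc_of_ge h1.le] at ha
        rcases eq_or_lt_of_le ha.2 with h2 | h2
        · have hcl : IsClosed {x : ℝ | ψ₀ x = 0} :=
            isClosed_eq hψ₀d.continuous continuous_const
          have : Iio (-R) ⊆ {x : ℝ | ψ₀ x = 0} := fun b hb => hz b fun hb' => by
            have := hb'.1; simp only [mem_Iio] at hb; linarith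
          have h3 := hcl.closure_subset_iff.2 this
          rw [closure_Iio] at h3
          exact h3 ha.2
        · exact hz a fun h => by have := h.1; linarith
      · have h2 : R < t := by
          by_contra h2
          exact ht ⟨h1, not_lt.1 h2⟩
        simp only [hφ]
        rw [intervalIntegral.integral_of_le h1, ← hψ₀0]
        symm
        rw [← integral_indicator measurableSet_Ioc]
        refine integral_congr_ae ?_
        have hne : ∀ᵐ a : ℝ, a ≠ -R := by simp [ae_iff]
        filter_upwards [hne] with a ha
        by_cases hat : a ∈ Ioc (-R) t
        · rw [indicator_of_mem hat]
        · rw [indicator_of_notMem hat]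
          refine hz a fun h => hat ⟨lt_of_le_of_ne h.1 (Ne.symm ha), h.2.trans h2.le⟩
    have h1 := h φ hφs hφc
    rw [hderiv] at h1
    have h2 : ∫ t, ψ₀ t • u t = (∫ t, ψ t • u t) - m • c := by
      rw [hc, ← integral_smul, ← integral_sub (hint ψ hψ.continuous hψc)
        (show Integrable (fun t => m • χ t • u t) from (hint χ hχ.continuous hχc).smul m)]
      congr 1
      funext t
      simp [hψ₀, sub_smul, mul_smul]
    rw [h2] at h1
    rw [sub_eq_zero.1 h1, integral_smul_const]
  have : u = fun _ => c := (hu.ae_eq_iff_eq volume continuous_const).1 hae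
  rw [this]

theorem embConst_nonneg (hρ : 1 ≤ ρ) (hsρ : 1 < s * ρ) : 0 ≤ embConst s ρ := by
  have h0 : 0 < ρ := by linarith
  have : 0 < s - 1 / ρ := by rw [sub_pos, div_lt_iff₀ h0]; exact hsρ
  have h1 := half_rpow_lt_one this
  have h2 : 0 < 1 - ((1 : ℝ) / 2) ^ (s - 1 / ρ) := by linarith
  unfold embConst
  positivity

variable [Fact (1 ≤ ρ)]

theorem Slob.eLpNorm_le (γ : Slob s ρ n) :
    eLpNorm γ.wderiv (ENNReal.ofReal ρ) volume ≤ ENNReal.ofReal ‖γ‖ ∧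
    eLpNorm (fracQuot s ρ γ.wderiv) (ENNReal.ofReal ρ) volume ≤ ENNReal.ofReal ‖γ‖ := by
  have h1 : (1 : ℝ) ≤ ρ := Fact.out
  have h0 : (0 : ℝ) < ρ := by linarith
  set a := (eLpNorm γ.curve (ENNReal.ofReal ρ) volume).toReal
  set b := (eLpNorm γ.wderiv (ENNReal.ofReal ρ) volume).toReal with hb
  set c := (eLpNorm (fracQuot s ρ γ.wderiv) (ENNReal.ofReal ρ) volume).toReal with hc
  have hn : ‖γ‖ = (a ^ ρ + (b ^ ρ + c ^ ρ)) ^ (1 / ρ) := γ.norm_def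
  have ha0 : 0 ≤ a := ENNReal.toReal_nonneg
  have hb0 : 0 ≤ b := ENNReal.toReal_nonneg
  have hc0 : 0 ≤ c := ENNReal.toReal_nonneg
  have ha := Real.rpow_nonneg ha0 ρ
  have hb' := Real.rpow_nonneg hb0 ρ
  have hc' := Real.rpow_nonneg hc0 ρ
  have key : ∀ t : ℝ, 0 ≤ t → t ^ ρ ≤ a ^ ρ + (b ^ ρ + c ^ ρ) → t ≤ ‖γ‖ := by
    intro t ht h
    rw [hn]
    calc t = (t ^ ρ) ^ (1 / ρ) := by
          rw [← Real.rpow_mul ht, mul_one_div_cancel h0.ne', Real.rpow_one]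
      _ ≤ _ := by gcongr
  constructor
  · rw [← ENNReal.ofReal_toReal γ.isSlobDeriv.memLp.2.ne]
    exact ENNReal.ofReal_le_ofReal (key b hb0 (by linarith))
  · rw [← ENNReal.ofReal_toReal γ.isSlobDeriv.gagliardo.2.ne]
    exact ENNReal.ofReal_le_ofReal (key c hc0 (by linarith))

/-- The derivative of the `1`-periodic lift of a closed curve. -/
noncomputable def Slob.vel (γ : Slob s ρ n) : ℝ → EuclideanSpace ℝ (Fin n) :=
  deriv fun u : ℝ => γ.curve (u : UnitAddCircle)

/-- The curve minus the primitive of the continuous representative `G` has weak derivative zero, so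
it is constant and `G` is a classical derivative. -/
theorem Slob.exists_deriv (hs : 0 ≤ s) (hsρ : 1 < s * ρ) (γ : Slob s ρ n) :
    ∃ G : ℝ → EuclideanSpace ℝ (Fin n), Continuous G ∧ (∀ x, ‖G x‖ ≤ embConst s ρ * ‖γ‖) ∧
      (∀ᵐ x : ℝ, γ.wderiv (x : UnitAddCircle) = G x) ∧
      ∀ x, HasDerivAt (fun u : ℝ => γ.curve (u : UnitAddCircle)) (G x) x := by
  have h1 : (1 : ℝ) ≤ ρ := Fact.out
  have hrep : ∀ M : ℝ, ‖γ‖ < M → ∃ G : ℝ → EuclideanSpace ℝ (Fin n), Continuous G ∧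
      (∀ x, ‖G x‖ ≤ embConst s ρ * M) ∧ ∀ᵐ x : ℝ, γ.wderiv (x : UnitAddCircle) = G x :=
    fun M hM => exists_continuous_representative hs h1 hsρ γ.isSlobDeriv.memLp
      γ.isSlobDeriv.gagliardo.aestronglyMeasurable ((norm_nonneg _).trans_lt hM)
      (γ.eLpNorm_le.1.trans (ENNReal.ofReal_le_ofReal hM.le))
      (γ.eLpNorm_le.2.trans (ENNReal.ofReal_le_ofReal hM.le))
  obtain ⟨G, hGc, -, hG⟩ := hrep (‖γ‖ + 1) (by linarith)
  refine ⟨G, hGc, fun x => ?_, hG, ?_⟩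
  · have hE := embConst_nonneg h1 hsρ
    -- The representative is available only for positive `M`, so it is taken for `M > ‖γ‖`.
    -- Representatives for different `M` coincide by continuity, and `M` may then decrease to `‖γ‖`.
    have hlim : Tendsto (fun M : ℝ => embConst s ρ * M) (𝓝[>] ‖γ‖) (𝓝 (embConst s ρ * ‖γ‖)) :=
      (tendsto_id.const_mul _).mono_left nhdsWithin_le_nhds
    refine ge_of_tendsto hlim ?_
    filter_upwards [self_mem_nhdsWithin] with M hM
    obtain ⟨G', hG'c, hG'b, hG'⟩ := hrep M hM
    have : G = G' := (hGc.ae_eq_iff_eq volume hG'c).1 (by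
      filter_upwards [hG, hG'] with t h h' using h.symm.trans h')
    rw [this]
    exact hG'b x
  · set f : ℝ → EuclideanSpace ℝ (Fin n) := fun u => γ.curve (u : UnitAddCircle) with hf
    have hfc : Continuous f := γ.curve.continuous.comp (AddCircle.continuous_mk' 1)
    set F : ℝ → EuclideanSpace ℝ (Fin n) := fun x => ∫ t in (0 : ℝ)..x, G t with hF
    have hFd : ∀ x, HasDerivAt F (G x) x := fun x =>
      intervalIntegral.integral_hasDerivAt_right (hGc.intervalIntegrable _ _)
        (hGc.stronglyMeasurableAtFilter _ _) hGc.continuousAt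
    have hFc : Continuous F := continuous_iff_continuousAt.2 fun x => (hFd x).continuousAt
    have hconst : ∀ x y, (f x - F x) = (f y - F y) := by
      refine ae_const_of_integral_deriv_smul_eq_zero (u := fun t => f t - F t) (hfc.sub hFc) ?_
      intro φ hφ hφc
      have hd : Continuous (deriv φ) := hφ.continuous_deriv (by simp)
      have hi : ∀ (ψ : ℝ → ℝ) (v : ℝ → EuclideanSpace ℝ (Fin n)), Continuous ψ →
          HasCompactSupport ψ → Continuous v → Integrable fun t => ψ t • v t :=
        fun ψ v hψ hψc hv => (hψ.smul hv).integrable_of_hasCompactSupport hψc.smul_right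
      simp only [smul_sub]
      rw [integral_sub (hi _ _ hd hφc.deriv hfc) (hi _ _ hd hφc.deriv hFc), sub_eq_zero]
      have e1 : ∫ t, deriv φ t • f t = - ∫ t, φ t • G t := by
        rw [hf, γ.isSlobDeriv.weak φ hφ hφc]
        congr 1
        refine integral_congr_ae ?_
        filter_upwards [hG] with t ht
        rw [ht]
      have hφd : ∀ t, HasDerivAt φ (deriv φ t) t := fun t =>
        ((hφ.differentiable (by simp)) t).hasDerivAt
      have e2 : ∫ t, φ t • G t = - ∫ t, deriv φ t • F t :=
        integral_bilinear_hasDerivAt_right_eq_neg_left_of_integrable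
          (L := ContinuousLinearMap.lsmul ℝ ℝ) (fun t _ => hφd t) (fun t _ => hFd t)
          (hi _ _ hφ.continuous hφc hGc) (hi _ _ hd hφc.deriv hFc) (hi _ _ hφ.continuous hφc hFc)
      rw [e1, e2, neg_neg]
    intro x
    have : f = fun t => F t + (f 0 - F 0) := by
      funext t
      rw [← hconst t 0]; abel
    rw [this]
    exact (hFd x).add_const _

theorem Slob.hasDerivAt (hs : 0 ≤ s) (hsρ : 1 < s * ρ) (γ : Slob s ρ n) (x : ℝ) :
    HasDerivAt (fun u : ℝ => γ.curve (u : UnitAddCircle)) (γ.vel x) x := by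
  obtain ⟨G, -, -, -, hG⟩ := γ.exists_deriv hs hsρ
  have := (hG x).deriv ▸ hG x
  exact this

theorem Slob.vel_spec (hs : 0 ≤ s) (hsρ : 1 < s * ρ) (γ : Slob s ρ n) :
    Continuous γ.vel ∧ (∀ x, ‖γ.vel x‖ ≤ embConst s ρ * ‖γ‖) ∧
      ∀ᵐ x : ℝ, γ.wderiv (x : UnitAddCircle) = γ.vel x := by
  obtain ⟨G, hGc, hGb, hGae, hG⟩ := γ.exists_deriv hs hsρ
  have : γ.vel = G := funext fun x => (hG x).deriv
  rw [this]
  exact ⟨hGc, hGb, hGae⟩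

theorem Slob.vel_add (hs : 0 ≤ s) (hsρ : 1 < s * ρ) (γ η : Slob s ρ n) :
    (γ + η).vel = γ.vel + η.vel := by
  funext x
  exact ((γ.hasDerivAt hs hsρ x).add (η.hasDerivAt hs hsρ x)).deriv

theorem Slob.vel_smul (hs : 0 ≤ s) (hsρ : 1 < s * ρ) (c : ℝ) (γ : Slob s ρ n) :
    (c • γ).vel = c • γ.vel := by
  funext x
  exact ((γ.hasDerivAt hs hsρ x).const_smul c).deriv

theorem Slob.vel_sub (hs : 0 ≤ s) (hsρ : 1 < s * ρ) (γ η : Slob s ρ n) :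
    (γ - η).vel = γ.vel - η.vel := by
  have h := Slob.vel_add hs hsρ (γ - η) η
  rw [sub_add_cancel] at h
  rw [h, add_sub_cancel_right]

theorem Slob.vel_periodic (γ : Slob s ρ n) : Function.Periodic γ.vel 1 := by
  intro x
  have h := deriv_comp_add_const (f := fun u : ℝ => γ.curve (u : UnitAddCircle)) 1 x
  simp only [AddCircle.coe_add, AddCircle.coe_period, add_zero] at h
  exact h.symm

end Embedding

/-! ### The square oscillation as an integrable weight -/

section Weight

variable {n : ℕ}

/-- The domain `(0, 1] × (0, 1/2]` of the pairs (starting point, length of the arc of parameters). -/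
def arcDomain : Set (ℝ × ℝ) := Ioc (0 : ℝ) 1 ×ˢ Ioc (0 : ℝ) (1 / 2)

theorem measurableSet_arcDomain : MeasurableSet arcDomain := measurableSet_Ioc.prod measurableSet_Ioc

instance isFiniteMeasure_arcDomain : IsFiniteMeasure (volume.restrict arcDomain) := by
  refine ⟨?_⟩
  rw [Measure.restrict_apply_univ, arcDomain, Measure.volume_eq_prod, Measure.prod_prod,
    Real.volume_Ioc, Real.volume_Ioc]
  exact ENNReal.mul_lt_top ENNReal.ofReal_lt_top ENNReal.ofReal_lt_top

/-- The weighted mean square oscillation `|w|^{-α} ∫_0^1 |g(x + θw) - g(x)|² dθ`. -/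
noncomputable def sqOsc (α : ℝ) (g : ℝ → EuclideanSpace ℝ (Fin n)) (x w : ℝ) : ℝ :=
  |w| ^ (-α) * ∫ θ in (0 : ℝ)..1, ‖g (x + θ * w) - g x‖ ^ 2

theorem sqOsc_nonneg (α : ℝ) (g : ℝ → EuclideanSpace ℝ (Fin n)) (x w : ℝ) : 0 ≤ sqOsc α g x w :=
  mul_nonneg (Real.rpow_nonneg (abs_nonneg _) _)
    (intervalIntegral.integral_nonneg (by norm_num) fun _ _ => sq_nonneg _)

theorem sqOsc_smul (α c : ℝ) (g : ℝ → EuclideanSpace ℝ (Fin n)) (x w : ℝ) :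
    sqOsc α (c • g) x w = c ^ 2 * sqOsc α g x w := by
  simp only [sqOsc, Pi.smul_apply, ← smul_sub, norm_smul, mul_pow,
    intervalIntegral.integral_const_mul, Real.norm_eq_abs, sq_abs]
  ring

theorem sqOsc_add_le (α : ℝ) {g h : ℝ → EuclideanSpace ℝ (Fin n)} (hg : Continuous g)
    (hh : Continuous h) (x w : ℝ) :
    sqOsc α (g + h) x w ≤ 2 * (sqOsc α g x w + sqOsc α h x w) := by
  have hi : ∀ {g : ℝ → EuclideanSpace ℝ (Fin n)}, Continuous g →
      IntervalIntegrable (fun θ => ‖g (x + θ * w) - g x‖ ^ 2) volume 0 1 := fun hg =>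
    Continuous.intervalIntegrable (by fun_prop) _ _
  have h1 : ∫ θ in (0 : ℝ)..1, ‖(g + h) (x + θ * w) - (g + h) x‖ ^ 2 ≤
      2 * ((∫ θ in (0 : ℝ)..1, ‖g (x + θ * w) - g x‖ ^ 2) +
        ∫ θ in (0 : ℝ)..1, ‖h (x + θ * w) - h x‖ ^ 2) := by
    rw [← intervalIntegral.integral_add (hi hg) (hi hh), ← intervalIntegral.integral_const_mul]
    refine intervalIntegral.integral_mono_on (by norm_num) (hi (hg.add hh))
      (((hi hg).add (hi hh)).const_mul 2) fun θ _ => ?_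
    have h2 : ‖(g + h) (x + θ * w) - (g + h) x‖ ≤
        ‖g (x + θ * w) - g x‖ + ‖h (x + θ * w) - h x‖ := by
      refine le_trans (le_of_eq ?_) (norm_add_le _ _)
      congr 1
      simp only [Pi.add_apply]
      abel
    have h3 := norm_nonneg ((g + h) (x + θ * w) - (g + h) x)
    nlinarith [sq_nonneg (‖g (x + θ * w) - g x‖ - ‖h (x + θ * w) - h x‖)]
  have h4 : 0 ≤ |w| ^ (-α) := Real.rpow_nonneg (abs_nonneg _) _
  unfold sqOsc
  nlinarith

theorem measurable_sqOsc (α : ℝ) {g : ℝ → EuclideanSpace ℝ (Fin n)} (hg : Continuous g) :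
    Measurable fun z : ℝ × ℝ => sqOsc α g z.1 z.2 := by
  have h1 : Continuous fun z : ℝ × ℝ => ∫ θ in (0 : ℝ)..1, ‖g (z.1 + θ * z.2) - g z.1‖ ^ 2 :=
    intervalIntegral.continuous_parametric_intervalIntegral_of_continuous' (by fun_prop) 0 1
  have h2 : Measurable fun z : ℝ × ℝ => |z.2| ^ (-α) := by fun_prop
  exact h2.mul h1.measurable

/-- Jensen's inequality for the uniform probability measure in θ. The square inside becomes the
power 2p = ρ of the Gagliardo seminorm. -/
theorem sqOsc_rpow_le {p : ℝ} (hp : 1 ≤ p) (α : ℝ) {g : ℝ → EuclideanSpace ℝ (Fin n)}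
    (hg : Continuous g) (x w : ℝ) :
    ENNReal.ofReal (sqOsc α g x w ^ p) ≤ ∫⁻ θ in Ioc (0 : ℝ) 1,
      ENNReal.ofReal (|w| ^ (-(α * p))) * ‖g (x + θ * w) - g x‖ₑ ^ (2 * p) := by
  have hp0 : 0 < p := by linarith
  have : IsProbabilityMeasure (volume.restrict (Ioc (0 : ℝ) 1)) := ⟨by simp⟩
  set f : ℝ → ℝ := fun θ => ‖g (x + θ * w) - g x‖ ^ 2 with hf
  have hfc : Continuous f := by fun_prop
  have hf0 : ∀ θ, 0 ≤ f θ := fun θ => sq_nonneg _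
  have hfp : Continuous fun θ => f θ ^ p := hfc.rpow_const fun _ => Or.inr hp0.le
  have hi : ∀ {u : ℝ → ℝ}, Continuous u → Integrable u (volume.restrict (Ioc (0 : ℝ) 1)) :=
    fun hu => (hu.integrableOn_Icc).mono_set Ioc_subset_Icc_self
  have h1 : (∫ θ in Ioc (0 : ℝ) 1, f θ) ^ p ≤ ∫ θ in Ioc (0 : ℝ) 1, f θ ^ p :=
    (convexOn_rpow hp).map_integral_le
      (continuousOn_id.rpow_const fun _ _ => Or.inr hp0.le) isClosed_Ici
      (Eventually.of_forall fun θ => hf0 θ) (hi hfc) (hi hfp)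
  have hw : 0 ≤ |w| ^ (-α) := Real.rpow_nonneg (abs_nonneg _) _
  have hI : 0 ≤ ∫ θ in Ioc (0 : ℝ) 1, f θ := integral_nonneg hf0
  have h2 : sqOsc α g x w ^ p ≤ |w| ^ (-(α * p)) * ∫ θ in Ioc (0 : ℝ) 1, f θ ^ p := by
    rw [sqOsc, intervalIntegral.integral_of_le (by norm_num), Real.mul_rpow hw hI,
      ← Real.rpow_mul (abs_nonneg _), neg_mul]
    gcongr
  refine (ENNReal.ofReal_le_ofReal h2).trans ?_
  rw [ENNReal.ofReal_mul (by positivity), lintegral_const_mul' _ _ ENNReal.ofReal_ne_top,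
    ofReal_integral_eq_lintegral_ofReal (hi hfp) (Eventually.of_forall fun θ => by
      have := hf0 θ; positivity)]
  gcongr with θ
  rw [← ofReal_norm, ENNReal.ofReal_rpow_of_nonneg (norm_nonneg _) (by positivity)]
  apply le_of_eq
  congr 1
  simp only [hf]
  rw [← Real.rpow_natCast, ← Real.rpow_mul (norm_nonneg _)]
  norm_num

theorem setLIntegral_comp_mul_left {f : ℝ → ℝ≥0∞} (hf : Measurable f) {θ : ℝ} (hθ : 0 < θ)
    (b : ℝ) : ∫⁻ w in Ioc 0 b, f (θ * w) = ENNReal.ofReal θ⁻¹ * ∫⁻ w in Ioc 0 (θ * b), f w := by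
  have h1 := setLIntegral_map (μ := volume) (g := fun w : ℝ => θ * w) (f := f)
    (measurableSet_Ioc (a := (0 : ℝ)) (b := θ * b)) hf (measurable_const_mul θ)
  rw [Real.map_volume_mul_left hθ.ne', abs_of_pos (inv_pos.2 hθ), Measure.restrict_smul,
    lintegral_smul_measure] at h1
  have h2 : (fun w : ℝ => θ * w) ⁻¹' Ioc 0 (θ * b) = Ioc 0 b := by
    ext w
    simp [hθ, hθ.ne']
  rw [h2] at h1
  exact h1.symm

/-- By Tonelli the integral in `w` is taken first, and θw is substituted. The kernel yields θ^(αp),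
the Jacobian θ⁻¹, and their product is at most 1 because αp ≥ 1; the new domain (0, θ/2] lies in the
old one. -/
theorem lintegral_sqOsc_rpow_le {p α : ℝ} (hp : 1 ≤ p) (hαp : 1 ≤ α * p)
    {g : ℝ → EuclideanSpace ℝ (Fin n)} (hg : Continuous g) (x : ℝ) :
    ∫⁻ w in Ioc (0 : ℝ) (1 / 2), ENNReal.ofReal (sqOsc α g x w ^ p) ≤
      ∫⁻ w in Ioc (0 : ℝ) (1 / 2),
        ENNReal.ofReal (|w| ^ (-(α * p))) * ‖g (x + w) - g x‖ₑ ^ (2 * p) := by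
  set f : ℝ → ℝ≥0∞ := fun w => ENNReal.ofReal (|w| ^ (-(α * p))) * ‖g (x + w) - g x‖ₑ ^ (2 * p)
    with hf
  have hfm : Measurable f := by
    have h1 : Measurable fun w : ℝ => |w| ^ (-(α * p)) := by fun_prop
    have h2 : Measurable fun w : ℝ => ‖g (x + w) - g x‖ₑ :=
      (by fun_prop : Continuous fun w : ℝ => g (x + w) - g x).measurable.enorm
    exact h1.ennreal_ofReal.mul (h2.pow_const _)
  have hm : Measurable fun z : ℝ × ℝ =>
      ENNReal.ofReal (|z.1| ^ (-(α * p))) * ‖g (x + z.2 * z.1) - g x‖ₑ ^ (2 * p) := by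
    have h1 : Measurable fun z : ℝ × ℝ => |z.1| ^ (-(α * p)) := by fun_prop
    have h2 : Measurable fun z : ℝ × ℝ => ‖g (x + z.2 * z.1) - g x‖ₑ :=
      (by fun_prop : Continuous fun z : ℝ × ℝ => g (x + z.2 * z.1) - g x).measurable.enorm
    exact h1.ennreal_ofReal.mul (h2.pow_const _)
  calc _ ≤ ∫⁻ w in Ioc (0 : ℝ) (1 / 2), ∫⁻ θ in Ioc (0 : ℝ) 1,
        ENNReal.ofReal (|w| ^ (-(α * p))) * ‖g (x + θ * w) - g x‖ₑ ^ (2 * p) :=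
        lintegral_mono fun w => sqOsc_rpow_le hp α hg x w
    _ = ∫⁻ θ in Ioc (0 : ℝ) 1, ∫⁻ w in Ioc (0 : ℝ) (1 / 2),
        ENNReal.ofReal (|w| ^ (-(α * p))) * ‖g (x + θ * w) - g x‖ₑ ^ (2 * p) :=
        lintegral_lintegral_swap hm.aemeasurable
    _ ≤ ∫⁻ θ in Ioc (0 : ℝ) 1, ∫⁻ w in Ioc (0 : ℝ) (1 / 2), f w := by
        refine setLIntegral_mono' measurableSet_Ioc fun θ hθ => ?_
        have hθ0 := hθ.1
        have h1 : ∀ w, ENNReal.ofReal (|w| ^ (-(α * p))) * ‖g (x + θ * w) - g x‖ₑ ^ (2 * p) =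
            ENNReal.ofReal (θ ^ (α * p)) * f (θ * w) := by
          intro w
          simp only [hf]
          rw [← mul_assoc, ← ENNReal.ofReal_mul (by positivity), abs_mul, abs_of_pos hθ0,
            Real.mul_rpow hθ0.le (abs_nonneg _), ← mul_assoc, ← Real.rpow_add hθ0]
          simp
        simp only [h1]
        rw [lintegral_const_mul' _ _ ENNReal.ofReal_ne_top, setLIntegral_comp_mul_left hfm hθ0,
          ← mul_assoc, ← ENNReal.ofReal_mul (by positivity)]
        have h2 : θ ^ (α * p) * θ⁻¹ ≤ 1 := by
          rw [← Real.rpow_neg_one, ← Real.rpow_add hθ0]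
          exact Real.rpow_le_one hθ0.le hθ.2 (by linarith)
        calc _ ≤ 1 * ∫⁻ w in Ioc (0 : ℝ) (1 / 2), f w := by
              gcongr
              · exact ENNReal.ofReal_le_one.2 h2
              · nlinarith [hθ.2]
          _ = _ := one_mul _
    _ = _ := by simp

variable {s ρ : ℝ} [Fact (1 ≤ ρ)]

/-- A measure preserving shear of the torus turns the Gagliardo integral into one over the starting
point and the increment. For 0 < w ≤ 1/2 the distance on the circle equals `w`; the other increments
are discarded. -/
theorem Slob.lintegral_vel_le (hs : 0 ≤ s) (hsρ : 1 < s * ρ) (γ : Slob s ρ n) :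
    ∫⁻ x in Ioc (0 : ℝ) 1, ∫⁻ w in Ioc (0 : ℝ) (1 / 2),
      ENNReal.ofReal (|w| ^ (-(1 + s * ρ))) * ‖γ.vel (x + w) - γ.vel x‖ₑ ^ ρ ≤
      ENNReal.ofReal (‖γ‖ ^ ρ) := by
  have hρ : (1 : ℝ) ≤ ρ := Fact.out
  have h0 : 0 < ρ := by linarith
  have hae := (γ.vel_spec hs hsρ).2.2
  set F : UnitAddCircle × UnitAddCircle → ℝ≥0∞ := fun z => ‖fracQuot s ρ γ.wderiv z‖ₑ ^ ρ with hF
  have hFm : AEMeasurable F volume := γ.isSlobDeriv.gagliardo.aestronglyMeasurable.enorm.pow_const _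
  have hshear : MeasurePreserving (fun z : UnitAddCircle × UnitAddCircle => (z.1, z.1 + z.2))
      volume volume := measurePreserving_prod_add volume volume
  have h1 : ∫⁻ z, F z ≤ ENNReal.ofReal (‖γ‖ ^ ρ) := by
    rw [← eLpNorm_rpow_eq_lintegral hρ, ← ENNReal.ofReal_rpow_of_nonneg (norm_nonneg _) h0.le]
    gcongr
    exact γ.eLpNorm_le.2
  have h2 : ∫⁻ z : UnitAddCircle × UnitAddCircle, F (z.1, z.1 + z.2) = ∫⁻ z, F z := by
    rw [← hshear.map_eq] at hFm
    have := lintegral_map' hFm hshear.measurable.aemeasurable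
    rw [hshear.map_eq] at this
    exact this.symm
  have h3 := lintegral_lintegral_circle
    (F := fun z : UnitAddCircle × UnitAddCircle => F (z.1, z.1 + z.2))
    (hFm.comp_quasiMeasurePreserving hshear.quasiMeasurePreserving) 0 (-(1 / 2))
  rw [h2] at h3
  refine le_trans ?_ (h3.le.trans h1)
  rw [zero_add]
  have hae' : ∀ᵐ x : ℝ ∂volume.restrict (Ioc (0 : ℝ) 1), γ.wderiv (x : UnitAddCircle) = γ.vel x :=
    ae_restrict_of_ae hae
  refine lintegral_mono_ae ?_
  filter_upwards [hae'] with x hx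
  have hxw : ∀ᵐ w : ℝ, γ.wderiv ((x + w : ℝ) : UnitAddCircle) = γ.vel (x + w) :=
    (measurePreserving_add_left volume x).quasiMeasurePreserving.ae hae
  have hsub : Ioc (0 : ℝ) (1 / 2) ⊆ Ioc (-(1 / 2)) (-(1 / 2) + 1) :=
    Ioc_subset_Ioc (by norm_num) (by norm_num)
  refine le_trans ?_ (lintegral_mono_set hsub)
  refine lintegral_mono_ae ?_
  filter_upwards [ae_restrict_of_ae hxw, ae_restrict_mem measurableSet_Ioc] with w hw hwm
  have hd : dist (x : UnitAddCircle) ((x : UnitAddCircle) + (w : UnitAddCircle)) = w := by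
    rw [dist_eq_norm, sub_add_cancel_left, norm_neg,
      (AddCircle.norm_coe_eq_abs_iff 1 one_ne_zero).2]
    · exact abs_of_pos hwm.1
    · rw [abs_of_pos hwm.1, abs_one]; exact hwm.2
  simp only [hF, fracQuot]
  rw [hd, ← AddCircle.coe_add, hx, hw, enorm_smul, ENNReal.mul_rpow_of_nonneg _ _ h0.le,
    enorm_sub_rev (γ.vel x)]
  gcongr
  have hw0 := hwm.1
  rw [Real.enorm_eq_ofReal (by positivity), ENNReal.ofReal_rpow_of_nonneg (by positivity) h0.le,
    abs_of_pos hw0, ← Real.rpow_neg hw0.le, ← Real.rpow_mul hw0.le]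
  apply le_of_eq
  congr 2
  field_simp
  ring

end Weight

/-! ### The weight on the energy space -/

section WeightSlob

variable {n : ℕ} {α p : ℝ} [Fact (1 ≤ p)]

/-- The curves in `W^{1+s,2p}` with `s = (αp - 1)/(2p)`. -/
abbrev EnergySpace (α p : ℝ) [Fact (1 ≤ p)] (n : ℕ) : Type := Slob ((α * p - 1) / (2 * p)) (2 * p) n

/-- The second relation is the condition for the embedding; the third matches the weight |w|^(-αp)
with the Gagliardo kernel. -/
theorem exponent_facts (h2 : 2 < α * p) : 0 ≤ (α * p - 1) / (2 * p) ∧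
    1 < (α * p - 1) / (2 * p) * (2 * p) ∧ 1 + (α * p - 1) / (2 * p) * (2 * p) = α * p := by
  have hp : (1 : ℝ) ≤ p := Fact.out
  have hp0 : 0 < p := by linarith
  have h : (α * p - 1) / (2 * p) * (2 * p) = α * p - 1 := div_mul_cancel₀ _ (by positivity)
  refine ⟨div_nonneg (by linarith) (by linarith), by rw [h]; linarith, by rw [h]; ring⟩

theorem lintegral_weight_le (h2 : 2 < α * p) (γ : EnergySpace α p n) :
    ∫⁻ z in arcDomain, ENNReal.ofReal (sqOsc α γ.vel z.1 z.2 ^ p) ≤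
      ENNReal.ofReal (‖γ‖ ^ (2 * p)) := by
  have hp : (1 : ℝ) ≤ p := Fact.out
  obtain ⟨e1, e2, e3⟩ := exponent_facts (p := p) h2
  have hc := (γ.vel_spec e1 e2).1
  have h3 := γ.lintegral_vel_le e1 e2
  rw [e3] at h3
  refine le_trans ?_ h3
  rw [arcDomain, Measure.volume_eq_prod, ← Measure.prod_restrict, lintegral_prod _
    ((measurable_sqOsc α hc).pow_const p).ennreal_ofReal.aemeasurable]
  exact lintegral_mono fun x => lintegral_sqOsc_rpow_le hp (by linarith) hc x

theorem integrable_weight (h2 : 2 < α * p) (γ : EnergySpace α p n) :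
    Integrable (fun z : ℝ × ℝ => sqOsc α γ.vel z.1 z.2 ^ p) (volume.restrict arcDomain) := by
  obtain ⟨e1, e2, -⟩ := exponent_facts (p := p) h2
  refine ⟨((measurable_sqOsc α (γ.vel_spec e1 e2).1).pow_const p).aestronglyMeasurable, ?_⟩
  rw [hasFiniteIntegral_iff_ofReal (Eventually.of_forall fun z =>
    Real.rpow_nonneg (sqOsc_nonneg _ _ _ _) _)]
  exact (lintegral_weight_le h2 γ).trans_lt ENNReal.ofReal_lt_top

theorem integral_weight_le (h2 : 2 < α * p) (γ : EnergySpace α p n) :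
    ∫ z in arcDomain, sqOsc α γ.vel z.1 z.2 ^ p ≤ ‖γ‖ ^ (2 * p) := by
  rw [integral_eq_lintegral_of_nonneg_ae (Eventually.of_forall fun z =>
    Real.rpow_nonneg (sqOsc_nonneg _ _ _ _) _) (integrable_weight h2 γ).aestronglyMeasurable]
  exact ENNReal.toReal_le_of_le_ofReal (by positivity) (lintegral_weight_le h2 γ)

end WeightSlob

/-! ### Inequalities for real powers -/

section Elementary

theorem abs_rpow_neg_sub_le {b κ x y : ℝ} (hb : 0 < b) (hκ : 0 < κ) (hx : κ ≤ x) (hy : κ ≤ y) :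
    |x ^ (-b) - y ^ (-b)| ≤ b * κ ^ (-b - 1) * |x - y| := by
  have hd : ∀ z ∈ Ici κ, HasDerivWithinAt (fun z : ℝ => z ^ (-b)) (-b * z ^ (-b - 1)) (Ici κ) z :=
    fun z hz => (Real.hasDerivAt_rpow_const (Or.inl (hκ.trans_le hz).ne')).hasDerivWithinAt
  refine (convex_Ici κ).norm_image_sub_le_of_norm_hasDerivWithin_le hd (fun z hz => ?_) hy hx
  have hz0 : 0 < z := hκ.trans_le hz
  rw [norm_mul, Real.norm_eq_abs, abs_neg, abs_of_pos hb, Real.norm_of_nonneg (by positivity)]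
  exact mul_le_mul_of_nonneg_left (Real.rpow_le_rpow_of_nonpos hκ hz (by linarith)) hb.le

/-- The intermediate pair `(A₁, D₂)` separates the two changes. The function z ↦ z^(-b) - (z +
D₂)^(-b) has a derivative of order `D₂`, so the change of `A` is multiplied by `D₂`. This factor
later compensates the singular w^(-α), which a plain Lipschitz bound could not do. -/
theorem abs_second_diff_rpow_neg_le {b κ A₁ A₂ D₁ D₂ : ℝ} (hb : 0 < b) (hκ : 0 < κ) (h₁ : κ ≤ A₁)
    (h₂ : κ ≤ A₂) (hD₁ : 0 ≤ D₁) (hD₂ : 0 ≤ D₂) :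
    |(A₁ ^ (-b) - (A₁ + D₁) ^ (-b)) - (A₂ ^ (-b) - (A₂ + D₂) ^ (-b))| ≤
      b * κ ^ (-b - 1) * |D₁ - D₂| + b * (b + 1) * κ ^ (-b - 2) * D₂ * |A₁ - A₂| := by
  have h3 : |(A₁ + D₂) ^ (-b) - (A₁ + D₁) ^ (-b)| ≤ b * κ ^ (-b - 1) * |D₁ - D₂| := by
    have := abs_rpow_neg_sub_le hb hκ (show κ ≤ A₁ + D₂ by linarith)
      (show κ ≤ A₁ + D₁ by linarith)
    rw [add_sub_add_left_eq_sub, abs_sub_comm D₂ D₁] at this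
    exact this
  have h4 : |(A₁ ^ (-b) - (A₁ + D₂) ^ (-b)) - (A₂ ^ (-b) - (A₂ + D₂) ^ (-b))| ≤
      b * (b + 1) * κ ^ (-b - 2) * D₂ * |A₁ - A₂| := by
    have hd : ∀ z ∈ Ici κ, HasDerivWithinAt (fun z : ℝ => z ^ (-b) - (z + D₂) ^ (-b))
        (-b * z ^ (-b - 1) - -b * (z + D₂) ^ (-b - 1)) (Ici κ) z := by
      intro z hz
      have hz0 : 0 < z := hκ.trans_le hz
      have e1 := Real.hasDerivAt_rpow_const (x := z) (p := -b) (Or.inl hz0.ne')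
      have e2 := (Real.hasDerivAt_rpow_const (x := z + D₂) (p := -b)
        (Or.inl (by linarith))).comp_add_const z D₂
      exact (e1.sub e2).hasDerivWithinAt
    refine (convex_Ici κ).norm_image_sub_le_of_norm_hasDerivWithin_le hd (fun z hz => ?_) h₂ h₁
    have hz' : κ ≤ z := hz
    have e3 := abs_rpow_neg_sub_le (b := b + 1) (by linarith) hκ (show κ ≤ z + D₂ by linarith) hz'
    rw [add_sub_cancel_left, abs_of_nonneg hD₂] at e3
    have e4 : -(b + 1) = -b - 1 := by ring
    have e5 : -b - 1 - 1 = -b - 2 := by ring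
    rw [e4, e5] at e3
    have e6 : -b * z ^ (-b - 1) - -b * (z + D₂) ^ (-b - 1) =
        b * ((z + D₂) ^ (-b - 1) - z ^ (-b - 1)) := by ring
    rw [e6, norm_mul, Real.norm_of_nonneg hb.le, Real.norm_eq_abs]
    calc b * |(z + D₂) ^ (-b - 1) - z ^ (-b - 1)| ≤ b * ((b + 1) * κ ^ (-b - 2) * D₂) := by gcongr
      _ = _ := by ring
  calc _ = |((A₁ + D₂) ^ (-b) - (A₁ + D₁) ^ (-b)) +
        ((A₁ ^ (-b) - (A₁ + D₂) ^ (-b)) - (A₂ ^ (-b) - (A₂ + D₂) ^ (-b)))| := by congr 1; ring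
    _ ≤ _ := (abs_add_le _ _).trans (add_le_add h3 h4)

theorem abs_rpow_sub_rpow_le {p a b R : ℝ} (hp : 1 ≤ p) (ha : 0 ≤ a) (hb : 0 ≤ b) (haR : a ≤ R)
    (hbR : b ≤ R) : |a ^ p - b ^ p| ≤ p * R ^ (p - 1) * |a - b| := by
  have hd : ∀ z ∈ Icc 0 R, HasDerivWithinAt (fun z : ℝ => z ^ p) (p * z ^ (p - 1)) (Icc 0 R) z :=
    fun z _ => (Real.hasDerivAt_rpow_const (Or.inr hp)).hasDerivWithinAt
  refine (convex_Icc 0 R).norm_image_sub_le_of_norm_hasDerivWithin_le hd (fun z hz => ?_)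
    ⟨hb, hbR⟩ ⟨ha, haR⟩
  have hz0 := hz.1
  rw [Real.norm_of_nonneg (by positivity)]
  have := Real.rpow_le_rpow hz0 hz.2 (show 0 ≤ p - 1 by linarith)
  gcongr

theorem rpow_sub_one_mul_le {p x y : ℝ} (hp : 1 ≤ p) (hx : 0 ≤ x) (hy : 0 ≤ y) :
    x ^ (p - 1) * y ≤ x ^ p + y ^ p := by
  have key : ∀ z : ℝ, 0 ≤ z → z ^ (p - 1) * z = z ^ p := by
    intro z hz
    rcases hz.eq_or_lt with rfl | hz
    · rw [mul_zero, Real.zero_rpow (by linarith)]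
    · rw [← Real.rpow_add_one hz.ne', sub_add_cancel]
  have hxp := Real.rpow_nonneg hx p
  have hyp := Real.rpow_nonneg hy p
  rcases le_total x y with h | h
  · calc x ^ (p - 1) * y ≤ y ^ (p - 1) * y := by gcongr
      _ = y ^ p := key y hy
      _ ≤ _ := by linarith
  · calc x ^ (p - 1) * y ≤ x ^ (p - 1) * x := by gcongr
      _ = x ^ p := key x hx
      _ ≤ _ := by linarith

theorem add_rpow_le_two_rpow {p x y : ℝ} (hp : 0 ≤ p) (hx : 0 ≤ x) (hy : 0 ≤ y) :
    (x + y) ^ p ≤ 2 ^ p * (x ^ p + y ^ p) := by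
  have key : ∀ {x y : ℝ}, 0 ≤ x → 0 ≤ y → x ≤ y → (x + y) ^ p ≤ 2 ^ p * (x ^ p + y ^ p) := by
    intro x y hx hy h
    have h1 : (x + y) ^ p ≤ (2 * y) ^ p := Real.rpow_le_rpow (by linarith) (by linarith) hp
    rw [Real.mul_rpow (by norm_num) hy] at h1
    have := Real.rpow_nonneg hx p
    have h2 : (0 : ℝ) < 2 ^ p := by positivity
    nlinarith
  rcases le_total x y with h | h
  · exact key hx hy h
  · rw [add_comm x, add_comm (x ^ p)]; exact key hy hx h

end Elementary

/-! ### Second differences of norms and the Cauchy–Schwarz defect -/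

section Vectors

variable {E : Type*} [NormedAddCommGroup E] [InnerProductSpace ℝ E]

theorem norm_sub_norm_mul_add (a b : E) :
    (‖a‖ - ‖b‖) * (‖a‖ + ‖b‖) = inner ℝ (a - b) (a + b) := by
  have h : inner ℝ (a - b) (a + b) = ‖a‖ ^ 2 - ‖b‖ ^ 2 := by
    rw [inner_sub_left, inner_add_right, inner_add_right, real_inner_self_eq_norm_sq,
      real_inner_self_eq_norm_sq, real_inner_comm a b]
    ring
  rw [h]; ring

/-- The norm has a Lipschitz gradient away from the origin. Concretely, ‖a‖ - ‖b‖ = ⟨a - b, a + b⟩ /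
(‖a‖ + ‖b‖); after multiplication by ‖a₁‖ + ‖b₁‖ each term contains either the second difference or
`a₂ - b₂` together with a change of size at most 2η. A lower bound on the first pair is enough. -/
theorem abs_second_diff_norm_le {c η : ℝ} {a₁ b₁ a₂ b₂ : E} (hc : 0 < c) (ha₁ : c ≤ ‖a₁‖)
    (hb₁ : c ≤ ‖b₁‖) (ha : ‖a₁ - a₂‖ ≤ η) (hb : ‖b₁ - b₂‖ ≤ η) :
    |(‖a₁‖ - ‖b₁‖) - (‖a₂‖ - ‖b₂‖)| ≤
      ‖(a₁ - b₁) - (a₂ - b₂)‖ + 2 * η / c * ‖a₂ - b₂‖ := by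
  set S : ℝ := ‖a₁‖ + ‖b₁‖ with hS
  have hS0 : 2 * c ≤ S := by rw [hS]; linarith
  have hSpos : 0 < S := by linarith
  have hη : 0 ≤ η := (norm_nonneg _).trans ha
  have h1 := norm_sub_norm_mul_add a₁ b₁
  have h2 := norm_sub_norm_mul_add a₂ b₂
  have key : ((‖a₁‖ - ‖b₁‖) - (‖a₂‖ - ‖b₂‖)) * S =
      inner ℝ ((a₁ - b₁) - (a₂ - b₂)) (a₁ + b₁) + inner ℝ (a₂ - b₂) ((a₁ - a₂) + (b₁ - b₂)) +
        (‖a₂‖ - ‖b₂‖) * ((‖a₂‖ - ‖a₁‖) + (‖b₂‖ - ‖b₁‖)) := by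
    have e1 : (a₁ - a₂) + (b₁ - b₂) = (a₁ + b₁) - (a₂ + b₂) := by abel
    rw [e1, inner_sub_left (a₁ - b₁), inner_sub_right (a₂ - b₂), ← h1, ← h2]
    rw [hS]
    ring
  have k1 : |inner ℝ ((a₁ - b₁) - (a₂ - b₂)) (a₁ + b₁)| ≤ ‖(a₁ - b₁) - (a₂ - b₂)‖ * S :=
    (abs_real_inner_le_norm _ _).trans
      (mul_le_mul_of_nonneg_left (norm_add_le _ _) (norm_nonneg _))
  have k2 : |inner ℝ (a₂ - b₂) ((a₁ - a₂) + (b₁ - b₂))| ≤ ‖a₂ - b₂‖ * (2 * η) :=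
    (abs_real_inner_le_norm _ _).trans (mul_le_mul_of_nonneg_left
      ((norm_add_le _ _).trans (by linarith)) (norm_nonneg _))
  have k3 : |(‖a₂‖ - ‖b₂‖) * ((‖a₂‖ - ‖a₁‖) + (‖b₂‖ - ‖b₁‖))| ≤ ‖a₂ - b₂‖ * (2 * η) := by
    rw [abs_mul]
    have e1 := abs_norm_sub_norm_le a₂ a₁
    have e2 := abs_norm_sub_norm_le b₂ b₁
    rw [norm_sub_rev] at e1 e2
    refine mul_le_mul (abs_norm_sub_norm_le _ _) ((abs_add_le _ _).trans (by linarith))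
      (abs_nonneg _) (norm_nonneg _)
  have k4 : |(‖a₁‖ - ‖b₁‖) - (‖a₂‖ - ‖b₂‖)| * S ≤
      ‖(a₁ - b₁) - (a₂ - b₂)‖ * S + ‖a₂ - b₂‖ * (4 * η) := by
    rw [← abs_of_pos hSpos, ← abs_mul, abs_of_pos hSpos, key]
    refine (abs_add_le _ _).trans ((add_le_add ((abs_add_le _ _).trans (add_le_add k1 k2)) k3).trans
      (le_of_eq (by ring)))
  have k5 : ‖a₂ - b₂‖ * (4 * η) ≤ 2 * η / c * ‖a₂ - b₂‖ * S := by
    have : 2 * η / c * ‖a₂ - b₂‖ * (2 * c) = ‖a₂ - b₂‖ * (4 * η) := by field_simp; ring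
    rw [← this]
    gcongr
  have k6 : |(‖a₁‖ - ‖b₁‖) - (‖a₂‖ - ‖b₂‖)| * S ≤
      (‖(a₁ - b₁) - (a₂ - b₂)‖ + 2 * η / c * ‖a₂ - b₂‖) * S := by
    rw [add_mul]; linarith
  exact le_of_mul_le_mul_right k6 hSpos

/-- The defect in the Cauchy–Schwarz inequality. -/
noncomputable def csDefect (a b : E) : ℝ := ‖a‖ * ‖b‖ - inner ℝ a b

/-- In this form the defect is visibly of second order in `a - b`, and differences of defects factor
as differences of squares. -/
theorem csDefect_eq (a b : E) : csDefect a b = (‖a - b‖ ^ 2 - (‖a‖ - ‖b‖) ^ 2) / 2 := by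
  rw [csDefect, norm_sub_sq_real]; ring

theorem csDefect_nonneg (a b : E) : 0 ≤ csDefect a b :=
  sub_nonneg.2 (real_inner_le_norm a b)

theorem csDefect_le (a b : E) : csDefect a b ≤ ‖a - b‖ ^ 2 / 2 := by
  rw [csDefect_eq]; nlinarith [sq_nonneg (‖a‖ - ‖b‖)]

/-- Each square in `csDefect_eq` changes by a sum times a difference. The parameter `t` is the
weight in Young's inequality; it stays free so that the oscillation of the increment can later
receive a small coefficient. -/
theorem abs_csDefect_sub_le {c η t : ℝ} {a₁ b₁ a₂ b₂ : E} (hc : 0 < c) (ha₁ : c ≤ ‖a₁‖)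
    (hb₁ : c ≤ ‖b₁‖) (ha : ‖a₁ - a₂‖ ≤ η) (hb : ‖b₁ - b₂‖ ≤ η) (ht : 0 < t) :
    |csDefect a₁ b₁ - csDefect a₂ b₂| ≤
      (t + 2 * η / c) * (‖a₁ - b₁‖ ^ 2 + ‖a₂ - b₂‖ ^ 2) +
        ‖(a₁ - b₁) - (a₂ - b₂)‖ ^ 2 / t := by
  have hη : 0 ≤ η := (norm_nonneg _).trans ha
  have h0 := abs_second_diff_norm_le hc ha₁ hb₁ ha hb
  set X := ‖a₁ - b₁‖
  set Y := ‖a₂ - b₂‖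
  set H := ‖(a₁ - b₁) - (a₂ - b₂)‖
  have hX : 0 ≤ X := norm_nonneg _
  have hY : 0 ≤ Y := norm_nonneg _
  have hH : 0 ≤ H := norm_nonneg _
  have h1 : |X - Y| ≤ H := abs_norm_sub_norm_le _ _
  have h2 : |‖a₁‖ - ‖b₁‖| ≤ X := abs_norm_sub_norm_le _ _
  have h3 : |‖a₂‖ - ‖b₂‖| ≤ Y := abs_norm_sub_norm_le _ _
  have e : csDefect a₁ b₁ - csDefect a₂ b₂ = ((X + Y) * (X - Y) -
      ((‖a₁‖ - ‖b₁‖) + (‖a₂‖ - ‖b₂‖)) * ((‖a₁‖ - ‖b₁‖) - (‖a₂‖ - ‖b₂‖))) / 2 := by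
    rw [csDefect_eq, csDefect_eq]; ring
  have h4 : |(X + Y) * (X - Y)| ≤ (X + Y) * H := by
    rw [abs_mul, abs_of_nonneg (by positivity : 0 ≤ X + Y)]; gcongr
  have h5 : |((‖a₁‖ - ‖b₁‖) + (‖a₂‖ - ‖b₂‖)) * ((‖a₁‖ - ‖b₁‖) - (‖a₂‖ - ‖b₂‖))| ≤
      (X + Y) * (H + 2 * η / c * Y) := by
    rw [abs_mul]
    exact mul_le_mul ((abs_add_le _ _).trans (add_le_add h2 h3)) h0 (abs_nonneg _) (by positivity)
  have h6 : |csDefect a₁ b₁ - csDefect a₂ b₂| ≤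
      ((X + Y) * H + (X + Y) * (H + 2 * η / c * Y)) / 2 := by
    rw [e, abs_div, abs_of_pos (by norm_num : (0 : ℝ) < 2)]
    have := (abs_sub _ _).trans (add_le_add h4 h5)
    linarith
  have h7 : (X + Y) * H ≤ t * (X ^ 2 + Y ^ 2) + H ^ 2 / t := by
    have h8 : 0 ≤ (t * (X + Y) - H) ^ 2 / t := by positivity
    have h9 : (t * (X + Y) - H) ^ 2 / t = t * (X + Y) ^ 2 - 2 * ((X + Y) * H) + H ^ 2 / t := by
      field_simp; ring
    have h10 : 0 ≤ H ^ 2 / t := by positivity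
    nlinarith [mul_nonneg ht.le (sq_nonneg (X - Y))]
  have h8 : (X + Y) * (2 * η / c * Y) ≤ 2 * (2 * η / c) * (X ^ 2 + Y ^ 2) := by
    have : 0 ≤ 2 * η / c := by positivity
    have h9 : (X + Y) * Y ≤ 2 * (X ^ 2 + Y ^ 2) := by nlinarith [sq_nonneg (X - Y)]
    nlinarith
  nlinarith

theorem norm_sub_sq_le_two_mul {E : Type*} [SeminormedAddCommGroup E] (a b r : E) :
    ‖a - b‖ ^ 2 ≤ 2 * (‖a - r‖ ^ 2 + ‖b - r‖ ^ 2) := by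
  have h : ‖a - b‖ ≤ ‖a - r‖ + ‖b - r‖ := by
    rw [norm_sub_rev b r]; exact norm_sub_le_norm_sub_add_norm_sub _ _ _
  nlinarith [sq_nonneg (‖a - r‖ - ‖b - r‖), norm_nonneg (a - b)]

/-- The difference between the squares of the mean norm and of the norm of the mean. -/
noncomputable def meanDefect (u : ℝ → E) : ℝ :=
  (∫ θ in (0 : ℝ)..1, ‖u θ‖) ^ 2 - ‖∫ θ in (0 : ℝ)..1, u θ‖ ^ 2

/-- Writing the squares of the two means as double integrals exhibits the gap between arc and chord
as a superposition of pointwise Cauchy–Schwarz defects, each controlled by an oscillation. -/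
theorem integral_csDefect [CompleteSpace E] {u : ℝ → E} (hu : Continuous u) :
    Continuous (fun a => ∫ b in (0 : ℝ)..1, csDefect (u a) (u b)) ∧
    ∫ a in (0 : ℝ)..1, ∫ b in (0 : ℝ)..1, csDefect (u a) (u b) = meanDefect u := by
  have hi : IntervalIntegrable u volume 0 1 := hu.intervalIntegrable _ _
  have hn : IntervalIntegrable (fun b => ‖u b‖) volume 0 1 := hu.norm.intervalIntegrable _ _
  have h1 : ∀ v : E, ∫ b in (0 : ℝ)..1, csDefect v (u b) =
      ‖v‖ * (∫ b in (0 : ℝ)..1, ‖u b‖) - inner ℝ v (∫ b in (0 : ℝ)..1, u b) := by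
    intro v
    have hin : IntervalIntegrable (fun b => inner ℝ v (u b)) volume 0 1 :=
      (continuous_const.inner hu).intervalIntegrable _ _
    simp only [csDefect]
    rw [intervalIntegral.integral_sub (hn.const_mul _) hin, intervalIntegral.integral_const_mul]
    congr 1
    exact (innerSL ℝ v).intervalIntegral_comp_comm hi
  simp only [h1]
  refine ⟨by fun_prop, ?_⟩
  rw [intervalIntegral.integral_sub (hn.mul_const _)
    ((hu.inner continuous_const).intervalIntegrable _ _), intervalIntegral.integral_mul_const,
    meanDefect, sq]
  congr 1
  simp only [real_inner_comm (∫ b in (0 : ℝ)..1, u b)]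
  rw [← real_inner_self_eq_norm_sq]
  exact (innerSL ℝ (∫ b in (0 : ℝ)..1, u b)).intervalIntegral_comp_comm hi

theorem meanDefect_nonneg (u : ℝ → E) : 0 ≤ meanDefect u := by
  have h := intervalIntegral.norm_integral_le_integral_norm (f := u) (μ := volume) zero_le_one
  have := norm_nonneg (∫ θ in (0 : ℝ)..1, u θ)
  unfold meanDefect
  nlinarith

theorem continuous_csDefect {u : ℝ → E} (hu : Continuous u) (v : E) :
    Continuous fun b => csDefect v (u b) := by
  unfold csDefect
  fun_prop

theorem abs_integral_integral_le {f : ℝ → ℝ → ℝ} {B : ℝ → ℝ} (hB : Continuous B)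
    (h : ∀ a ∈ Icc (0 : ℝ) 1, ∀ b ∈ Icc (0 : ℝ) 1, |f a b| ≤ B a + B b) :
    |∫ a in (0 : ℝ)..1, ∫ b in (0 : ℝ)..1, f a b| ≤ 2 * ∫ a in (0 : ℝ)..1, B a := by
  have hi : IntervalIntegrable B volume 0 1 := hB.intervalIntegrable _ _
  have h1 : ∀ a ∈ Icc (0 : ℝ) 1, |∫ b in (0 : ℝ)..1, f a b| ≤ B a + ∫ b in (0 : ℝ)..1, B b := by
    intro a ha
    have h2 : ‖∫ b in (0 : ℝ)..1, f a b‖ ≤ ∫ b in (0 : ℝ)..1, (B a + B b) :=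
      intervalIntegral.norm_integral_le_of_norm_le zero_le_one
        (Eventually.of_forall fun b hb => h a ha b (Ioc_subset_Icc_self hb))
        ((by simp : IntervalIntegrable (fun _ => B a) volume 0 1).add hi)
    rw [intervalIntegral.integral_add (by simp) hi, intervalIntegral.integral_const] at h2
    simpa using h2
  have h3 : ‖∫ a in (0 : ℝ)..1, ∫ b in (0 : ℝ)..1, f a b‖ ≤
      ∫ a in (0 : ℝ)..1, (B a + ∫ b in (0 : ℝ)..1, B b) :=
    intervalIntegral.norm_integral_le_of_norm_le zero_le_one
      (Eventually.of_forall fun a ha => h1 a (Ioc_subset_Icc_self ha)) (hi.add (by simp))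
  rw [intervalIntegral.integral_add hi (by simp), intervalIntegral.integral_const] at h3
  refine h3.trans (le_of_eq ?_)
  simp
  ring

/-- Inserting the pivot `r` between u(a) and u(b) decouples the two variables. In the applications
the pivot is the value at the starting point, which produces `sqOsc`. -/
theorem meanDefect_le [CompleteSpace E] {u : ℝ → E} (hu : Continuous u) (r : E) :
    meanDefect u ≤ 2 * ∫ θ in (0 : ℝ)..1, ‖u θ - r‖ ^ 2 := by
  rw [← (integral_csDefect hu).2]
  refine (le_abs_self _).trans (abs_integral_integral_le (by fun_prop) fun a _ b _ => ?_)
  rw [abs_of_nonneg (csDefect_nonneg _ _)]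
  have h1 := csDefect_le (u a) (u b)
  have h2 := norm_sub_sq_le_two_mul (u a) (u b) r
  linarith

theorem abs_meanDefect_sub_le [CompleteSpace E] {c η t : ℝ} {u₁ u₂ : ℝ → E} (hu₁ : Continuous u₁)
    (hu₂ : Continuous u₂) (hc : 0 < c) (h₁ : ∀ θ ∈ Icc (0 : ℝ) 1, c ≤ ‖u₁ θ‖)
    (hη : ∀ θ ∈ Icc (0 : ℝ) 1, ‖u₁ θ - u₂ θ‖ ≤ η) (ht : 0 < t) (r₁ r₂ : E) :
    |meanDefect u₁ - meanDefect u₂| ≤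
      4 * ((t + 2 * η / c) * ((∫ θ in (0 : ℝ)..1, ‖u₁ θ - r₁‖ ^ 2) +
        ∫ θ in (0 : ℝ)..1, ‖u₂ θ - r₂‖ ^ 2) +
        (∫ θ in (0 : ℝ)..1, ‖(u₁ θ - u₂ θ) - (r₁ - r₂)‖ ^ 2) / t) := by
  have hη0 : 0 ≤ η := (norm_nonneg _).trans (hη 0 ⟨le_rfl, zero_le_one⟩)
  obtain ⟨i1, e1⟩ := integral_csDefect hu₁
  obtain ⟨i2, e2⟩ := integral_csDefect hu₂
  rw [← e1, ← e2, ← intervalIntegral.integral_sub (i1.intervalIntegrable _ _)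
    (i2.intervalIntegrable _ _)]
  have e3 : ∀ a, (∫ b in (0 : ℝ)..1, csDefect (u₁ a) (u₁ b)) -
      ∫ b in (0 : ℝ)..1, csDefect (u₂ a) (u₂ b) =
      ∫ b in (0 : ℝ)..1, (csDefect (u₁ a) (u₁ b) - csDefect (u₂ a) (u₂ b)) := fun a =>
    (intervalIntegral.integral_sub ((continuous_csDefect hu₁ _).intervalIntegrable _ _)
      ((continuous_csDefect hu₂ _).intervalIntegrable _ _)).symm
  simp only [e3]
  set B : ℝ → ℝ := fun θ => 2 * ((t + 2 * η / c) * (‖u₁ θ - r₁‖ ^ 2 + ‖u₂ θ - r₂‖ ^ 2) +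
    ‖(u₁ θ - u₂ θ) - (r₁ - r₂)‖ ^ 2 / t) with hB
  have hBc : Continuous B := by fun_prop
  refine (abs_integral_integral_le hBc fun a ha b hb => ?_).trans (le_of_eq ?_)
  · have k0 := abs_csDefect_sub_le hc (h₁ a ha) (h₁ b hb) (hη a ha) (hη b hb) ht
    have k1 := norm_sub_sq_le_two_mul (u₁ a) (u₁ b) r₁
    have k2 := norm_sub_sq_le_two_mul (u₂ a) (u₂ b) r₂
    have k3 := norm_sub_sq_le_two_mul (u₁ a - u₂ a) (u₁ b - u₂ b) (r₁ - r₂)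
    have k4 : (u₁ a - u₂ a) - (u₁ b - u₂ b) = (u₁ a - u₁ b) - (u₂ a - u₂ b) := by abel
    rw [k4] at k3
    have k5 : 0 ≤ t + 2 * η / c := by positivity
    calc _ ≤ _ := k0
      _ ≤ (t + 2 * η / c) * (2 * (‖u₁ a - r₁‖ ^ 2 + ‖u₁ b - r₁‖ ^ 2) +
          2 * (‖u₂ a - r₂‖ ^ 2 + ‖u₂ b - r₂‖ ^ 2)) + 2 * (‖u₁ a - u₂ a - (r₁ - r₂)‖ ^ 2 +
          ‖u₁ b - u₂ b - (r₁ - r₂)‖ ^ 2) / t := by gcongr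
      _ = B a + B b := by simp only [hB]; ring
  · have j1 : IntervalIntegrable (fun θ => ‖u₁ θ - r₁‖ ^ 2) volume 0 1 :=
      Continuous.intervalIntegrable (by fun_prop) _ _
    have j2 : IntervalIntegrable (fun θ => ‖u₂ θ - r₂‖ ^ 2) volume 0 1 :=
      Continuous.intervalIntegrable (by fun_prop) _ _
    have j3 : IntervalIntegrable (fun θ => ‖(u₁ θ - u₂ θ) - (r₁ - r₂)‖ ^ 2) volume 0 1 :=
      Continuous.intervalIntegrable (by fun_prop) _ _
    simp only [hB]
    rw [intervalIntegral.integral_const_mul, intervalIntegral.integral_add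
      ((j1.add j2).const_mul _) (j3.div_const _), intervalIntegral.integral_const_mul,
      intervalIntegral.integral_add j1 j2, intervalIntegral.integral_div]
    ring

end Vectors

/-! ### Bounds and Lipschitz estimates for the energy density -/

section Density

variable {n : ℕ}

/-- The mean of `g` over the interval between `x` and `x + w`. -/
noncomputable def avg (g : ℝ → EuclideanSpace ℝ (Fin n)) (x w : ℝ) : EuclideanSpace ℝ (Fin n) :=
  ∫ θ in (0 : ℝ)..1, g (x + θ * w)

/-- The mean of `|g|` over the interval between `x` and `x + w`. -/
noncomputable def normAvg (g : ℝ → EuclideanSpace ℝ (Fin n)) (x w : ℝ) : ℝ :=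
  ∫ θ in (0 : ℝ)..1, ‖g (x + θ * w)‖

/-- The length of a closed curve with derivative `g`. -/
noncomputable def totalLength (g : ℝ → EuclideanSpace ℝ (Fin n)) : ℝ := ∫ t in (0 : ℝ)..1, ‖g t‖

/-- The difference of the powers of the reciprocals of chord and intrinsic distance, between the
parameters `x` and `x + w`, for a curve with derivative `g`. -/
noncomputable def gap (α : ℝ) (g : ℝ → EuclideanSpace ℝ (Fin n)) (x w : ℝ) : ℝ :=
  1 / (w * ‖avg g x w‖) ^ α - 1 / (min (w * normAvg g x w) (totalLength g - w * normAvg g x w)) ^ α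

/-- The energy density between the parameters `x` and `x + w`. -/
noncomputable def density (α p : ℝ) (g : ℝ → EuclideanSpace ℝ (Fin n)) (x w : ℝ) : ℝ :=
  gap α g x w ^ p * ‖g x‖ * ‖g (x + w)‖

/-- Derivatives of closed curves with a bi-Lipschitz bound `c` and speed at most `M`. -/
structure IsTame (c M : ℝ) (g : ℝ → EuclideanSpace ℝ (Fin n)) : Prop where
  continuous : Continuous g
  periodic : Function.Periodic g 1
  closed : ∫ t in (0 : ℝ)..1, g t = 0
  norm_le : ∀ x, ‖g x‖ ≤ M
  le_norm_avg : ∀ x, ∀ w ∈ Icc (0 : ℝ) (1 / 2), c ≤ ‖avg g x w‖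

variable {c M : ℝ} {g : ℝ → EuclideanSpace ℝ (Fin n)}

theorem smul_avg (g : ℝ → EuclideanSpace ℝ (Fin n)) (x w : ℝ) :
    w • avg g x w = ∫ t in x..x + w, g t := by
  simp [avg, mul_comm]

theorem mul_normAvg (g : ℝ → EuclideanSpace ℝ (Fin n)) (x w : ℝ) :
    w * normAvg g x w = ∫ t in x..x + w, ‖g t‖ := by
  have := intervalIntegral.smul_integral_comp_add_mul (a := 0) (b := 1) (fun t => ‖g t‖) w x
  simpa [normAvg, mul_comm] using this

theorem continuous_avg (hg : Continuous g) : Continuous fun z : ℝ × ℝ => avg g z.1 z.2 :=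
  intervalIntegral.continuous_parametric_intervalIntegral_of_continuous' (by fun_prop) 0 1

theorem continuous_normAvg (hg : Continuous g) : Continuous fun z : ℝ × ℝ => normAvg g z.1 z.2 :=
  intervalIntegral.continuous_parametric_intervalIntegral_of_continuous' (by fun_prop) 0 1

theorem measurable_gap (α : ℝ) (hg : Continuous g) :
    Measurable fun z : ℝ × ℝ => gap α g z.1 z.2 := by
  have h1 : Measurable fun z : ℝ × ℝ => avg g z.1 z.2 := (continuous_avg hg).measurable
  have h2 : Measurable fun z : ℝ × ℝ => normAvg g z.1 z.2 := (continuous_normAvg hg).measurable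
  unfold gap
  fun_prop

theorem measurable_density (α p : ℝ) (hg : Continuous g) :
    Measurable fun z : ℝ × ℝ => density α p g z.1 z.2 := by
  have h1 := measurable_gap α hg
  have h2 : Measurable g := hg.measurable
  unfold density
  fun_prop

theorem norm_avg_le_normAvg (g : ℝ → EuclideanSpace ℝ (Fin n)) (x w : ℝ) :
    ‖avg g x w‖ ≤ normAvg g x w :=
  intervalIntegral.norm_integral_le_integral_norm zero_le_one

theorem meanDefect_eq (g : ℝ → EuclideanSpace ℝ (Fin n)) (x w : ℝ) :
    meanDefect (fun θ => g (x + θ * w)) = normAvg g x w ^ 2 - ‖avg g x w‖ ^ 2 := rfl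

theorem abs_normAvg_sub_le {g₁ g₂ : ℝ → EuclideanSpace ℝ (Fin n)} {η : ℝ} (h₁ : Continuous g₁)
    (h₂ : Continuous g₂) (hη : ∀ x, ‖g₁ x - g₂ x‖ ≤ η) (x w : ℝ) :
    |normAvg g₁ x w - normAvg g₂ x w| ≤ η := by
  unfold normAvg
  rw [← intervalIntegral.integral_sub (Continuous.intervalIntegrable (by fun_prop) _ _)
    (Continuous.intervalIntegrable (by fun_prop) _ _)]
  have := intervalIntegral.norm_integral_le_of_norm_le_const (a := (0 : ℝ)) (b := 1) (C := η)
    (f := fun θ => ‖g₁ (x + θ * w)‖ - ‖g₂ (x + θ * w)‖)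
    fun θ _ => (abs_norm_sub_norm_le _ _).trans (hη _)
  simpa using this

theorem norm_avg_sub_le {g₁ g₂ : ℝ → EuclideanSpace ℝ (Fin n)} {η : ℝ} (h₁ : Continuous g₁)
    (h₂ : Continuous g₂) (hη : ∀ x, ‖g₁ x - g₂ x‖ ≤ η) (x w : ℝ) :
    ‖avg g₁ x w - avg g₂ x w‖ ≤ η := by
  unfold avg
  rw [← intervalIntegral.integral_sub (Continuous.intervalIntegrable (by fun_prop) _ _)
    (Continuous.intervalIntegrable (by fun_prop) _ _)]
  have := intervalIntegral.norm_integral_le_of_norm_le_const (a := (0 : ℝ)) (b := 1) (C := η)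
    (f := fun θ => g₁ (x + θ * w) - g₂ (x + θ * w)) fun θ _ => hη _
  simpa using this

theorem totalLength_eq (g : ℝ → EuclideanSpace ℝ (Fin n)) : totalLength g = normAvg g 0 1 := by
  simp [totalLength, normAvg]

namespace IsTame

/-- At w = 0 the mean is the value of `g` itself, so the bi-Lipschitz bound contains regularity. -/
theorem le_norm (hg : IsTame c M g) (x : ℝ) : c ≤ ‖g x‖ := by
  have := hg.le_norm_avg x 0 ⟨le_rfl, by norm_num⟩
  simpa [avg] using this

theorem norm_avg_le (hg : IsTame c M g) (x w : ℝ) : ‖avg g x w‖ ≤ M := by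
  have := intervalIntegral.norm_integral_le_of_norm_le_const (a := (0 : ℝ)) (b := 1) (C := M)
    (f := fun θ => g (x + θ * w)) fun θ _ => hg.norm_le _
  simpa [avg] using this

theorem integral_norm (hg : IsTame c M g) (x : ℝ) : ∫ t in x..x + 1, ‖g t‖ = totalLength g := by
  have hp : Function.Periodic (fun t => ‖g t‖) 1 := fun t => by simp only [hg.periodic t]
  have := hp.intervalIntegral_add_eq x 0
  rwa [zero_add] at this

theorem integral_eq_zero (hg : IsTame c M g) (x : ℝ) : ∫ t in x..x + 1, g t = 0 := by
  have := hg.periodic.intervalIntegral_add_eq x 0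
  rwa [zero_add, hg.closed] at this

theorem totalLength_sub (hg : IsTame c M g) (x w : ℝ) :
    totalLength g - w * normAvg g x w = ∫ t in x + w..x + 1, ‖g t‖ := by
  rw [← hg.integral_norm x, mul_normAvg]
  exact intervalIntegral.integral_interval_sub_left (hg.continuous.norm.intervalIntegrable _ _)
    (hg.continuous.norm.intervalIntegrable _ _)

/-- The complementary arc has parameter length at least 1/2. Its length stays away from zero, so it
never causes a singularity. -/
theorem half_le_totalLength_sub (hg : IsTame c M g) (hc : 0 < c) (x : ℝ) {w : ℝ}
    (hw : w ≤ 1 / 2) : c / 2 ≤ totalLength g - w * normAvg g x w := by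
  rw [hg.totalLength_sub]
  have h1 : ∫ t in x + w..x + 1, c ≤ ∫ t in x + w..x + 1, ‖g t‖ :=
    intervalIntegral.integral_mono_on (by linarith) (by simp)
      (hg.continuous.norm.intervalIntegrable _ _) fun t _ => hg.le_norm t
  rw [intervalIntegral.integral_const, smul_eq_mul] at h1
  nlinarith

/-- On a closed curve the complementary arc has the opposite displacement, so it is no shorter than
the chord either. -/
theorem chord_le (hg : IsTame c M g) (x : ℝ) {w : ℝ} (hw0 : 0 ≤ w) (hw : w ≤ 1 / 2) :
    w * ‖avg g x w‖ ≤ min (w * normAvg g x w) (totalLength g - w * normAvg g x w) := by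
  refine le_min (mul_le_mul_of_nonneg_left (norm_avg_le_normAvg _ _ _) hw0) ?_
  have h1 : w * ‖avg g x w‖ = ‖∫ t in x..x + w, g t‖ := by
    rw [← smul_avg, norm_smul, Real.norm_of_nonneg hw0]
  have h2 : ∫ t in x..x + w, g t = - ∫ t in x + w..x + 1, g t := by
    rw [eq_neg_iff_add_eq_zero, intervalIntegral.integral_add_adjacent_intervals
      (hg.continuous.intervalIntegrable _ _) (hg.continuous.intervalIntegrable _ _),
      hg.integral_eq_zero]
  rw [h1, h2, norm_neg, hg.totalLength_sub]
  exact intervalIntegral.norm_integral_le_integral_norm (by linarith)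

/-- A function applied to the minimum of two numbers is the sum of its values at both minus its
value at the maximum. This separates the singular comparison of chord and short arc from two terms
whose arguments are at least c/2. -/
theorem gap_eq (hg : IsTame c M g) (hc : 0 < c) {α : ℝ} (x : ℝ) {w : ℝ}
    (hw : w ∈ Ioc (0 : ℝ) (1 / 2)) :
    gap α g x w = w ^ (-α) * ((‖avg g x w‖ ^ 2) ^ (-(α / 2)) -
        (‖avg g x w‖ ^ 2 + meanDefect (fun θ => g (x + θ * w))) ^ (-(α / 2))) -
      ((totalLength g - w * normAvg g x w) ^ (-α) -
        (max (w * normAvg g x w) (totalLength g - w * normAvg g x w)) ^ (-α)) := by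
  have hw0 := hw.1
  have hm0 : 0 < ‖avg g x w‖ := hc.trans_le (hg.le_norm_avg x w ⟨hw0.le, hw.2⟩)
  have hl := hg.half_le_totalLength_sub hc x hw.2
  have hb0 : 0 < normAvg g x w := hm0.trans_le (norm_avg_le_normAvg g x w)
  rw [meanDefect_eq, add_sub_cancel, gap]
  set l := totalLength g - w * normAvg g x w
  set β := normAvg g x w
  set m := ‖avg g x w‖
  have hl0 : 0 < l := by linarith
  have e1 : ∀ y : ℝ, 0 < y → w ^ (-α) * (y ^ 2) ^ (-(α / 2)) = (w * y) ^ (-α) := by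
    intro y hy
    rw [Real.mul_rpow hw0.le hy.le, ← Real.rpow_natCast, ← Real.rpow_mul hy.le]
    congr 2
    push_cast
    ring
  rw [mul_sub, e1 m hm0, e1 β hb0, one_div, one_div, ← Real.rpow_neg (by positivity),
    ← Real.rpow_neg (by positivity)]
  rcases le_total (w * β) l with h | h
  · rw [min_eq_left h, max_eq_right h]; ring
  · rw [min_eq_right h, max_eq_left h]; ring

theorem gap_nonneg (hg : IsTame c M g) (hc : 0 < c) {α : ℝ} (hα : 0 < α) (x : ℝ) {w : ℝ}
    (hw : w ∈ Ioc (0 : ℝ) (1 / 2)) : 0 ≤ gap α g x w := by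
  have hw0 := hw.1
  have hm0 : 0 < ‖avg g x w‖ := hc.trans_le (hg.le_norm_avg x w ⟨hw0.le, hw.2⟩)
  have h := hg.chord_le x hw0.le hw.2
  rw [gap, sub_nonneg]
  gcongr

theorem mul_meanDefect_le (hg : IsTame c M g) (α x : ℝ) {w : ℝ} (hw : 0 < w) :
    w ^ (-α) * meanDefect (fun θ => g (x + θ * w)) ≤ 2 * sqOsc α g x w := by
  have hc := hg.continuous
  have h1 := meanDefect_le (u := fun θ => g (x + θ * w)) (by fun_prop) (g x)
  rw [sqOsc, abs_of_pos hw]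
  have : 0 ≤ w ^ (-α) := by positivity
  nlinarith

end IsTame

/-- The terms with the complementary arc have a favourable sign and are dropped. The remaining power
difference is linear in the mean defect, which carries the factor w^(-α). -/
theorem exists_gap_le {α : ℝ} (hα : 0 < α) (hc : 0 < c) : ∃ C : ℝ, 0 < C ∧
    ∀ {M : ℝ} {g : ℝ → EuclideanSpace ℝ (Fin n)}, IsTame c M g → ∀ x : ℝ,
      ∀ w ∈ Ioc (0 : ℝ) (1 / 2), gap α g x w ≤ C * sqOsc α g x w := by
  refine ⟨α / 2 * (c ^ 2) ^ (-(α / 2) - 1) * 2, by positivity, fun {M g} hg x w hw => ?_⟩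
  have hw0 := hw.1
  have hm := hg.le_norm_avg x w ⟨hw0.le, hw.2⟩
  have hl := hg.half_le_totalLength_sub hc x hw.2
  have hD := meanDefect_nonneg fun θ => g (x + θ * w)
  have hA : c ^ 2 ≤ ‖avg g x w‖ ^ 2 := by gcongr
  have h1 := (le_abs_self _).trans (abs_rpow_neg_sub_le (half_pos hα) (show 0 < c ^ 2 by positivity)
    hA (show c ^ 2 ≤ ‖avg g x w‖ ^ 2 + meanDefect (fun θ => g (x + θ * w)) by linarith))
  rw [abs_sub_comm, add_sub_cancel_left, abs_of_nonneg hD] at h1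
  have h2 : (max (w * normAvg g x w) (totalLength g - w * normAvg g x w)) ^ (-α) ≤
      (totalLength g - w * normAvg g x w) ^ (-α) :=
    Real.rpow_le_rpow_of_nonpos (by linarith) (le_max_right _ _) (by linarith)
  rw [hg.gap_eq hc x hw]
  have h3 := hg.mul_meanDefect_le α x hw0
  have hwα : 0 ≤ w ^ (-α) := by positivity
  have hC : 0 ≤ α / 2 * (c ^ 2) ^ (-(α / 2) - 1) := by positivity
  have h4 := mul_le_mul_of_nonneg_left h1 hwα
  have h5 := mul_le_mul_of_nonneg_left h3 hC
  nlinarith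

theorem exists_gap_lipschitz {α : ℝ} (hα : 0 < α) (hc : 0 < c) (hM : 0 < M) : ∃ C : ℝ, 0 < C ∧
    ∀ {g₁ g₂ : ℝ → EuclideanSpace ℝ (Fin n)}, IsTame c M g₁ → IsTame c M g₂ →
      ∀ {η : ℝ}, (∀ x, ‖g₁ x - g₂ x‖ ≤ η) → ∀ {t : ℝ}, 0 < t → ∀ x : ℝ,
      ∀ w ∈ Ioc (0 : ℝ) (1 / 2), |gap α g₁ x w - gap α g₂ x w| ≤
        C * ((t + η) * (sqOsc α g₁ x w + sqOsc α g₂ x w) + sqOsc α (g₁ - g₂) x w / t + η) := by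
  -- `C₁` and `C₂` are the constants of `abs_second_diff_rpow_neg_le` for b = α/2 and κ = c²; `C₃`
  -- is the Lipschitz constant of y^(-α) on [c/2, ∞).
  set C₁ : ℝ := α / 2 * (c ^ 2) ^ (-(α / 2) - 1) with hC₁
  set C₂ : ℝ := α / 2 * (α / 2 + 1) * (c ^ 2) ^ (-(α / 2) - 2) with hC₂
  set C₃ : ℝ := α * (c / 2) ^ (-α - 1) with hC₃
  have hC₁0 : 0 < C₁ := by positivity
  have hC₂0 : 0 < C₂ := by positivity
  have hC₃0 : 0 < C₃ := by positivity
  refine ⟨4 * C₁ + 8 * C₁ / c + 4 * C₂ * M + 4 * C₃, by positivity,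
    fun {g₁ g₂} hg₁ hg₂ {η} hη {t} ht x w hw => ?_⟩
  have hw0 := hw.1
  have hη0 : 0 ≤ η := (norm_nonneg _).trans (hη 0)
  have hm₁ := hg₁.le_norm_avg x w ⟨hw0.le, hw.2⟩
  have hm₂ := hg₂.le_norm_avg x w ⟨hw0.le, hw.2⟩
  have hl₁ := hg₁.half_le_totalLength_sub hc x hw.2
  have hl₂ := hg₂.half_le_totalLength_sub hc x hw.2
  have hD₁ := meanDefect_nonneg fun θ => g₁ (x + θ * w)
  have hD₂ := meanDefect_nonneg fun θ => g₂ (x + θ * w)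
  have hD₂S := hg₂.mul_meanDefect_le α x hw0
  have hA₁ : c ^ 2 ≤ ‖avg g₁ x w‖ ^ 2 := by gcongr
  have hA₂ : c ^ 2 ≤ ‖avg g₂ x w‖ ^ 2 := by gcongr
  have hAd : |‖avg g₁ x w‖ ^ 2 - ‖avg g₂ x w‖ ^ 2| ≤ 2 * M * η := by
    have e1 : ‖avg g₁ x w‖ ^ 2 - ‖avg g₂ x w‖ ^ 2 =
        (‖avg g₁ x w‖ + ‖avg g₂ x w‖) * (‖avg g₁ x w‖ - ‖avg g₂ x w‖) := by ring
    rw [e1, abs_mul, abs_of_nonneg (by positivity)]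
    have e2 := hg₁.norm_avg_le x w
    have e3 := hg₂.norm_avg_le x w
    have e4 := (abs_norm_sub_norm_le _ _).trans
      (norm_avg_sub_le hg₁.continuous hg₂.continuous hη x w)
    exact mul_le_mul (by linarith) e4 (abs_nonneg _) (by positivity)
  have hβd := abs_normAvg_sub_le hg₁.continuous hg₂.continuous hη x w
  have hLd : |totalLength g₁ - totalLength g₂| ≤ η := by
    rw [totalLength_eq, totalLength_eq]
    exact abs_normAvg_sub_le hg₁.continuous hg₂.continuous hη 0 1
  have had : |w * normAvg g₁ x w - w * normAvg g₂ x w| ≤ 2 * η := by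
    rw [← mul_sub, abs_mul, abs_of_pos hw0]
    nlinarith [hw.2, abs_nonneg (normAvg g₁ x w - normAvg g₂ x w)]
  have hld : |(totalLength g₁ - w * normAvg g₁ x w) - (totalLength g₂ - w * normAvg g₂ x w)| ≤
      2 * η := by
    have e1 : |w * normAvg g₁ x w - w * normAvg g₂ x w| ≤ η := by
      rw [← mul_sub, abs_mul, abs_of_pos hw0]
      nlinarith [hw.2, abs_nonneg (normAvg g₁ x w - normAvg g₂ x w)]
    rw [sub_sub_sub_comm]
    exact (abs_sub _ _).trans (by linarith)
  have hMd := abs_meanDefect_sub_le (u₁ := fun θ => g₁ (x + θ * w)) (u₂ := fun θ => g₂ (x + θ * w))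
    (hg₁.continuous.comp (by fun_prop)) (hg₂.continuous.comp (by fun_prop)) hc
    (fun θ _ => hg₁.le_norm _) (fun θ _ => hη _) ht (g₁ x) (g₂ x)
  rw [hg₁.gap_eq hc x hw, hg₂.gap_eq hc x hw]
  set A₁ := ‖avg g₁ x w‖ ^ 2
  set A₂ := ‖avg g₂ x w‖ ^ 2
  set D₁ := meanDefect fun θ => g₁ (x + θ * w)
  set D₂ := meanDefect fun θ => g₂ (x + θ * w)
  set l₁ := totalLength g₁ - w * normAvg g₁ x w
  set l₂ := totalLength g₂ - w * normAvg g₂ x w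
  set a₁ := w * normAvg g₁ x w
  set a₂ := w * normAvg g₂ x w
  have hwα : 0 ≤ w ^ (-α) := by positivity
  have hMd' : w ^ (-α) * |D₁ - D₂| ≤ 4 * ((t + 2 * η / c) * (sqOsc α g₁ x w + sqOsc α g₂ x w) +
      sqOsc α (g₁ - g₂) x w / t) := by
    refine (mul_le_mul_of_nonneg_left hMd hwα).trans (le_of_eq ?_)
    simp only [sqOsc, abs_of_pos hw0, Pi.sub_apply]
    ring
  have k1 := abs_second_diff_rpow_neg_le (half_pos hα) (show 0 < c ^ 2 by positivity) hA₁ hA₂ hD₁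
    hD₂
  rw [← hC₁, ← hC₂] at k1
  have k2 : |l₁ ^ (-α) - l₂ ^ (-α)| ≤ C₃ * (2 * η) :=
    (abs_rpow_neg_sub_le hα (half_pos hc) hl₁ hl₂).trans (by gcongr)
  have k3 : |(max a₁ l₁) ^ (-α) - (max a₂ l₂) ^ (-α)| ≤ C₃ * (2 * η) :=
    (abs_rpow_neg_sub_le hα (half_pos hc) (hl₁.trans (le_max_right _ _))
      (hl₂.trans (le_max_right _ _))).trans (by
        have := (abs_max_sub_max_le_max a₁ l₁ a₂ l₂).trans (max_le had hld)
        gcongr)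
  set S₁ := sqOsc α g₁ x w
  set S₂ := sqOsc α g₂ x w
  set S₀ := sqOsc α (g₁ - g₂) x w
  have hS₁ : 0 ≤ S₁ := sqOsc_nonneg _ _ _ _
  have hS₂ : 0 ≤ S₂ := sqOsc_nonneg _ _ _ _
  have hS₀ : 0 ≤ S₀ := sqOsc_nonneg _ _ _ _
  calc _ = |w ^ (-α) * ((A₁ ^ (-(α / 2)) - (A₁ + D₁) ^ (-(α / 2))) -
          (A₂ ^ (-(α / 2)) - (A₂ + D₂) ^ (-(α / 2)))) - (l₁ ^ (-α) - l₂ ^ (-α)) +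
          ((max a₁ l₁) ^ (-α) - (max a₂ l₂) ^ (-α))| := by congr 1; ring
    _ ≤ w ^ (-α) * (C₁ * |D₁ - D₂| + C₂ * D₂ * |A₁ - A₂|) + C₃ * (2 * η) + C₃ * (2 * η) := by
        refine (abs_add_le _ _).trans (add_le_add ((abs_sub _ _).trans (add_le_add ?_ k2)) k3)
        rw [abs_mul, abs_of_nonneg hwα]
        gcongr
    _ ≤ w ^ (-α) * (C₁ * |D₁ - D₂| + C₂ * D₂ * (2 * M * η)) + C₃ * (2 * η) + C₃ * (2 * η) := by
        gcongr
    _ = C₁ * (w ^ (-α) * |D₁ - D₂|) + C₂ * (2 * M * η) * (w ^ (-α) * D₂) + 4 * C₃ * η := by ring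
    _ ≤ C₁ * (4 * ((t + 2 * η / c) * (S₁ + S₂) + S₀ / t)) + C₂ * (2 * M * η) * (2 * S₂) +
        4 * C₃ * η := by gcongr
    _ = 4 * C₁ * (t * (S₁ + S₂)) + 8 * C₁ / c * (η * (S₁ + S₂)) + 4 * C₁ * (S₀ / t) +
        4 * C₂ * M * (η * S₂) + 4 * C₃ * η := by field_simp; ring
    _ ≤ _ := by
        have i0 : 0 ≤ t * (S₁ + S₂) := by positivity
        have i1 : 0 ≤ η * (S₁ + S₂) := by positivity
        have i2 : 0 ≤ S₀ / t := by positivity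
        have i3 : η * S₂ ≤ η * (S₁ + S₂) := by gcongr; linarith
        have c1 : 0 ≤ 8 * C₁ / c := by positivity
        have c2 : 0 ≤ 4 * C₂ * M := by positivity
        have i4 := mul_le_mul_of_nonneg_left i3 c2
        set a := 8 * C₁ / c
        set b := 4 * C₂ * M
        set T := t * (S₁ + S₂)
        set H := η * (S₁ + S₂)
        set Q := S₀ / t
        have e : (4 * C₁ + a + b + 4 * C₃) * ((t + η) * (S₁ + S₂) + Q + η) =
            4 * C₁ * T + a * H + 4 * C₁ * Q + b * H + 4 * C₃ * η +
            ((a + b + 4 * C₃) * T + (4 * C₁ + 4 * C₃) * H + (a + b + 4 * C₃) * Q +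
              (4 * C₁ + a + b) * η) := by
          simp only [T, H]; ring
        rw [e]
        have : 0 ≤ (a + b + 4 * C₃) * T + (4 * C₁ + 4 * C₃) * H + (a + b + 4 * C₃) * Q +
              (4 * C₁ + a + b) * η := by positivity
        linarith

theorem exists_density_le {α p : ℝ} (hα : 0 < α) (hp : 1 ≤ p) (hc : 0 < c) (hM : 0 < M) :
    ∃ C : ℝ, 0 < C ∧ ∀ {g : ℝ → EuclideanSpace ℝ (Fin n)}, IsTame c M g → ∀ x : ℝ,
      ∀ w ∈ Ioc (0 : ℝ) (1 / 2), 0 ≤ density α p g x w ∧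
        density α p g x w ≤ C * sqOsc α g x w ^ p := by
  obtain ⟨C, hC, h⟩ := exists_gap_le (n := n) hα hc
  refine ⟨C ^ p * M * M, by positivity, fun {g} hg x w hw => ?_⟩
  have h0 := hg.gap_nonneg hc hα x hw
  have h1 := h hg x w hw
  have hS : 0 ≤ sqOsc α g x w := sqOsc_nonneg _ _ _ _
  refine ⟨by unfold density; positivity, ?_⟩
  calc density α p g x w ≤ (C * sqOsc α g x w) ^ p * M * M := by
        unfold density
        gcongr
        · exact hg.norm_le _
        · exact hg.norm_le _
    _ = _ := by rw [Real.mul_rpow hC.le hS]; ring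

/-- The choice t = Kη in `exists_gap_lipschitz` gives the oscillation of g₁ - g₂, normalised by η²,
the coefficient η/K, and all other terms at most a multiple of Kη. This is the shape required by
`exists_hasStrictFDerivAt_integral`. -/
theorem exists_density_lipschitz {α p : ℝ} (hα : 0 < α) (hp : 1 ≤ p) (hc : 0 < c) (hM : 0 < M) :
    ∃ C : ℝ, 0 < C ∧
    ∀ {g₁ g₂ : ℝ → EuclideanSpace ℝ (Fin n)}, IsTame c M g₁ → IsTame c M g₂ →
      ∀ {η : ℝ}, 0 < η → (∀ x, ‖g₁ x - g₂ x‖ ≤ η) → ∀ {K : ℝ}, 1 ≤ K → ∀ x : ℝ,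
      ∀ w ∈ Ioc (0 : ℝ) (1 / 2), |density α p g₁ x w - density α p g₂ x w| ≤
        C * η * (K * (1 + sqOsc α g₁ x w ^ p + sqOsc α g₂ x w ^ p) +
          K⁻¹ * (sqOsc α (g₁ - g₂) x w / η ^ 2) ^ p) := by
  have hp0 : 0 < p := by linarith
  obtain ⟨B, hB, hgap⟩ := exists_gap_le (n := n) hα hc
  obtain ⟨C, hC, hlip⟩ := exists_gap_lipschitz (n := n) hα hc hM
  refine ⟨M * M * p * B ^ (p - 1) * C * (6 * 2 ^ p) + B ^ p * (2 * M), by positivity,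
    fun {g₁ g₂} hg₁ hg₂ {η} hη0 hη {K} hK x w hw => ?_⟩
  have hK0 : 0 < K := by linarith
  have f1 := hg₁.gap_nonneg hc hα x hw
  have f2 := hg₂.gap_nonneg hc hα x hw
  have F1 := hgap hg₁ x w hw
  have F2 := hgap hg₂ x w hw
  have hl := hlip hg₁ hg₂ hη (mul_pos hK0 hη0) x w hw
  have hS₁ : 0 ≤ sqOsc α g₁ x w := sqOsc_nonneg _ _ _ _
  have hS₂ : 0 ≤ sqOsc α g₂ x w := sqOsc_nonneg _ _ _ _
  have hS₀ : 0 ≤ sqOsc α (g₁ - g₂) x w := sqOsc_nonneg _ _ _ _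
  unfold density
  set F₁ := gap α g₁ x w
  set F₂ := gap α g₂ x w
  set S₁ := sqOsc α g₁ x w
  set S₂ := sqOsc α g₂ x w
  set S₀ := sqOsc α (g₁ - g₂) x w
  set m₁ := ‖g₁ x‖ * ‖g₁ (x + w)‖ with hm₁
  set m₂ := ‖g₂ x‖ * ‖g₂ (x + w)‖ with hm₂
  have hm₁M : m₁ ≤ M * M := mul_le_mul (hg₁.norm_le _) (hg₁.norm_le _) (norm_nonneg _) hM.le
  have hm₁0 : 0 ≤ m₁ := by positivity
  have hmd : |m₁ - m₂| ≤ 2 * M * η := by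
    have e1 : m₁ - m₂ = ‖g₁ x‖ * (‖g₁ (x + w)‖ - ‖g₂ (x + w)‖) +
        (‖g₁ x‖ - ‖g₂ x‖) * ‖g₂ (x + w)‖ := by rw [hm₁, hm₂]; ring
    have e2 : ‖g₁ x‖ * |‖g₁ (x + w)‖ - ‖g₂ (x + w)‖| ≤ M * η :=
      mul_le_mul (hg₁.norm_le _) ((abs_norm_sub_norm_le _ _).trans (hη _)) (abs_nonneg _) hM.le
    have e3 : |‖g₁ x‖ - ‖g₂ x‖| * ‖g₂ (x + w)‖ ≤ η * M :=
      mul_le_mul ((abs_norm_sub_norm_le _ _).trans (hη _)) (hg₂.norm_le _) (norm_nonneg _) hη0.le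
    rw [e1]
    refine (abs_add_le _ _).trans ?_
    rw [abs_mul, abs_mul, abs_of_nonneg (norm_nonneg (g₁ x)),
      abs_of_nonneg (norm_nonneg (g₂ (x + w)))]
    linarith
  set T := S₁ + S₂ with hT
  have hT0 : 0 ≤ T := by positivity
  have hF₁ : F₁ ≤ B * T := F1.trans (by gcongr; linarith)
  have hF₂ : F₂ ≤ B * T := F2.trans (by gcongr; linarith)
  have hpow := abs_rpow_sub_rpow_le hp f1 f2 hF₁ hF₂
  rw [Real.mul_rpow hB.le hT0] at hpow
  set Y := (S₀ / η ^ 2) ^ p with hY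
  have hY0 : 0 ≤ Y := by positivity
  have hTp : T ^ p ≤ 2 ^ p * (S₁ ^ p + S₂ ^ p) := add_rpow_le_two_rpow hp0.le hS₁ hS₂
  set R := 1 + S₁ ^ p + S₂ ^ p with hR
  have hS₁p : 0 ≤ S₁ ^ p := by positivity
  have hS₂p : 0 ≤ S₂ ^ p := by positivity
  have h2p : (1 : ℝ) ≤ 2 ^ p := Real.one_le_rpow (by norm_num) hp0.le
  have hTR : T ^ p ≤ 2 ^ p * R := hTp.trans (by gcongr; linarith)
  have q1 : T ^ (p - 1) * T ≤ 2 * (2 ^ p * R) := by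
    have := rpow_sub_one_mul_le hp hT0 hT0
    linarith
  have q2 : T ^ (p - 1) * 1 ≤ 2 ^ p * R := by
    have := rpow_sub_one_mul_le hp hT0 zero_le_one
    rw [Real.one_rpow] at this
    have h3 : 2 ^ p * (S₁ ^ p + S₂ ^ p) + 1 ≤ 2 ^ p * R := by rw [hR]; nlinarith
    linarith
  have q3 : T ^ (p - 1) * (S₀ / η ^ 2) ≤ 2 ^ p * R + Y := by
    have := rpow_sub_one_mul_le hp hT0 (show 0 ≤ S₀ / η ^ 2 by positivity)
    linarith
  have hR0 : 0 ≤ R := by positivity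
  have hKi : K⁻¹ ≤ 1 := inv_le_one_of_one_le₀ hK
  have hKi0 : 0 < K⁻¹ := inv_pos.2 hK0
  -- The constant 6 is 4 + 1 + 1, one summand for each of the three terms, measured in multiples of
  -- `2 ^ p * (K * R)`.
  have q4 : T ^ (p - 1) * ((K * η + η) * T + S₀ / (K * η) + η) ≤
      η * (6 * 2 ^ p * (K * R + K⁻¹ * Y)) := by
    have e1 : T ^ (p - 1) * ((K * η + η) * T + S₀ / (K * η) + η) =
        η * ((K + 1) * (T ^ (p - 1) * T) + K⁻¹ * (T ^ (p - 1) * (S₀ / η ^ 2)) +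
          T ^ (p - 1) * 1) := by
      field_simp
    rw [e1]
    refine mul_le_mul_of_nonneg_left ?_ hη0.le
    have i1 : (K + 1) * (T ^ (p - 1) * T) ≤ (2 * K) * (2 * (2 ^ p * R)) :=
      mul_le_mul (by linarith) q1 (by positivity) (by positivity)
    have i2 : K⁻¹ * (T ^ (p - 1) * (S₀ / η ^ 2)) ≤ K⁻¹ * (2 ^ p * R + Y) :=
      mul_le_mul_of_nonneg_left q3 hKi0.le
    have i3 : 0 ≤ 2 ^ p * R := by positivity
    have i4 : K⁻¹ * (2 ^ p * R) ≤ K * (2 ^ p * R) := by gcongr; linarith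
    have i5 : 2 ^ p * R ≤ K * (2 ^ p * R) := le_mul_of_one_le_left i3 hK
    have i6 : K⁻¹ * Y ≤ 6 * 2 ^ p * (K⁻¹ * Y) :=
      le_mul_of_one_le_left (by positivity) (by linarith)
    rw [mul_add (6 * 2 ^ p : ℝ)]
    linarith
  have hF : |F₁ ^ p - F₂ ^ p| ≤
      p * B ^ (p - 1) * C * (η * (6 * 2 ^ p * (K * R + K⁻¹ * Y))) := by
    calc _ ≤ p * (B ^ (p - 1) * T ^ (p - 1)) * |F₁ - F₂| := hpow
      _ ≤ p * (B ^ (p - 1) * T ^ (p - 1)) * (C * ((K * η + η) * T + S₀ / (K * η) + η)) := by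
        gcongr
      _ = p * B ^ (p - 1) * C * (T ^ (p - 1) * ((K * η + η) * T + S₀ / (K * η) + η)) := by ring
      _ ≤ _ := by gcongr
  have hF₂p : F₂ ^ p ≤ B ^ p * (K * R + K⁻¹ * Y) := by
    have i1 : F₂ ^ p ≤ (B * S₂) ^ p := by gcongr
    rw [Real.mul_rpow hB.le hS₂] at i1
    have i2 : S₂ ^ p ≤ R := by rw [hR]; linarith
    have i3 : R ≤ K * R := le_mul_of_one_le_left hR0 hK
    have i4 : 0 ≤ K⁻¹ * Y := by positivity
    refine i1.trans ?_
    gcongr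
    linarith
  have e : F₁ ^ p * ‖g₁ x‖ * ‖g₁ (x + w)‖ - F₂ ^ p * ‖g₂ x‖ * ‖g₂ (x + w)‖ =
      m₁ * (F₁ ^ p - F₂ ^ p) + F₂ ^ p * (m₁ - m₂) := by rw [hm₁, hm₂]; ring
  rw [e]
  refine (abs_add_le _ _).trans ?_
  rw [abs_mul m₁, abs_mul (F₂ ^ p), abs_of_nonneg hm₁0, abs_of_nonneg (Real.rpow_nonneg f2 p)]
  calc _ ≤ M * M * (p * B ^ (p - 1) * C * (η * (6 * 2 ^ p * (K * R + K⁻¹ * Y)))) +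
        B ^ p * (K * R + K⁻¹ * Y) * (2 * M * η) := by gcongr
    _ = _ := by ring


end Density

/-! ### Reduction of the square to arcs of parameter length at most 1/2 -/

section Symmetrization

theorem setLIntegral_Ioc_const_add (f : ℝ → ℝ≥0∞) (a b c : ℝ) :
    ∫⁻ y in Ioc a b, f (c + y) = ∫⁻ y in Ioc (c + a) (c + b), f y := by
  have h := (measurePreserving_add_left volume c).setLIntegral_comp_preimage_emb
    (MeasurableEquiv.addLeft c).measurableEmbedding f (Ioc (c + a) (c + b))
  rw [preimage_const_add_Ioc, add_sub_cancel_left, add_sub_cancel_left] at h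
  exact h

theorem setLIntegral_Ioc_const_sub (f : ℝ → ℝ≥0∞) (a b c : ℝ) :
    ∫⁻ y in Ioc a b, f (c - y) = ∫⁻ y in Ioc (c - b) (c - a), f y := by
  have h := (Measure.measurePreserving_sub_left volume c).setLIntegral_comp_preimage_emb
    (MeasurableEquiv.subLeft c).measurableEmbedding f (Ico (c - b) (c - a))
  -- The reflection exchanges `Ioc` and `Ico`, which differ by a null set.
  rw [preimage_const_sub_Ico, sub_sub_cancel, sub_sub_cancel,
    setLIntegral_congr Ico_ae_eq_Ioc] at h
  exact h

theorem setLIntegral_Ioc_add_one {f : ℝ → ℝ≥0∞} (hf : Function.Periodic f 1) (a : ℝ) :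
    ∫⁻ x in Ioc a (a + 1), f x = ∫⁻ x in Ioc (0 : ℝ) 1, f x := by
  have h : ∀ a : ℝ, ∫⁻ x in Ioc a (a + 1), f x = ∫⁻ b : UnitAddCircle, hf.lift b := fun a =>
    UnitAddCircle.lintegral_preimage a hf.lift
  rw [h a, ← h 0, zero_add]

/-- Each pair is seen as an arc starting at x. If the arc is longer than 1/2, its complement,
started at the other end, is short; by symmetry and periodicity these pairs contribute the same
amount. Invariance under a shift of one variable is required only within one period, as
`intrinsicDist` is meant only for such parameters. -/
theorem setLIntegral_square_eq {J : ℝ → ℝ → ℝ≥0∞} (hJ : Measurable (Function.uncurry J))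
    (hsymm : ∀ x y, J x y = J y x) (hper : ∀ x y, J (x + 1) (y + 1) = J x y)
    (hwrap : ∀ x y, y ≤ x → x ≤ y + 1 → J x (y + 1) = J x y) :
    ∫⁻ z in Ioc (0 : ℝ) 1 ×ˢ Ioc (0 : ℝ) 1, J z.1 z.2 =
      2 * ∫⁻ z in arcDomain, J z.1 (z.1 + z.2) := by
  have hJs : Measurable fun z : ℝ × ℝ => J z.1 (z.1 + z.2) :=
    hJ.comp (measurable_fst.prodMk (measurable_fst.add measurable_snd))
  have hJs' : Measurable fun z : ℝ × ℝ => J (z.1 + 1 - z.2) (z.1 + 1 - z.2 + z.2) :=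
    hJ.comp (by fun_prop : Measurable fun z : ℝ × ℝ => (z.1 + 1 - z.2, z.1 + 1 - z.2 + z.2))
  have h1 : ∫⁻ z in Ioc (0 : ℝ) 1 ×ˢ Ioc (0 : ℝ) 1, J z.1 z.2 =
      ∫⁻ x in Ioc (0 : ℝ) 1, ∫⁻ y in Ioc (0 : ℝ) 1, J x y := by
    rw [Measure.volume_eq_prod, ← Measure.prod_restrict, lintegral_prod _ (by exact hJ.aemeasurable)]
  have h2 : ∫⁻ z in arcDomain, J z.1 (z.1 + z.2) =
      ∫⁻ x in Ioc (0 : ℝ) 1, ∫⁻ w in Ioc (0 : ℝ) (1 / 2), J x (x + w) := by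
    rw [arcDomain, Measure.volume_eq_prod, ← Measure.prod_restrict,
      lintegral_prod _ hJs.aemeasurable]
  have h3 : ∀ x ∈ Ioc (0 : ℝ) 1, ∫⁻ y in Ioc (0 : ℝ) 1, J x y =
      (∫⁻ w in Ioc (0 : ℝ) (1 / 2), J x (x + w)) +
        ∫⁻ w in Ioc (0 : ℝ) (1 / 2), J (x + 1 - w) (x + 1 - w + w) := by
    intro x hx
    have e1 : ∫⁻ y in Ioc (0 : ℝ) x, J x y = ∫⁻ y in Ioc 1 (x + 1), J x y := by
      have := setLIntegral_Ioc_const_add (J x) 0 x 1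
      rw [add_zero, add_comm 1 x] at this
      rw [← this]
      refine setLIntegral_congr_fun measurableSet_Ioc fun y hy => ?_
      rw [add_comm 1 y, hwrap x y hy.2 (by linarith [hx.2, hy.1])]
    have e2 : ∫⁻ y in Ioc (0 : ℝ) 1, J x y = ∫⁻ y in Ioc x (x + 1), J x y := by
      rw [← Ioc_union_Ioc_eq_Ioc hx.1.le hx.2,
        lintegral_union measurableSet_Ioc (Ioc_disjoint_Ioc_of_le le_rfl), e1,
        ← Ioc_union_Ioc_eq_Ioc hx.2 (by linarith [hx.1] : (1 : ℝ) ≤ x + 1),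
        lintegral_union measurableSet_Ioc (Ioc_disjoint_Ioc_of_le le_rfl), add_comm]
    have e3 : ∫⁻ y in Ioc x (x + 1), J x y = ∫⁻ w in Ioc (0 : ℝ) 1, J x (x + w) := by
      have := setLIntegral_Ioc_const_add (J x) 0 1 x
      rw [this, add_zero]
    -- Here a long arc is exchanged for its complement through w ↦ 1 - w.
    have e4 : ∫⁻ w in Ioc (1 / 2 : ℝ) 1, J x (x + w) =
        ∫⁻ w in Ioc (0 : ℝ) (1 / 2), J (x + 1 - w) (x + 1 - w + w) := by
      have := setLIntegral_Ioc_const_sub (fun w => J x (x + w)) 0 (1 / 2) 1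
      rw [sub_zero, show (1 : ℝ) - 1 / 2 = 1 / 2 by norm_num] at this
      rw [← this]
      refine setLIntegral_congr_fun measurableSet_Ioc fun w hw => ?_
      rw [sub_add_cancel, hwrap (x + 1 - w) x (by linarith [hw.2]) (by linarith [hw.1]), hsymm,
        add_sub_assoc]
    rw [e2, e3, ← Ioc_union_Ioc_eq_Ioc (by norm_num : (0 : ℝ) ≤ 1 / 2) (by norm_num),
      lintegral_union measurableSet_Ioc (Ioc_disjoint_Ioc_of_le le_rfl), e4]
  have h4 : ∫⁻ x in Ioc (0 : ℝ) 1, ∫⁻ w in Ioc (0 : ℝ) (1 / 2), J (x + 1 - w) (x + 1 - w + w) =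
      ∫⁻ x in Ioc (0 : ℝ) 1, ∫⁻ w in Ioc (0 : ℝ) (1 / 2), J x (x + w) := by
    rw [lintegral_lintegral_swap (f := fun x w => J (x + 1 - w) (x + 1 - w + w))
        hJs'.aemeasurable,
      lintegral_lintegral_swap (f := fun x w => J x (x + w)) hJs.aemeasurable]
    congr 1
    funext w
    have hQ : Function.Periodic (fun u => J u (u + w)) 1 := fun u => by
      simp only
      rw [add_right_comm, hper]
    have := setLIntegral_Ioc_const_add (fun u => J u (u + w)) 0 1 (1 - w)
    rw [add_zero, setLIntegral_Ioc_add_one hQ] at this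
    rw [← this]
    congr 1
    funext x
    rw [show 1 - w + x = x + 1 - w by ring]
  rw [h1, h2, setLIntegral_congr_fun measurableSet_Ioc h3,
    lintegral_add_left (Measurable.lintegral_prod_right' (f := fun z : ℝ × ℝ => J z.1 (z.1 + z.2))
      hJs), h4, two_mul]

end Symmetrization

/-! ### The energy as an integral of the density -/

section EnergyFormula

variable {n : ℕ} {s ρ : ℝ} [Fact (1 ≤ ρ)]

theorem Slob.curve_sub (hs : 0 ≤ s) (hsρ : 1 < s * ρ) (γ : Slob s ρ n) (x w : ℝ) :
    γ.curve ((x + w : ℝ) : UnitAddCircle) - γ.curve (x : UnitAddCircle) = w • avg γ.vel x w := by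
  rw [smul_avg]
  exact (intervalIntegral.integral_eq_sub_of_hasDerivAt (fun t _ => γ.hasDerivAt hs hsρ t)
    ((γ.vel_spec hs hsρ).1.intervalIntegrable _ _)).symm

theorem Slob.integral_vel_eq_zero (hs : 0 ≤ s) (hsρ : 1 < s * ρ) (γ : Slob s ρ n) :
    ∫ t in (0 : ℝ)..1, γ.vel t = 0 := by
  have h1 := smul_avg γ.vel 0 1
  rw [← γ.curve_sub hs hsρ 0 1, zero_add, AddCircle.coe_period] at h1
  rw [← h1]
  simp

theorem Slob.oharaEnergy_eq (hs : 0 ≤ s) (hsρ : 1 < s * ρ) (α p : ℝ) (γ : Slob s ρ n) :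
    oharaEnergy α p γ.curve =
      2 * ∫⁻ z in arcDomain, ENNReal.ofReal (density α p γ.vel z.1 z.2) := by
  have hgc : Continuous γ.vel := (γ.vel_spec hs hsρ).1
  have hsp : speed γ.curve = fun t => ‖γ.vel t‖ := rfl
  have hspp : Function.Periodic (speed γ.curve) 1 := fun t => by
    simp only [hsp, γ.vel_periodic t]
  have hspc : Continuous (speed γ.curve) := hgc.norm
  have hi : ∀ a b, IntervalIntegrable (speed γ.curve) volume a b := fun a b =>
    hspc.intervalIntegrable a b
  have hL : ∀ x, ∫ t in x..x + 1, speed γ.curve t = ∫ t in (0 : ℝ)..1, speed γ.curve t := by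
    intro x
    have := hspp.intervalIntegral_add_eq x 0
    rwa [zero_add] at this
  have hcurve : Continuous fun t : ℝ => γ.curve (t : UnitAddCircle) :=
    γ.curve.continuous.comp (AddCircle.continuous_mk' 1)
  have hd_symm : ∀ x y, intrinsicDist γ.curve x y = intrinsicDist γ.curve y x := by
    intro x y
    unfold intrinsicDist
    rw [intervalIntegral.integral_symm, abs_neg]
  have hd_per : ∀ x y, intrinsicDist γ.curve (x + 1) (y + 1) = intrinsicDist γ.curve x y := by
    intro x y
    unfold intrinsicDist
    have h1 := intervalIntegral.integral_comp_add_right (a := x) (b := y) (speed γ.curve) 1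
    simp only [hspp _] at h1
    rw [h1]
  -- Shifting one parameter by a period exchanges the two arcs in the minimum.
  have hd_wrap : ∀ x y, y ≤ x → x ≤ y + 1 →
      intrinsicDist γ.curve x (y + 1) = intrinsicDist γ.curve x y := by
    intro x y hyx hxy
    unfold intrinsicDist
    have h1 := intervalIntegral.integral_add_adjacent_intervals (hi y x) (hi x (y + 1))
    rw [hL] at h1
    have h2 : 0 ≤ ∫ t in y..x, speed γ.curve t :=
      intervalIntegral.integral_nonneg hyx fun _ _ => norm_nonneg _
    have h3 : 0 ≤ ∫ t in x..y + 1, speed γ.curve t :=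
      intervalIntegral.integral_nonneg hxy fun _ _ => norm_nonneg _
    rw [intervalIntegral.integral_symm y x, abs_neg, abs_of_nonneg h2, abs_of_nonneg h3, ← h1,
      add_sub_cancel_right, add_sub_cancel_left, min_comm]
  have hone : ∀ t : ℝ, ((t + 1 : ℝ) : UnitAddCircle) = t := fun t => AddCircle.coe_add_period 1 t
  have hdm : Measurable fun z : ℝ × ℝ => intrinsicDist γ.curve z.1 z.2 := by
    have h0 : Continuous fun b : ℝ => ∫ t in (0 : ℝ)..b, speed γ.curve t :=
      intervalIntegral.continuous_primitive hi 0
    have h1 : Continuous fun z : ℝ × ℝ => ∫ t in z.1..z.2, speed γ.curve t := by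
      have : (fun z : ℝ × ℝ => ∫ t in z.1..z.2, speed γ.curve t) = fun z =>
          (∫ t in (0 : ℝ)..z.2, speed γ.curve t) - ∫ t in (0 : ℝ)..z.1, speed γ.curve t := by
        funext z
        rw [intervalIntegral.integral_interval_sub_left (hi _ _) (hi _ _)]
      rw [this]
      fun_prop
    unfold intrinsicDist
    exact (by fun_prop : Continuous fun z : ℝ × ℝ => min |∫ t in z.1..z.2, speed γ.curve t|
      ((∫ t in (0 : ℝ)..1, speed γ.curve t) - |∫ t in z.1..z.2, speed γ.curve t|)).measurable
  set J : ℝ → ℝ → ℝ≥0∞ := fun x y => ENNReal.ofReal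
    ((1 / ‖γ.curve (x : UnitAddCircle) - γ.curve (y : UnitAddCircle)‖ ^ α
        - 1 / intrinsicDist γ.curve x y ^ α) ^ p * speed γ.curve x * speed γ.curve y) with hJ
  have hJm : Measurable (Function.uncurry J) := by
    have h1 : Measurable fun z : ℝ × ℝ =>
        ‖γ.curve (z.1 : UnitAddCircle) - γ.curve (z.2 : UnitAddCircle)‖ :=
      ((hcurve.comp continuous_fst).sub (hcurve.comp continuous_snd)).norm.measurable
    have h2 : Measurable fun z : ℝ × ℝ => speed γ.curve z.1 :=
      (hspc.comp continuous_fst).measurable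
    have h3 : Measurable fun z : ℝ × ℝ => speed γ.curve z.2 :=
      (hspc.comp continuous_snd).measurable
    have h4 : Measurable fun z : ℝ × ℝ => (1 / ‖γ.curve (z.1 : UnitAddCircle) -
        γ.curve (z.2 : UnitAddCircle)‖ ^ α - 1 / intrinsicDist γ.curve z.1 z.2 ^ α) ^ p *
        speed γ.curve z.1 * speed γ.curve z.2 := by fun_prop
    exact h4.ennreal_ofReal
  have key := setLIntegral_square_eq hJm
    (fun x y => by simp only [hJ]; rw [norm_sub_rev, hd_symm]; congr 1; ring)
    (fun x y => by simp only [hJ]; rw [hd_per, hone, hone, hspp, hspp])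
    (fun x y h1 h2 => by simp only [hJ]; rw [hd_wrap x y h1 h2, hone, hspp])
  refine key.trans ?_
  congr 1
  refine setLIntegral_congr_fun measurableSet_arcDomain fun z hz => ?_
  have hw0 : 0 < z.2 := hz.2.1
  simp only [hJ]
  have hβ : ∫ t in z.1..z.1 + z.2, speed γ.curve t = z.2 * normAvg γ.vel z.1 z.2 :=
    (mul_normAvg γ.vel z.1 z.2).symm
  have hβ0 : 0 ≤ z.2 * normAvg γ.vel z.1 z.2 :=
    mul_nonneg hw0.le ((norm_nonneg _).trans (norm_avg_le_normAvg _ _ _))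
  have hdist : intrinsicDist γ.curve z.1 (z.1 + z.2) =
      min (z.2 * normAvg γ.vel z.1 z.2) (totalLength γ.vel - z.2 * normAvg γ.vel z.1 z.2) := by
    unfold intrinsicDist
    rw [hβ, abs_of_nonneg hβ0]
    rfl
  rw [hdist, norm_sub_rev, γ.curve_sub hs hsρ, norm_smul, Real.norm_of_nonneg hw0.le]
  rfl

end EnergyFormula

/-! ### Calculus of strict differentiability -/

section Pointwise

variable {X : Type*} [NormedAddCommGroup X] [NormedSpace ℝ X]

/-- The real function `f` has a strict derivative at `a`. -/
def StrictDiffAt (f : X → ℝ) (a : X) : Prop := ∃ D : X →L[ℝ] ℝ, HasStrictFDerivAt f D a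

namespace StrictDiffAt

variable {f g : X → ℝ} {a : X}

theorem of_contDiffAt (h : ContDiffAt ℝ 1 f a) : StrictDiffAt f a :=
  ⟨_, h.hasStrictFDerivAt one_ne_zero⟩

theorem const (c : ℝ) : StrictDiffAt (fun _ : X => c) a := ⟨0, hasStrictFDerivAt_const c a⟩

theorem sub (hf : StrictDiffAt f a) (hg : StrictDiffAt g a) :
    StrictDiffAt (fun x => f x - g x) a := by
  obtain ⟨D, hD⟩ := hf
  obtain ⟨D', hD'⟩ := hg
  exact ⟨_, hD.sub hD'⟩

theorem mul (hf : StrictDiffAt f a) (hg : StrictDiffAt g a) :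
    StrictDiffAt (fun x => f x * g x) a := by
  obtain ⟨D, hD⟩ := hf
  obtain ⟨D', hD'⟩ := hg
  exact ⟨_, hD.mul hD'⟩

theorem comp {φ : ℝ → ℝ} (hφ : ContDiffAt ℝ 1 φ (f a)) (hf : StrictDiffAt f a) :
    StrictDiffAt (fun x => φ (f x)) a := by
  obtain ⟨D, hD⟩ := hf
  exact ⟨_, (hφ.hasStrictFDerivAt one_ne_zero).comp a hD⟩

theorem norm {F : Type*} [NormedAddCommGroup F] [InnerProductSpace ℝ F] (L : X →L[ℝ] F)
    (h : L a ≠ 0) : StrictDiffAt (fun x => ‖L x‖) a :=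
  of_contDiffAt ((contDiffAt_norm ℝ h).comp a L.contDiff.contDiffAt)

theorem min (hf : StrictDiffAt f a) (hg : StrictDiffAt g a) (h : f a ≠ g a) :
    StrictDiffAt (fun x => Min.min (f x) (g x)) a := by
  obtain ⟨D, hD⟩ := hf
  obtain ⟨D', hD'⟩ := hg
  rcases lt_or_gt_of_ne h with h | h
  · refine ⟨D, hD.congr_of_eventuallyEq ?_⟩
    filter_upwards [hD.continuousAt.eventually_lt hD'.continuousAt h] with x hx
    exact (min_eq_left hx.le).symm
  · refine ⟨D', hD'.congr_of_eventuallyEq ?_⟩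
    filter_upwards [hD'.continuousAt.eventually_lt hD.continuousAt h] with x hx
    exact (min_eq_right hx.le).symm

theorem one_div_rpow {α : ℝ} (hf : StrictDiffAt f a) (h : 0 < f a) :
    StrictDiffAt (fun x => 1 / f x ^ α) a :=
  comp (φ := fun y => 1 / y ^ α) (contDiffAt_const.div
    (Real.contDiffAt_rpow_const_of_ne h.ne') (Real.rpow_pos_of_pos h _).ne') hf

theorem rpow {p : ℝ} (hf : StrictDiffAt f a) (hp : 1 ≤ p) : StrictDiffAt (fun x => f x ^ p) a :=
  comp (φ := fun y => y ^ p)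
    (Real.contDiff_rpow_const_of_le (n := 1) (by simpa using hp)).contDiffAt hf

end StrictDiffAt

end Pointwise

/-! ### Differentiability of the density, and openness of the injective regular curves -/

section CurveSpace

theorem one_le_embConst {s ρ : ℝ} (hρ : 1 ≤ ρ) (hsρ : 1 < s * ρ) : 1 ≤ embConst s ρ := by
  have h0 : 0 < ρ := by linarith
  have : 0 < s - 1 / ρ := by rw [sub_pos, div_lt_iff₀ h0]; exact hsρ
  have h1 := half_rpow_lt_one this
  have h2 : 0 < 1 - ((1 : ℝ) / 2) ^ (s - 1 / ρ) := by linarith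
  have h3 : 0 < 3 / (1 - ((1 : ℝ) / 2) ^ (s - 1 / ρ)) := by positivity
  unfold embConst
  linarith

variable {n : ℕ} {s ρ : ℝ} [Fact (1 ≤ ρ)]

theorem Slob.norm_vel_sub_le (hs : 0 ≤ s) (hsρ : 1 < s * ρ) (γ η : Slob s ρ n) (x : ℝ) :
    ‖γ.vel x - η.vel x‖ ≤ embConst s ρ * ‖γ - η‖ := by
  have := ((γ - η).vel_spec hs hsρ).2.1 x
  rwa [Slob.vel_sub hs hsρ] at this

/-- Evaluation of the derivative at a point. -/
noncomputable def Slob.velCLM (hs : 0 ≤ s) (hsρ : 1 < s * ρ) (x : ℝ) :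
    Slob s ρ n →L[ℝ] EuclideanSpace ℝ (Fin n) :=
  LinearMap.mkContinuous
    { toFun := fun γ => γ.vel x
      map_add' := fun γ η => by rw [Slob.vel_add hs hsρ]; rfl
      map_smul' := fun c γ => by rw [Slob.vel_smul hs hsρ]; rfl } (embConst s ρ)
    fun γ => (γ.vel_spec hs hsρ).2.1 x

/-- The mean of the derivative over an interval. -/
noncomputable def Slob.avgCLM (hs : 0 ≤ s) (hsρ : 1 < s * ρ) (x w : ℝ) :
    Slob s ρ n →L[ℝ] EuclideanSpace ℝ (Fin n) :=
  LinearMap.mkContinuous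
    { toFun := fun γ => avg γ.vel x w
      map_add' := fun γ η => by
        have h1 := (γ.vel_spec hs hsρ).1
        have h2 := (η.vel_spec hs hsρ).1
        rw [Slob.vel_add hs hsρ]
        exact intervalIntegral.integral_add (Continuous.intervalIntegrable (by fun_prop) _ _)
          (Continuous.intervalIntegrable (by fun_prop) _ _)
      map_smul' := fun c γ => by
        rw [Slob.vel_smul hs hsρ]
        exact intervalIntegral.integral_smul c fun θ => γ.vel (x + θ * w) } (embConst s ρ)
    fun γ => by
      have := intervalIntegral.norm_integral_le_of_norm_le_const (a := (0 : ℝ)) (b := 1)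
        (f := fun θ => γ.vel (x + θ * w)) fun θ _ => (γ.vel_spec hs hsρ).2.1 (x + θ * w)
      simpa [avg] using this

theorem Slob.strictDiffAt_normAvg (hs : 0 ≤ s) (hsρ : 1 < s * ρ) {γ₀ : Slob s ρ n}
    (h : ∀ x, γ₀.vel x ≠ 0) (x w : ℝ) :
    StrictDiffAt (fun γ : Slob s ρ n => normAvg γ.vel x w) γ₀ := by
  have hρ : (1 : ℝ) ≤ ρ := Fact.out
  have hE := embConst_nonneg hρ hsρ
  have hc : ∀ γ : Slob s ρ n, Continuous fun θ => ‖γ.vel (x + θ * w)‖ := fun γ => by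
    have := (γ.vel_spec hs hsρ).1
    fun_prop
  -- The integrand is Lipschitz in γ uniformly in θ, so the weights can be taken to be zero.
  obtain ⟨D, hD⟩ := exists_hasStrictFDerivAt_integral (μ := volume.restrict (Ioc (0 : ℝ) 1))
    (γ₀ := γ₀) (U := univ) univ_mem (e := fun γ θ => ‖γ.vel (x + θ * w)‖) (P := fun _ _ => 0)
    (C := embConst s ρ) (q := 1) hE one_pos
    (fun γ _ => ((hc γ).integrableOn_Icc).mono_set Ioc_subset_Icc_self)
    (fun _ _ => le_rfl) (fun _ => integrable_zero _ _ _) (fun γ => by simp; positivity)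
    (by simp) (by simp)
    (fun γ₁ _ γ₂ _ K hK => Eventually.of_forall fun θ => by
      refine (abs_norm_sub_norm_le _ _).trans ((Slob.norm_vel_sub_le hs hsρ γ₁ γ₂ _).trans ?_)
      simp only [add_zero, mul_one, mul_zero]
      exact le_mul_of_one_le_right (by positivity) hK)
    (Eventually.of_forall fun θ => StrictDiffAt.norm (Slob.velCLM hs hsρ (x + θ * w)) (h _))
  refine ⟨D, ?_⟩
  simp only [normAvg, intervalIntegral.integral_of_le zero_le_one]
  exact hD

theorem Slob.strictDiffAt_density (hs : 0 ≤ s) (hsρ : 1 < s * ρ) {α p c M : ℝ} (hp : 1 ≤ p)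
    (hc : 0 < c) {γ₀ : Slob s ρ n} (h : IsTame c M γ₀.vel) {x w : ℝ}
    (hw : w ∈ Ioc (0 : ℝ) (1 / 2))
    (hne : w * normAvg γ₀.vel x w ≠ totalLength γ₀.vel - w * normAvg γ₀.vel x w) :
    StrictDiffAt (fun γ : Slob s ρ n => density α p γ.vel x w) γ₀ := by
  have hw0 := hw.1
  have hv : ∀ x, γ₀.vel x ≠ 0 := fun x => norm_pos_iff.1 (hc.trans_le (h.le_norm x))
  have hm0 : 0 < ‖avg γ₀.vel x w‖ := hc.trans_le (h.le_norm_avg x w ⟨hw0.le, hw.2⟩)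
  have h1 : StrictDiffAt (fun γ : Slob s ρ n => ‖avg γ.vel x w‖) γ₀ :=
    StrictDiffAt.norm (Slob.avgCLM hs hsρ x w) (norm_pos_iff.1 hm0)
  have h2 : ∀ x, StrictDiffAt (fun γ : Slob s ρ n => ‖γ.vel x‖) γ₀ := fun x =>
    StrictDiffAt.norm (Slob.velCLM hs hsρ x) (hv x)
  have h3 := (StrictDiffAt.const w).mul (Slob.strictDiffAt_normAvg hs hsρ hv x w)
  have h4 : StrictDiffAt (fun γ : Slob s ρ n => totalLength γ.vel) γ₀ := by
    simp only [totalLength_eq]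
    exact Slob.strictDiffAt_normAvg hs hsρ hv 0 1
  have h5 := h3.min (h4.sub h3) hne
  have hchord : 0 < w * ‖avg γ₀.vel x w‖ := mul_pos hw0 hm0
  have h6 := (((StrictDiffAt.const w).mul h1).one_div_rpow (α := α) hchord).sub
    (h5.one_div_rpow (α := α) (hchord.trans_le (h.chord_le x hw0.le hw.2)))
  exact ((h6.rpow hp).mul (h2 x)).mul (h2 (x + w))

/-- For a fixed starting point the arc length is strictly increasing in `w`, so at most one `w`
makes the two arcs equally long; Fubini gives a null set of pairs. -/
theorem IsTame.ae_ne {c M : ℝ} {g : ℝ → EuclideanSpace ℝ (Fin n)} (hg : IsTame c M g)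
    (hc : 0 < c) : ∀ᵐ z : ℝ × ℝ ∂volume.restrict arcDomain,
      z.2 * normAvg g z.1 z.2 ≠ totalLength g - z.2 * normAvg g z.1 z.2 := by
  have hcont : Continuous fun z : ℝ × ℝ => z.2 * normAvg g z.1 z.2 :=
    continuous_snd.mul (continuous_normAvg hg.continuous)
  have hm : MeasurableSet {z : ℝ × ℝ |
      z.2 * normAvg g z.1 z.2 ≠ totalLength g - z.2 * normAvg g z.1 z.2} :=
    (isClosed_eq hcont (continuous_const.sub hcont)).measurableSet.compl
  rw [arcDomain, Measure.volume_eq_prod, ← Measure.prod_restrict, Measure.ae_prod_iff_ae_ae hm]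
  refine Eventually.of_forall fun x => ae_restrict_of_ae ?_
  have hmono : StrictMono fun w : ℝ => w * normAvg g x w := by
    intro a b hab
    simp only [mul_normAvg]
    have hi : ∀ a b, IntervalIntegrable (fun t => ‖g t‖) volume a b := fun a b =>
      hg.continuous.norm.intervalIntegrable a b
    rw [← intervalIntegral.integral_add_adjacent_intervals (hi x (x + a)) (hi (x + a) (x + b)),
      lt_add_iff_pos_right]
    exact intervalIntegral.intervalIntegral_pos_of_pos (hi _ _)
      (fun t => hc.trans_le (hg.le_norm t)) (by linarith)
  have hsub : {w : ℝ | w * normAvg g x w = totalLength g - w * normAvg g x w}.Subsingleton := by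
    intro a ha b hb
    have ha' : a * normAvg g x a = totalLength g - a * normAvg g x a := ha
    have hb' : b * normAvg g x b = totalLength g - b * normAvg g x b := hb
    exact hmono.injective (show a * normAvg g x a = b * normAvg g x b by linarith)
  have := hsub.countable.ae_notMem volume
  exact this

theorem Slob.mem_injReg_of_isTame (hs : 0 ≤ s) (hsρ : 1 < s * ρ) {c M : ℝ} (hc : 0 < c)
    {γ : Slob s ρ n} (h : IsTame c M γ.vel) : γ ∈ injReg s ρ n := by
  have hne : ∀ x w : ℝ, 0 < w → w ≤ 1 / 2 →
      γ.curve ((x + w : ℝ) : UnitAddCircle) ≠ γ.curve (x : UnitAddCircle) := by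
    intro x w hw0 hw heq
    have h1 := γ.curve_sub hs hsρ x w
    rw [heq, sub_self] at h1
    have h2 := hc.trans_le (h.le_norm_avg x w ⟨hw0.le, hw⟩)
    rcases smul_eq_zero.1 h1.symm with h3 | h3
    · exact hw0.ne' h3
    · rw [h3, norm_zero] at h2; exact lt_irrefl _ h2
  refine ⟨fun a b hab => ?_, fun t => norm_pos_iff.1 (hc.trans_le (h.le_norm t))⟩
  obtain ⟨x, rfl⟩ := QuotientAddGroup.mk_surjective a
  -- The increment is represented in (-1/2, 1/2]; if it is negative, the two points exchange their
  -- roles.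
  obtain ⟨w, hw, hwe⟩ : ∃ w ∈ Ioc (-(1 / 2) : ℝ) (-(1 / 2) + 1),
      (w : UnitAddCircle) = b - (x : UnitAddCircle) := by
    have := AddCircle.coe_image_Ioc_eq (1 : ℝ) (-(1 / 2))
    have h2 : b - (x : UnitAddCircle) ∈ (univ : Set UnitAddCircle) := mem_univ _
    rw [← this] at h2
    exact h2
  have hb : b = ((x + w : ℝ) : UnitAddCircle) := by
    rw [AddCircle.coe_add, hwe]; abel
  rw [hb] at hab ⊢
  rcases lt_trichotomy w 0 with h0 | h0 | h0
  · exfalso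
    have := hne (x + w) (-w) (by linarith) (by linarith [hw.1])
    rw [add_neg_cancel_right] at this
    exact this hab
  · rw [h0, add_zero]
  · exfalso
    exact hne x w h0 (by linarith [hw.2]) hab.symm

/-- The mean of γ' is continuous up to w = 0, where it equals γ'(x). It is non-zero there by
regularity and for 0 < w ≤ 1/2 by injectivity, so its norm attains a positive minimum on a compact
rectangle; periodicity in x does the rest. -/
theorem Slob.isTame_of_mem_injReg (hs : 0 ≤ s) (hsρ : 1 < s * ρ) {γ : Slob s ρ n}
    (h : γ ∈ injReg s ρ n) : ∃ c M : ℝ, 0 < c ∧ 0 < M ∧ IsTame c M γ.vel := by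
  have hρ : (1 : ℝ) ≤ ρ := Fact.out
  obtain ⟨hgc, hgb, -⟩ := γ.vel_spec hs hsρ
  have hper : ∀ w, Function.Periodic (fun x => avg γ.vel x w) 1 := by
    intro w x
    simp only [avg]
    congr 1
    funext θ
    rw [add_right_comm, γ.vel_periodic]
  have hpos : ∀ x, ∀ w ∈ Icc (0 : ℝ) (1 / 2), avg γ.vel x w ≠ 0 := by
    intro x w hw h0
    rcases hw.1.eq_or_lt with h1 | h1
    · rw [← h1] at h0
      refine h.2 x ?_
      have h2 : γ.vel x = 0 := by simpa [avg] using h0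
      exact h2
    · have h2 := γ.curve_sub hs hsρ x w
      rw [h0, smul_zero, sub_eq_zero] at h2
      have h3 := h.1 h2
      rw [AddCircle.coe_add, add_eq_left] at h3
      have h4 := (AddCircle.norm_coe_eq_abs_iff (x := w) 1 one_ne_zero).2 (by
        rw [abs_of_pos h1, abs_one]; exact hw.2)
      rw [h3, norm_zero, abs_of_pos h1] at h4
      linarith
  obtain ⟨z₀, hz₀, hmin⟩ := (isCompact_Icc.prod isCompact_Icc).exists_isMinOn
    (s := Icc (0 : ℝ) 1 ×ˢ Icc (0 : ℝ) (1 / 2))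
    ⟨(0, 0), ⟨by norm_num, by norm_num⟩, ⟨by norm_num, by norm_num⟩⟩
    ((continuous_avg hgc).norm.continuousOn)
  refine ⟨‖avg γ.vel z₀.1 z₀.2‖, embConst s ρ * ‖γ‖ + 1,
    norm_pos_iff.2 (hpos _ _ hz₀.2), ?_, ?_⟩
  · have := embConst_nonneg hρ hsρ
    positivity
  · refine ⟨hgc, γ.vel_periodic, γ.integral_vel_eq_zero hs hsρ,
      fun x => (hgb x).trans (by linarith), fun x w hw => ?_⟩
    obtain ⟨y, hy, hxy⟩ := (hper w).exists_mem_Ico₀ one_pos x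
    have hxy' : avg γ.vel x w = avg γ.vel y w := hxy
    rw [hxy']
    exact isMinOn_iff.1 hmin (y, w) ⟨Ico_subset_Icc_self hy, hw⟩

theorem Slob.eventually_isTame (hs : 0 ≤ s) (hsρ : 1 < s * ρ) {c M : ℝ} (hc : 0 < c)
    {γ₀ : Slob s ρ n} (h : IsTame c M γ₀.vel) :
    ∀ᶠ γ in 𝓝 γ₀, IsTame (c / 2) (M + 1) γ.vel := by
  have hlim : Tendsto (fun γ => embConst s ρ * ‖γ - γ₀‖) (𝓝 γ₀) (𝓝 0) := by
    have : Continuous fun γ => embConst s ρ * ‖γ - γ₀‖ := by fun_prop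
    simpa using this.tendsto γ₀
  filter_upwards [hlim.eventually_lt_const (half_pos hc), hlim.eventually_lt_const one_pos]
    with γ h1 h2
  have hgc := (γ.vel_spec hs hsρ).1
  have hd := Slob.norm_vel_sub_le hs hsρ γ γ₀
  refine ⟨hgc, γ.vel_periodic, γ.integral_vel_eq_zero hs hsρ, fun x => ?_, fun x w hw => ?_⟩
  · have e1 := norm_le_norm_add_norm_sub' (γ.vel x) (γ₀.vel x)
    linarith [h.norm_le x, hd x]
  · have e1 := norm_avg_sub_le hgc h.continuous hd x w
    have e3 := h.le_norm_avg x w hw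
    rw [norm_sub_rev] at e1
    have e4 : ‖avg γ₀.vel x w‖ ≤ ‖avg γ.vel x w‖ + ‖avg γ₀.vel x w - avg γ.vel x w‖ :=
      norm_le_norm_add_norm_sub' _ _
    linarith

theorem Slob.isOpen_injReg (hs : 0 ≤ s) (hsρ : 1 < s * ρ) : IsOpen (injReg s ρ n) := by
  rw [isOpen_iff_mem_nhds]
  intro γ hγ
  obtain ⟨c, M, hc, -, h⟩ := Slob.isTame_of_mem_injReg hs hsρ hγ
  filter_upwards [Slob.eventually_isTame hs hsρ hc h] with η hη
  exact Slob.mem_injReg_of_isTame hs hsρ (half_pos hc) hη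

end CurveSpace

/-! ### Finiteness and strict differentiability of the energy -/

section Energy

theorem density_nonneg_ae {n : ℕ} {α p : ℝ} (hα : 0 < α) {c M : ℝ} (hc : 0 < c)
    {g : ℝ → EuclideanSpace ℝ (Fin n)} (h : IsTame c M g) :
    ∀ᵐ z : ℝ × ℝ ∂volume.restrict arcDomain, 0 ≤ density α p g z.1 z.2 := by
  filter_upwards [ae_restrict_mem measurableSet_arcDomain] with z hz
  have := h.gap_nonneg hc hα z.1 hz.2
  unfold density
  positivity

variable {n : ℕ} {α p : ℝ} [Fact (1 ≤ p)]

theorem integrable_density (hα : 0 < α) (h2 : 2 < α * p) {c M : ℝ} (hc : 0 < c) (hM : 0 < M)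
    {γ : EnergySpace α p n} (h : IsTame c M γ.vel) :
    Integrable (fun z : ℝ × ℝ => density α p γ.vel z.1 z.2) (volume.restrict arcDomain) := by
  have hp : (1 : ℝ) ≤ p := Fact.out
  obtain ⟨C, hC, hle⟩ := exists_density_le (n := n) hα hp hc hM
  refine ((integrable_weight h2 γ).const_mul C).mono'
    (measurable_density α p h.continuous).aestronglyMeasurable ?_
  filter_upwards [ae_restrict_mem measurableSet_arcDomain] with z hz
  obtain ⟨h0, h1⟩ := hle h z.1 z.2 hz.2
  rw [Real.norm_of_nonneg h0]
  exact h1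

theorem oharaEnergy_lt_top (hα : 0 < α) (h2 : 2 < α * p) {γ : EnergySpace α p n}
    (hγ : γ ∈ injReg ((α * p - 1) / (2 * p)) (2 * p) n) : oharaEnergy α p γ.curve < ⊤ := by
  obtain ⟨e1, e2, -⟩ := exponent_facts (p := p) h2
  obtain ⟨c, M, hc, hM, h⟩ := Slob.isTame_of_mem_injReg e1 e2 hγ
  rw [γ.oharaEnergy_eq e1 e2]
  refine ENNReal.mul_lt_top (by simp) ?_
  rw [← hasFiniteIntegral_iff_ofReal (density_nonneg_ae hα hc h)]
  exact (integrable_density hα h2 hc hM h).2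

theorem toReal_oharaEnergy (hα : 0 < α) (h2 : 2 < α * p) {c M : ℝ} (hc : 0 < c)
    {γ : EnergySpace α p n} (h : IsTame c M γ.vel) :
    (oharaEnergy α p γ.curve).toReal = 2 * ∫ z in arcDomain, density α p γ.vel z.1 z.2 := by
  obtain ⟨e1, e2, -⟩ := exponent_facts (p := p) h2
  rw [γ.oharaEnergy_eq e1 e2, ENNReal.toReal_mul,
    integral_eq_lintegral_of_nonneg_ae (density_nonneg_ae hα hc h)
      (measurable_density α p h.continuous).aestronglyMeasurable]
  simp

theorem weight_add_le (h2 : 2 < α * p) (γ η : EnergySpace α p n) (z : ℝ × ℝ) :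
    sqOsc α (γ + η).vel z.1 z.2 ^ p ≤
      4 ^ p * (sqOsc α γ.vel z.1 z.2 ^ p + sqOsc α η.vel z.1 z.2 ^ p) := by
  have hp : (1 : ℝ) ≤ p := Fact.out
  obtain ⟨e1, e2, -⟩ := exponent_facts (p := p) h2
  have h0 := sqOsc_nonneg α (γ + η).vel z.1 z.2
  have hγ := sqOsc_nonneg α γ.vel z.1 z.2
  have hη := sqOsc_nonneg α η.vel z.1 z.2
  have h1 := sqOsc_add_le α (γ.vel_spec e1 e2).1 (η.vel_spec e1 e2).1 z.1 z.2
  rw [← Slob.vel_add e1 e2] at h1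
  calc _ ≤ (2 * (sqOsc α γ.vel z.1 z.2 + sqOsc α η.vel z.1 z.2)) ^ p := by gcongr
    _ = 2 ^ p * (sqOsc α γ.vel z.1 z.2 + sqOsc α η.vel z.1 z.2) ^ p :=
        Real.mul_rpow (by norm_num) (by positivity)
    _ ≤ 2 ^ p * (2 ^ p * (sqOsc α γ.vel z.1 z.2 ^ p + sqOsc α η.vel z.1 z.2 ^ p)) := by
        gcongr
        exact add_rpow_le_two_rpow (by linarith) hγ hη
    _ = _ := by
        rw [← mul_assoc, ← Real.mul_rpow (by norm_num) (by norm_num)]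
        norm_num

theorem weight_smul (h2 : 2 < α * p) (t : ℝ) (γ : EnergySpace α p n) (z : ℝ × ℝ) :
    sqOsc α (t • γ).vel z.1 z.2 ^ p = |t| ^ (2 * p) * sqOsc α γ.vel z.1 z.2 ^ p := by
  obtain ⟨e1, e2, -⟩ := exponent_facts (p := p) h2
  rw [Slob.vel_smul e1 e2, sqOsc_smul, Real.mul_rpow (sq_nonneg _) (sqOsc_nonneg _ _ _ _),
    Real.rpow_mul (abs_nonneg _), Real.rpow_two, sq_abs]

theorem strictDiffAt_oharaEnergy (hα : 0 < α) (h2 : 2 < α * p) {γ₀ : EnergySpace α p n}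
    (hγ₀ : γ₀ ∈ injReg ((α * p - 1) / (2 * p)) (2 * p) n) :
    StrictDiffAt (fun η : EnergySpace α p n => (oharaEnergy α p η.curve).toReal) γ₀ := by
  have hp : (1 : ℝ) ≤ p := Fact.out
  have hp0 : 0 < p := by linarith
  obtain ⟨e1, e2, -⟩ := exponent_facts (p := p) h2
  obtain ⟨c, M, hc, hM, h₀⟩ := Slob.isTame_of_mem_injReg e1 e2 hγ₀
  have hev := Slob.eventually_isTame e1 e2 hc h₀
  have hc2 := half_pos hc
  have hM1 : 0 < M + 1 := by linarith
  obtain ⟨B, hB, hlip⟩ := exists_density_lipschitz (n := n) hα hp hc2 hM1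
  set C₀ : ℝ := embConst ((α * p - 1) / (2 * p)) (2 * p) with hC₀
  have hC₀1 : 1 ≤ C₀ := one_le_embConst (by linarith) e2
  -- `B * C₀` serves the Lipschitz bound, where `C₀` converts the norm of the space into the uniform
  -- norm of derivatives; `4 ^ p` serves the quasi-triangle inequality of the weight.
  set C : ℝ := max (B * C₀) (4 ^ p) with hC
  have hC4 : (4 : ℝ) ^ p ≤ C := le_max_right _ _
  have h4 : (1 : ℝ) ≤ 4 ^ p := Real.one_le_rpow (by norm_num) hp0.le
  have hC1 : 1 ≤ C := h4.trans hC4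
  have main : ∃ D : EnergySpace α p n →L[ℝ] ℝ, HasStrictFDerivAt
      (fun γ : EnergySpace α p n => ∫ z in arcDomain, density α p γ.vel z.1 z.2) D γ₀ := by
    refine exists_hasStrictFDerivAt_integral (X := EnergySpace α p n) (Ω := ℝ × ℝ)
      (μ := volume.restrict arcDomain) (γ₀ := γ₀)
      (U := {γ : EnergySpace α p n | IsTame (c / 2) (M + 1) γ.vel})
      (e := fun (γ : EnergySpace α p n) (z : ℝ × ℝ) => density α p γ.vel z.1 z.2)
      (P := fun (γ : EnergySpace α p n) (z : ℝ × ℝ) => sqOsc α γ.vel z.1 z.2 ^ p)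
      (C := C) (q := 2 * p) hev (by linarith) (by linarith) ?_ ?_ ?_ ?_ ?_ ?_ ?_ ?_
    · exact fun γ hγ => integrable_density hα h2 hc2 hM1 hγ
    · exact fun γ z => Real.rpow_nonneg (sqOsc_nonneg _ _ _ _) _
    · exact fun γ => integrable_weight h2 γ
    · intro γ
      exact (integral_weight_le h2 γ).trans (le_mul_of_one_le_left (by positivity) hC1)
    · exact fun t γ z => weight_smul h2 t γ z
    · intro γ η z
      refine (weight_add_le h2 γ η z).trans ?_
      have i1 : 0 ≤ sqOsc α γ.vel z.1 z.2 ^ p := Real.rpow_nonneg (sqOsc_nonneg _ _ _ _) _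
      have i2 : 0 ≤ sqOsc α η.vel z.1 z.2 ^ p := Real.rpow_nonneg (sqOsc_nonneg _ _ _ _) _
      gcongr
    · intro γ₁ hγ₁ γ₂ hγ₂ K hK
      filter_upwards [ae_restrict_mem measurableSet_arcDomain] with z hz
      rcases eq_or_ne γ₁ γ₂ with rfl | hne
      · simp
      have hn : 0 < ‖γ₁ - γ₂‖ := norm_pos_iff.2 (sub_ne_zero.2 hne)
      have hη : 0 < C₀ * ‖γ₁ - γ₂‖ := by positivity
      have hl := hlip hγ₁ hγ₂ hη (Slob.norm_vel_sub_le e1 e2 γ₁ γ₂) hK z.1 z.2 hz.2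
      rw [← Slob.vel_sub e1 e2] at hl
      refine hl.trans ?_
      have i0 : 0 ≤ sqOsc α (γ₁ - γ₂).vel z.1 z.2 := sqOsc_nonneg _ _ _ _
      have i1 : 0 ≤ sqOsc α γ₁.vel z.1 z.2 ^ p := Real.rpow_nonneg (sqOsc_nonneg _ _ _ _) _
      have i2 : 0 ≤ sqOsc α γ₂.vel z.1 z.2 ^ p := Real.rpow_nonneg (sqOsc_nonneg _ _ _ _) _
      -- The weight is quadratic before the power p is taken, so dividing by the square of the norm
      -- amounts to normalising the increment; C₀ ≥ 1 only helps.
      have i3 : (sqOsc α (γ₁ - γ₂).vel z.1 z.2 / (C₀ * ‖γ₁ - γ₂‖) ^ 2) ^ p ≤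
          sqOsc α (‖γ₁ - γ₂‖⁻¹ • (γ₁ - γ₂)).vel z.1 z.2 ^ p := by
        rw [Slob.vel_smul e1 e2, sqOsc_smul]
        refine Real.rpow_le_rpow (by positivity) ?_ hp0.le
        rw [inv_pow, inv_mul_eq_div]
        refine div_le_div_of_nonneg_left i0 (by positivity) ?_
        gcongr
        exact le_mul_of_one_le_left hn.le hC₀1
      have i4 : B * (C₀ * ‖γ₁ - γ₂‖) ≤ C * ‖γ₁ - γ₂‖ := by
        rw [← mul_assoc]
        gcongr
        exact le_max_left _ _
      have hK0 : 0 < K := by linarith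
      gcongr
    · filter_upwards [ae_restrict_mem measurableSet_arcDomain, h₀.ae_ne hc] with z hz hne
      exact Slob.strictDiffAt_density e1 e2 hp hc h₀ hz.2 hne
  obtain ⟨D, hD⟩ := main
  -- The energy is twice the integral for tame curves, hence throughout a neighbourhood of `γ₀`,
  -- which suffices for a strict derivative.
  refine ⟨(2 : ℝ) • D, (hD.const_smul (2 : ℝ)).congr_of_eventuallyEq ?_⟩
  filter_upwards [hev] with γ hγ
  rw [toReal_oharaEnergy hα h2 hc2 hγ]
  simp

end Energy

end KnotEnergy

theorem theorem5p1 (n : ℕ) (α p : ℝ) [Fact (1 ≤ p)] (hα : 0 < α) (h2 : 2 < α * p)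
    (hp : α * p < 2 * p + 1) :
    IsOpen (KnotEnergy.injReg ((α * p - 1) / (2 * p)) (2 * p) n) ∧
    (∀ γ ∈ KnotEnergy.injReg ((α * p - 1) / (2 * p)) (2 * p) n,
      KnotEnergy.oharaEnergy α p γ.curve < ⊤) ∧
    ∃ D : KnotEnergy.Slob ((α * p - 1) / (2 * p)) (2 * p) n →
        (KnotEnergy.Slob ((α * p - 1) / (2 * p)) (2 * p) n →L[ℝ] ℝ),
      (∀ γ ∈ KnotEnergy.injReg ((α * p - 1) / (2 * p)) (2 * p) n,
        HasFDerivAt (fun η : KnotEnergy.Slob ((α * p - 1) / (2 * p)) (2 * p) n =>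
          (KnotEnergy.oharaEnergy α p η.curve).toReal) (D γ) γ) ∧
      ContinuousOn D (KnotEnergy.injReg ((α * p - 1) / (2 * p)) (2 * p) n) := by
  obtain ⟨e1, e2, -⟩ := KnotEnergy.exponent_facts (p := p) h2
  have hopen := KnotEnergy.Slob.isOpen_injReg (n := n) e1 e2
  refine ⟨hopen, fun γ hγ => KnotEnergy.oharaEnergy_lt_top hα h2 hγ, fderiv ℝ _, fun γ hγ => ?_,
    KnotEnergy.continuousOn_fderiv_of_hasStrictFDerivAt hopen fun γ hγ =>
      KnotEnergy.strictDiffAt_oharaEnergy hα h2 hγ⟩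
  obtain ⟨D, hD⟩ := KnotEnergy.strictDiffAt_oharaEnergy hα h2 hγ
  exact hD.hasFDerivAt.differentiableAt.hasFDerivAt
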